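/- Let $G$ be a finite group and $V$ a finite-dimensional unitary complex representation of $G$. For $n\ge 0$ let $\mathcal F(n)=\mathcal F^V_{S^0}(n)$ be the $G$-space of all linear subspaces of $V^{n}$ (identified with the orthogonal projections onto them, topologized as a subspace of $\mathrm{End}_{\mathbb C}(V^n)$), and let $\mathcal F_2(n)=\mathcal F^V_{\underline 2_+}(n)$ be the $G$-space of pairs of orthogonal subspaces of $V^n$. Let $\mathcal F(\infty)=\operatorname{colim}_n\mathcal F(n)$ and $\mathcal F_2(\infty)=\operatorname{colim}_n\mathcal F_2(n)$, along the standard inclusions $V^n=V^n\oplus 0\subseteq V^{n+1}$. Let $\eta:\mathcal F(\infty)\to\mathcal F(\infty)$ be the equivariant map induced by $\mathcal F(n)\to\mathcal F(n+1)$, $(W\subseteq V^n)\mapsto (V\oplus W\subseteq V\oplus V^n)$. Put $X_i=\mathcal F(\infty)$ for all $i\ge 0$ and let $\mathrm{Tel}(X_i,\eta)$ be the mapping telescope of $X_0\xrightarrow{\eta}X_1\xrightarrow{\eta}X_2\to\cdots$, with its $G$-action, with base point the image of $0\in X_0$. An equivariant homotopy commutative, associative $H$-space is a $G$-space with a $G$-fixed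 base point and an equivariant product that is unital, associative and commutative up to based equivariant homotopy. An equivariant $H$-space map is a based equivariant map that preserves products up to based equivariant homotopy. A map $A\to B$ of homotopy associative, homotopy commutative $H$-spaces is a homotopy group completion if $\pi_0B$ is an abelian group, $\pi_0A\to\pi_0B$ is the group completion of the abelian monoid $\pi_0A$, and, for every commutative ring $R$, $H_*(A;R)\to H_*(B;R)$ is the localization map $H_*(A;R)\to\mathbb Z[\pi_0B]\otimes_{\mathbb Z[\pi_0A]}H_*(A;R)$. An equivariant $H$-space map $A\to B$ is an equivariant homotopy group completion if $A^K\to B^K$ is a homotopy group completion for every subgroup $K\subseteq G$. The inclusion $\mathcal F_2(\infty)\to\mathcal F(\infty)\times\mathcal F(\infty)$ has an equivariant homotopy inverse. Let $\mu:\mathcal F(\infty)\times\mathcal F(\infty)\to\mathcal F(\infty)$ be the composite of any such equivariant homotopy inverse with the map $\mathcal F_2(\infty)\to\mathcal F(\infty)$, $(W_1,W_2)\mapsto W_1\oplus W_2$. **Theorem.** $\mathcal F(\infty)$ with the product $\mu$ and base point $0$ is an equivariant homotopy commutative, associative $H$-space. There is a structure of equivariant homotopy commutative, associative $H$-space on $\mathrm{Tel}(X_i,\eta)$,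 with the base point above, whose product is induced by the maps $\mu:X_n\times X_n\to X_{2n}$ (that is, its restriction to $X_n\times X_n$ is, for every $n\ge 0$, equivariantly homotopic to $X_n\times X_n\xrightarrow{\mu}X_{2n}\to\mathrm{Tel}(X_i,\eta)$), such that the canonical map $$\mathcal F^V_{S^0}(\infty)=X_0\longrightarrow \mathrm{Tel}(X_i,\eta)$$ is an equivariant homotopy group completion. -/

import Mathlib

universe u v w

noncomputable section

open unitInterval

namespace TelGC

/-! ## Homotopy commutative, homotopy associative H-spaces -/

section HSpaces

variable (X : Type u) [TopologicalSpace X]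

/-- Reassociation `(X × X) × X → X × (X × X)`. -/
def assocMap : C((X × X) × X, X × (X × X)) where
  toFun p := (p.1.1, p.1.2, p.2)
  continuous_toFun := by fun_prop

/-- A homotopy associative, homotopy commutative H-space (all homotopies are based). -/
structure HCommSpace extends HSpace X where
  assoc : (hmul.comp (hmul.prodMap (.id X))).HomotopicRel
    ((hmul.comp ((ContinuousMap.id X).prodMap hmul)).comp (assocMap X)) {((e, e), e)}
  comm : hmul.HomotopicRel (hmul.comp ContinuousMap.prodSwap) {(e, e)}

variable {X}

namespace HCommSpace

variable (A : HCommSpace X)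

/-- Left translation by a point. -/
def leftMul (a : X) : C(X, X) := A.hmul.comp ((ContinuousMap.const X a).prodMk (.id X))

theorem joined_of_homotopic {Y Z : Type*} [TopologicalSpace Y] [TopologicalSpace Z]
    {f g : C(Y, Z)} (h : f.Homotopic g) (y : Y) : Joined (f y) (g y) := by
  obtain ⟨H⟩ := h
  exact ⟨H.evalAt y⟩

theorem joined_map {Y Z : Type*} [TopologicalSpace Y] [TopologicalSpace Z]
    (f : C(Y, Z)) {x y : Y} (h : Joined x y) : Joined (f x) (f y) := by
  obtain ⟨p⟩ := h
  exact ⟨p.map f.continuous⟩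

theorem joined_prod {Y Z : Type*} [TopologicalSpace Y] [TopologicalSpace Z]
    {x y : Y} {z t : Z} (h : Joined x y) (k : Joined z t) : Joined (x, z) (y, t) := by
  obtain ⟨p⟩ := h
  obtain ⟨q⟩ := k
  exact ⟨p.prod q⟩

/-- The set of path components of the H-space. -/
def Pi0 (_A : HCommSpace X) : Type u := ZerothHomotopy X

/-- The path component of a point. -/
def toPi0 (x : X) : A.Pi0 := ZerothHomotopy.mk x

/-- The monoid structure on the path components induced by the product of the H-space. -/
instance : CommMonoid A.Pi0 where
  mul := Quotient.map₂ (fun x y => A.hmul (x, y))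
    fun _ _ h _ _ k => joined_map A.hmul (joined_prod h k)
  one := A.toPi0 A.e
  mul_assoc := by
    rintro ⟨x⟩ ⟨y⟩ ⟨z⟩
    exact Quotient.sound (joined_of_homotopic A.assoc.homotopic ((x, y), z))
  one_mul := by
    rintro ⟨x⟩
    exact Quotient.sound (joined_of_homotopic ⟨A.eHmul.toHomotopy⟩ x)
  mul_one := by
    rintro ⟨x⟩
    exact Quotient.sound (joined_of_homotopic ⟨A.hmulE.toHomotopy⟩ x)
  mul_comm := by
    rintro ⟨x⟩ ⟨y⟩
    exact Quotient.sound (joined_of_homotopic A.comm.homotopic (x, y))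

theorem toPi0_mul (x y : X) : A.toPi0 (A.hmul (x, y)) = A.toPi0 x * A.toPi0 y := rfl

theorem toPi0_e : A.toPi0 A.e = 1 := rfl

end HCommSpace

/-- A map of H-spaces: a based map that preserves the products up to (based) homotopy. -/
structure IsHMap {Y : Type u} [TopologicalSpace Y] (A : HCommSpace X) (B : HCommSpace Y)
    (f : C(X, Y)) : Prop where
  map_e : f A.e = B.e
  map_hmul : (f.comp A.hmul).HomotopicRel (B.hmul.comp (f.prodMap f)) {(A.e, A.e)}

/-- The homomorphism on path components induced by a map of H-spaces. -/
def IsHMap.pi0 {Y : Type u} [TopologicalSpace Y] {A : HCommSpace X} {B : HCommSpace Y}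
    {f : C(X, Y)} (hf : IsHMap A B f) : A.Pi0 →* B.Pi0 where
  toFun := Quotient.map f fun _ _ h => HCommSpace.joined_map f h
  map_one' := congrArg B.toPi0 hf.map_e
  map_mul' := by
    rintro ⟨x⟩ ⟨y⟩
    exact Quotient.sound (HCommSpace.joined_of_homotopic hf.map_hmul.homotopic (x, y))

/-! ## Homology with coefficients and the action of path components -/

/-- Singular homology `H_n(X; R)`. -/
abbrev singH (R : Type v) [CommRing R] (n : ℕ) (X : Type u) [TopologicalSpace X] :
    ModuleCat.{max u v} R :=
  ((AlgebraicTopology.singularHomologyFunctor.{u} (ModuleCat.{max u v} R) n).obj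
    (ModuleCat.of R (ULift.{u} R))).obj (TopCat.of X)

/-- The map induced on singular homology. -/
def singHMap (R : Type v) [CommRing R] (n : ℕ) {X Y : Type u} [TopologicalSpace X]
    [TopologicalSpace Y] (f : C(X, Y)) : singH R n X →ₗ[R] singH R n Y :=
  (((AlgebraicTopology.singularHomologyFunctor.{u} (ModuleCat.{max u v} R) n).obj
    (ModuleCat.of R (ULift.{u} R))).map (TopCat.ofHom f)).hom

section singHMap

variable (R : Type v) [CommRing R] (n : ℕ)

theorem singHMap_id : singHMap R n (ContinuousMap.id X) = LinearMap.id := by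
  unfold singHMap
  rw [TopCat.ofHom_id, CategoryTheory.Functor.map_id]
  rfl

theorem singHMap_comp {Y Z : Type u} [TopologicalSpace Y] [TopologicalSpace Z]
    (g : C(Y, Z)) (f : C(X, Y)) :
    singHMap R n (g.comp f) = singHMap R n g ∘ₗ singHMap R n f := by
  unfold singHMap
  rw [TopCat.ofHom_comp, CategoryTheory.Functor.map_comp]
  rfl

theorem singHMap_congr {Y : Type u} [TopologicalSpace Y] {f g : C(X, Y)} (h : f.Homotopic g) :
    singHMap R n f = singHMap R n g := by
  obtain ⟨H⟩ := h
  have H' : TopCat.Homotopy (TopCat.ofHom f) (TopCat.ofHom g) := H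
  exact congrArg ModuleCat.Hom.hom
    (H'.congr_homologyMap_singularChainComplexFunctor (ModuleCat.of R (ULift.{u} R)) n)

end singHMap

namespace HCommSpace

variable (A : HCommSpace X)

theorem leftMul_congr {a b : X} (h : Joined a b) : (A.leftMul a).Homotopic (A.leftMul b) := by
  obtain ⟨p⟩ := h
  exact ⟨{ toFun := fun q => A.hmul (p q.1, q.2)
           continuous_toFun := by fun_prop
           map_zero_left := fun x => by simp [leftMul]
           map_one_left := fun x => by simp [leftMul] }⟩

theorem leftMul_e : (A.leftMul A.e).Homotopic (.id X) := ⟨A.eHmul.toHomotopy⟩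

theorem leftMul_hmul (a b : X) :
    (A.leftMul (A.hmul (a, b))).Homotopic ((A.leftMul a).comp (A.leftMul b)) := by
  obtain ⟨H⟩ := A.assoc
  exact ⟨{ toFun := fun q => H (q.1, ((a, b), q.2))
           continuous_toFun := by fun_prop
           map_zero_left := fun x => by simp [leftMul]
           map_one_left := fun x => H.apply_one ((a, b), x) }⟩

/-- The action of path components on homology by left translations. -/
def pi0Action (R : Type v) [CommRing R] (n : ℕ) : A.Pi0 →* Module.End R (singH R n X) where
  toFun := Quotient.lift (fun a => singHMap R n (A.leftMul a))
    fun _ _ h => singHMap_congr R n (A.leftMul_congr h)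
  map_one' := (singHMap_congr R n A.leftMul_e).trans (singHMap_id R n)
  map_mul' := by
    rintro ⟨a⟩ ⟨b⟩
    exact (singHMap_congr R n (A.leftMul_hmul a b)).trans (singHMap_comp R n _ _)

/-- `H_n(X; R)`, regarded as a module over the monoid ring `ℤ[π₀ X]`. -/
def Hlgy (_A : HCommSpace X) (R : Type v) [CommRing R] (n : ℕ) : Type (max u v) := singH R n X

instance (R : Type v) [CommRing R] (n : ℕ) : AddCommGroup (A.Hlgy R n) :=
  inferInstanceAs (AddCommGroup (singH R n X))

instance (R : Type v) [CommRing R] (n : ℕ) : Module (MonoidAlgebra ℤ A.Pi0) (A.Hlgy R n) :=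
  Module.compHom (singH R n X)
    (MonoidAlgebra.lift ℤ (Module.End R (singH R n X)) A.Pi0 (A.pi0Action R n)).toRingHom

theorem smul_toPi0 (R : Type v) [CommRing R] (n : ℕ) (k : ℤ) (a : X) (c : A.Hlgy R n) :
    (MonoidAlgebra.single (A.toPi0 a) k : MonoidAlgebra ℤ A.Pi0) • c =
      k • (singHMap R n (A.leftMul a) c : A.Hlgy R n) := by
  change (MonoidAlgebra.lift ℤ (Module.End R (singH R n X)) A.Pi0 (A.pi0Action R n)
    (MonoidAlgebra.single (A.toPi0 a) k)) c = _
  rw [MonoidAlgebra.lift_single]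
  rfl

end HCommSpace

namespace IsHMap

variable {Y : Type u} [TopologicalSpace Y] {A : HCommSpace X} {B : HCommSpace Y}
    {f : C(X, Y)}

/-- The ring homomorphism `ℤ[π₀ X] → ℤ[π₀ Y]`. -/
def monoidRingMap (hf : IsHMap A B f) : MonoidAlgebra ℤ A.Pi0 →+* MonoidAlgebra ℤ B.Pi0 :=
  MonoidAlgebra.mapDomainRingHom ℤ hf.pi0

theorem comp_leftMul (hf : IsHMap A B f) (a : X) :
    (f.comp (A.leftMul a)).Homotopic ((B.leftMul (f a)).comp f) := by
  obtain ⟨H⟩ := hf.map_hmul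
  exact ⟨{ toFun := fun q => H (q.1, (a, q.2))
           continuous_toFun := by fun_prop
           map_zero_left := fun x => by simp [HCommSpace.leftMul]
           map_one_left := fun x => by simp [HCommSpace.leftMul] }⟩

theorem singHMap_smul (hf : IsHMap A B f) (R : Type v) [CommRing R] (n : ℕ)
    (φ : A.Hlgy R n →+ B.Hlgy R n) (hφ : ∀ c, φ c = singHMap R n f c)
    (r : MonoidAlgebra ℤ A.Pi0) (c : A.Hlgy R n) : φ (r • c) = hf.monoidRingMap r • φ c := by
  induction r using MonoidAlgebra.induction_linear with
  | zero => rw [map_zero, zero_smul, zero_smul, map_zero]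
  | add r s hr hs => rw [map_add, add_smul, add_smul, ← hr, ← hs, map_add]
  | single a k =>
    obtain ⟨a⟩ := a
    have e : hf.monoidRingMap (MonoidAlgebra.single (A.toPi0 a) k) =
        MonoidAlgebra.single (B.toPi0 (f a)) k := by
      simp only [monoidRingMap, MonoidAlgebra.mapDomainRingHom_apply,
        MonoidAlgebra.mapDomain_single]
      rfl
    change φ ((MonoidAlgebra.single (A.toPi0 a) k : MonoidAlgebra ℤ A.Pi0) • c) =
      hf.monoidRingMap (MonoidAlgebra.single (A.toPi0 a) k) • φ c
    rw [e, HCommSpace.smul_toPi0, HCommSpace.smul_toPi0]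
    refine (map_zsmul φ k _).trans ?_
    congr 1
    have h := singHMap_congr R n (hf.comp_leftMul a)
    rw [singHMap_comp, singHMap_comp] at h
    exact (hφ _).trans ((LinearMap.congr_fun h c).trans
      (congrArg (singHMap R n (B.leftMul (f a))) (hφ c).symm))

/-- The map induced on homology, as a map which is semilinear along `ℤ[π₀ X] → ℤ[π₀ Y]`. -/
def hlgyMap (hf : IsHMap A B f) (R : Type v) [CommRing R] (n : ℕ) :
    A.Hlgy R n →ₛₗ[hf.monoidRingMap] B.Hlgy R n where
  toFun := singHMap R n f
  map_add' := map_add (singHMap R n f)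
  map_smul' := hf.singHMap_smul R n (singHMap R n f).toAddMonoidHom fun _ => rfl

/-- `H_n(X; R) → H_n(Y; R)` is the localization map
`H_n(X; R) → ℤ[π₀ Y] ⊗_{ℤ[π₀ X]} H_n(X; R)`. -/
def IsLocalizationOnHomology (hf : IsHMap A B f) (R : Type v) [CommRing R] (n : ℕ) : Prop :=
  letI : Algebra (MonoidAlgebra ℤ A.Pi0) (MonoidAlgebra ℤ B.Pi0) := hf.monoidRingMap.toAlgebra
  letI : Module (MonoidAlgebra ℤ A.Pi0) (B.Hlgy R n) :=
    Module.compHom (B.Hlgy R n) hf.monoidRingMap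
  haveI : IsScalarTower (MonoidAlgebra ℤ A.Pi0) (MonoidAlgebra ℤ B.Pi0) (B.Hlgy R n) :=
    ⟨fun r s c => mul_smul (hf.monoidRingMap r) s c⟩
  IsBaseChange (MonoidAlgebra ℤ B.Pi0)
    ({ toFun := hf.hlgyMap R n
       map_add' := map_add (hf.hlgyMap R n)
       map_smul' := (hf.hlgyMap R n).map_smulₛₗ } :
      A.Hlgy R n →ₗ[MonoidAlgebra ℤ A.Pi0] B.Hlgy R n)

end IsHMap

/-- A homotopy group completion: an H-space map `f : X → Y` such that `π₀ Y` is an (abelian) group,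
`π₀ X → π₀ Y` is the group completion, and `H_*(X; R) → H_*(Y; R)` is the localization
`H_*(X; R) → ℤ[π₀ Y] ⊗_{ℤ[π₀ X]} H_*(X; R)` for every commutative ring `R`. -/
structure IsHomotopyGroupCompletion {Y : Type u} [TopologicalSpace Y] (A : HCommSpace X)
    (B : HCommSpace Y) (f : C(X, Y)) : Prop where
  isHMap : IsHMap A B f
  isUnit_pi0 : ∀ b : B.Pi0, IsUnit b
  pi0 : Submonoid.IsLocalizationMap (⊤ : Submonoid A.Pi0) isHMap.pi0
  homology : ∀ (R : Type v) [CommRing R] (n : ℕ), isHMap.IsLocalizationOnHomology R n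

end HSpaces

/-! ## The equivariant versions -/

section Equivariant

variable (G : Type w) [Group G]

/-- `f` is `G`-equivariant. -/
def IsEquivariant {X Y : Type*} [TopologicalSpace X] [TopologicalSpace Y] [MulAction G X]
    [MulAction G Y] (f : C(X, Y)) : Prop :=
  ∀ (g : G) (x : X), f (g • x) = g • f x

/-- `f₀` and `f₁` are homotopic through `G`-equivariant maps. -/
def GHomotopic {X Y : Type*} [TopologicalSpace X] [TopologicalSpace Y] [MulAction G X]
    [MulAction G Y] (f₀ f₁ : C(X, Y)) : Prop :=
  ∃ H : f₀.Homotopy f₁, ∀ (g : G) (t : I) (x : X), H (t, g • x) = g • H (t, x)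

/-- `f₀` and `f₁` are homotopic relative to `S` through `G`-equivariant maps. -/
def GHomotopicRel {X Y : Type*} [TopologicalSpace X] [TopologicalSpace Y] [MulAction G X]
    [MulAction G Y] (f₀ f₁ : C(X, Y)) (S : Set X) : Prop :=
  ∃ H : f₀.HomotopyRel f₁ S, ∀ (g : G) (t : I) (x : X), H (t, g • x) = g • H (t, x)

/-- An equivariant homotopy associative, homotopy commutative H-space: the unit is a fixed point,
the product is equivariant, and all homotopies are (based and) equivariant. -/
structure GHCommSpace (X : Type u) [TopologicalSpace X] [MulAction G X] extends HSpace X where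
  smul_e : ∀ g : G, g • e = e
  hmul_smul : ∀ (g : G) (p : X × X), hmul (g • p) = g • hmul p
  eHmul_smul : ∀ (g : G) (t : I) (x : X), eHmul (t, g • x) = g • eHmul (t, x)
  hmulE_smul : ∀ (g : G) (t : I) (x : X), hmulE (t, g • x) = g • hmulE (t, x)
  assoc : GHomotopicRel G (hmul.comp (hmul.prodMap (.id X)))
    ((hmul.comp ((ContinuousMap.id X).prodMap hmul)).comp (assocMap X)) {((e, e), e)}
  comm : GHomotopicRel G hmul (hmul.comp ContinuousMap.prodSwap) {(e, e)}

variable {G}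

/-- The space `X^K` of fixed points of a subgroup. -/
abbrev Fix (K : Subgroup G) (X : Type*) [MulAction G X] : Type _ := {x : X // ∀ k ∈ K, k • x = x}

/-- The map `X^K → Y^K` induced by an equivariant map. -/
def fixMap (K : Subgroup G) {X Y : Type*} [TopologicalSpace X] [TopologicalSpace Y] [MulAction G X]
    [MulAction G Y] (f : C(X, Y)) (hf : IsEquivariant G f) : C(Fix K X, Fix K Y) where
  toFun x := ⟨f x.1, fun k hk => by rw [← hf, x.2 k hk]⟩
  continuous_toFun := by fun_prop

/-- The H-space structure on the fixed points of an equivariant H-space. -/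
def GHCommSpace.fixed {X : Type u} [TopologicalSpace X] [MulAction G X] (A : GHCommSpace G X)
    (K : Subgroup G) : HCommSpace (Fix K X) where
  hmul :=
    { toFun := fun p => ⟨A.hmul (p.1.1, p.2.1), fun k hk => by
        rw [← A.hmul_smul, Prod.smul_mk, p.1.2 k hk, p.2.2 k hk]⟩
      continuous_toFun := by fun_prop }
  e := ⟨A.e, fun k _ => A.smul_e k⟩
  hmul_e_e := Subtype.ext A.hmul_e_e
  eHmul :=
    { toFun := fun q => ⟨A.eHmul (q.1, q.2.1), fun k hk => by
        rw [← A.eHmul_smul, q.2.2 k hk]⟩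
      continuous_toFun := by fun_prop
      map_zero_left := fun x => Subtype.ext (A.eHmul.apply_zero x.1)
      map_one_left := fun x => Subtype.ext (A.eHmul.apply_one x.1)
      prop' := fun t x hx => Subtype.ext (A.eHmul.eq_fst t (congrArg Subtype.val hx)) }
  hmulE :=
    { toFun := fun q => ⟨A.hmulE (q.1, q.2.1), fun k hk => by
        rw [← A.hmulE_smul, q.2.2 k hk]⟩
      continuous_toFun := by fun_prop
      map_zero_left := fun x => Subtype.ext (A.hmulE.apply_zero x.1)
      map_one_left := fun x => Subtype.ext (A.hmulE.apply_one x.1)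
      prop' := fun t x hx => Subtype.ext (A.hmulE.eq_fst t (congrArg Subtype.val hx)) }
  assoc := by
    obtain ⟨H, hH⟩ := A.assoc
    exact ⟨{
      toFun := fun q => ⟨H (q.1, ((q.2.1.1.1, q.2.1.2.1), q.2.2.1)), fun k hk => by
        rw [← hH, Prod.smul_mk, Prod.smul_mk, q.2.1.1.2 k hk, q.2.1.2.2 k hk, q.2.2.2 k hk]⟩
      continuous_toFun := by fun_prop
      map_zero_left := fun x => Subtype.ext (H.apply_zero _)
      map_one_left := fun x => Subtype.ext (H.apply_one _)
      prop' := fun t x hx => Subtype.ext (H.eq_fst t (by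
        rw [Set.mem_singleton_iff] at hx
        subst hx
        rfl)) }⟩
  comm := by
    obtain ⟨H, hH⟩ := A.comm
    exact ⟨{
      toFun := fun q => ⟨H (q.1, (q.2.1.1, q.2.2.1)), fun k hk => by
        rw [← hH, Prod.smul_mk, q.2.1.2 k hk, q.2.2.2 k hk]⟩
      continuous_toFun := by fun_prop
      map_zero_left := fun x => Subtype.ext (H.apply_zero _)
      map_one_left := fun x => Subtype.ext (H.apply_one _)
      prop' := fun t x hx => Subtype.ext (H.eq_fst t (by
        rw [Set.mem_singleton_iff] at hx
        subst hx
        rfl)) }⟩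

/-- An equivariant map of equivariant H-spaces: an equivariant based map that preserves the
products up to an equivariant (based) homotopy. -/
structure IsGHMap {X Y : Type u} [TopologicalSpace X] [TopologicalSpace Y] [MulAction G X]
    [MulAction G Y] (A : GHCommSpace G X) (B : GHCommSpace G Y) (f : C(X, Y)) : Prop where
  equivariant : IsEquivariant G f
  map_e : f A.e = B.e
  map_hmul : GHomotopicRel G (f.comp A.hmul) (B.hmul.comp (f.prodMap f)) {(A.e, A.e)}

/-- An equivariant homotopy group completion: an equivariant H-space map which restricts to a
homotopy group completion `X^K → Y^K` for every subgroup `K`. -/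
structure IsEquivariantHomotopyGroupCompletion {X Y : Type u} [TopologicalSpace X]
    [TopologicalSpace Y] [MulAction G X] [MulAction G Y] (A : GHCommSpace G X)
    (B : GHCommSpace G Y) (f : C(X, Y)) : Prop where
  isGHMap : IsGHMap A B f
  fixed : ∀ K : Subgroup G,
    IsHomotopyGroupCompletion.{u, v} (A.fixed K) (B.fixed K) (fixMap K f isGHMap.equivariant)

end Equivariant

/-! ## Sequences of `G`-spaces, their colimits and mapping telescopes -/

section Sequences

/-- A sequence `X 0 → X 1 → X 2 → ⋯` of `G`-spaces and equivariant maps. -/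
structure GSeq (G : Type w) [Group G] where
  /-- the spaces -/
  X : ℕ → Type u
  /-- the topologies -/
  [top : ∀ n, TopologicalSpace (X n)]
  /-- the actions -/
  [act : ∀ n, MulAction G (X n)]
  /-- each group element acts continuously -/
  [cont : ∀ n, ContinuousConstSMul G (X n)]
  /-- the transition maps -/
  map : ∀ n, C(X n, X (n + 1))
  map_smul : ∀ n, IsEquivariant G (map n)

attribute [instance] GSeq.top GSeq.act GSeq.cont

variable {G : Type w} [Group G]

namespace GSeq

variable (S : GSeq.{u, w} G)

/-- The relation identifying `x` with its image in the next space. -/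
inductive ColimRel : (Σ n, S.X n) → (Σ n, S.X n) → Prop
  | step (n : ℕ) (x : S.X n) : ColimRel ⟨n, x⟩ ⟨n + 1, S.map n x⟩

/-- The colimit of a sequence, with the colimit topology. -/
def Colim : Type u := Quot S.ColimRel

instance : TopologicalSpace S.Colim := inferInstanceAs (TopologicalSpace (Quot S.ColimRel))

/-- The canonical map to the colimit. -/
def ι (n : ℕ) : C(S.X n, S.Colim) where
  toFun x := Quot.mk _ ⟨n, x⟩
  continuous_toFun := continuous_quot_mk.comp continuous_sigmaMk

theorem ι_map (n : ℕ) (x : S.X n) : S.ι (n + 1) (S.map n x) = S.ι n x :=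
  (Quot.sound (ColimRel.step n x)).symm

instance : MulAction G S.Colim where
  smul g := Quot.map (fun p => ⟨p.1, g • p.2⟩) (by
    rintro _ _ ⟨n, x⟩
    dsimp only
    rw [← S.map_smul n g x]
    exact ColimRel.step n (g • x))
  one_smul := by
    rintro ⟨n, x⟩
    exact congrArg (S.ι n) (one_smul G x)
  mul_smul := by
    rintro g h ⟨n, x⟩
    exact congrArg (S.ι n) (mul_smul g h x)

theorem ι_smul (n : ℕ) : IsEquivariant G (S.ι n) := fun _ _ => rfl

instance : ContinuousConstSMul G S.Colim where
  continuous_const_smul g := continuous_quot_lift _ <|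
    continuous_sigma fun n => (S.ι n).continuous.comp (continuous_const_smul g)

/-- The map from the colimit induced by a compatible family of maps. -/
def desc {Y : Type*} [TopologicalSpace Y] (f : ∀ n, C(S.X n, Y))
    (hf : ∀ n x, f (n + 1) (S.map n x) = f n x) : C(S.Colim, Y) where
  toFun := Quot.lift (fun p => f p.1 p.2) (by
    rintro _ _ ⟨n, x⟩
    exact (hf n x).symm)
  continuous_toFun := continuous_quot_lift _ (continuous_sigma fun n => (f n).continuous)

/-- The relation on `⨿ X n × [0,1]` that identifies `(x, 1)`, `x ∈ X n`, with
`(map x, 0)`, `map x ∈ X (n + 1)`. -/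
inductive TelRel : (Σ n, S.X n × I) → (Σ n, S.X n × I) → Prop
  | glue (n : ℕ) (x : S.X n) : TelRel ⟨n, (x, 1)⟩ ⟨n + 1, (S.map n x, 0)⟩

/-- The mapping telescope of a sequence. -/
def Tel : Type u := Quot S.TelRel

instance : TopologicalSpace S.Tel := inferInstanceAs (TopologicalSpace (Quot S.TelRel))

/-- The `n`-th cylinder of the telescope. -/
def telCyl (n : ℕ) : C(S.X n × I, S.Tel) where
  toFun p := Quot.mk _ ⟨n, p⟩
  continuous_toFun := continuous_quot_mk.comp continuous_sigmaMk

/-- The canonical map `X n → Tel`, onto the front end of the `n`-th cylinder. -/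
def telι (n : ℕ) : C(S.X n, S.Tel) where
  toFun x := S.telCyl n (x, 0)
  continuous_toFun := by fun_prop

instance : MulAction G S.Tel where
  smul g := Quot.map (fun p => ⟨p.1, (g • p.2.1, p.2.2)⟩) (by
    rintro _ _ ⟨n, x⟩
    dsimp only
    rw [← S.map_smul n g x]
    exact TelRel.glue n (g • x))
  one_smul := by
    rintro ⟨n, x, t⟩
    exact congrArg (fun y => S.telCyl n (y, t)) (one_smul G x)
  mul_smul := by
    rintro g h ⟨n, x, t⟩
    exact congrArg (fun y => S.telCyl n (y, t)) (mul_smul g h x)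

theorem telι_smul (n : ℕ) : IsEquivariant G (S.telι n) := fun _ _ => rfl

instance : ContinuousConstSMul G S.Tel where
  continuous_const_smul g := continuous_quot_lift _ <|
    continuous_sigma fun n => (S.telCyl n).continuous.comp
      ((continuous_fst.const_smul g).prodMk continuous_snd)

end GSeq

end Sequences

/-! ## The spaces of a unitary representation -/

section Grassmannians

variable {G : Type w} [Group G] {V : Type u} [NormedAddCommGroup V] [InnerProductSpace ℂ V]

/-- The Hilbert space `V^n`. -/
abbrev VPow (V : Type u) [NormedAddCommGroup V] [InnerProductSpace ℂ V] (n : ℕ) : Type u :=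
  PiLp 2 (fun _ : Fin n => V)

/-- `α_* : V^m → V^n` for an injection `α`: the `i`-th coordinate goes to the `α i`-th one. -/
def extend {m n : ℕ} (α : Fin m ↪ Fin n) : VPow V m →L[ℂ] VPow V n where
  toFun v := WithLp.toLp 2 fun j => ∑ i, if α i = j then v i else 0
  map_add' v w := by
    ext j
    simp only [PiLp.add_apply, ← Finset.sum_add_distrib]
    exact Finset.sum_congr rfl fun i _ => by split_ifs <;> simp
  map_smul' c v := by
    ext j
    simp only [PiLp.smul_apply, Finset.smul_sum, RingHom.id_apply]
    exact Finset.sum_congr rfl fun i _ => by split_ifs <;> simp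
  cont := by
    refine (PiLp.continuous_toLp 2 _).comp (continuous_pi fun j => ?_)
    refine continuous_finsetSum _ fun i _ => ?_
    split_ifs
    · fun_prop
    · fun_prop

/-- `α^* : V^n → V^m` for an injection `α`: the coordinates with index in the image of `α`. -/
def restrict {m n : ℕ} (α : Fin m ↪ Fin n) : VPow V n →L[ℂ] VPow V m where
  toFun v := WithLp.toLp 2 fun i => v (α i)
  map_add' v w := rfl
  map_smul' c v := rfl
  cont := by
    refine (PiLp.continuous_toLp 2 _).comp (continuous_pi fun j => ?_)
    fun_prop

@[simp]
theorem extend_apply {m n : ℕ} (α : Fin m ↪ Fin n) (v : VPow V m) (j : Fin n) :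
    extend α v j = ∑ i, if α i = j then v i else 0 := rfl

@[simp]
theorem restrict_apply {m n : ℕ} (α : Fin m ↪ Fin n) (v : VPow V n) (i : Fin m) :
    restrict α v i = v (α i) := rfl

theorem restrict_extend {m n : ℕ} (α : Fin m ↪ Fin n) (v : VPow V m) :
    restrict α (extend α v) = v := by
  ext i
  simp

theorem restrict_extend_of_ne {k m n : ℕ} (α : Fin m ↪ Fin n) (β : Fin k ↪ Fin n)
    (h : ∀ i j, α i ≠ β j) (v : VPow V m) : restrict β (extend α v) = 0 := by
  ext j
  simp [h]

theorem extend_extend {k m n : ℕ} (α : Fin m ↪ Fin n) (β : Fin k ↪ Fin m) (v : VPow V k) :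
    extend α (extend β v) = extend (β.trans α) v := by
  ext j
  simp only [extend_apply, Function.Embedding.trans_apply]
  have h : ∀ i : Fin m, (if α i = j then ∑ l, (if β l = i then v l else 0) else 0) =
      ∑ l, if β l = i then (if α (β l) = j then v l else 0) else 0 := by
    intro i
    split_ifs with hi
    · refine Finset.sum_congr rfl fun l _ => ?_
      split_ifs with h1 h2
      · rfl
      · exact absurd (h1 ▸ hi) h2
      · rfl
    · refine (Finset.sum_eq_zero fun l _ => ?_).symm
      split_ifs with h1 h2
      · exact absurd (h1 ▸ h2) hi
      · rfl
      · rfl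
  simp only [h]
  rw [Finset.sum_comm]
  exact Finset.sum_congr rfl fun l _ => by simp

theorem inner_extend {m n : ℕ} (α : Fin m ↪ Fin n) (v : VPow V m) (w : VPow V n) :
    inner ℂ (extend α v) w = inner ℂ v (restrict α w) := by
  simp only [PiLp.inner_apply, extend_apply, restrict_apply, sum_inner]
  rw [Finset.sum_comm]
  refine Finset.sum_congr rfl fun i _ => ?_
  rw [Finset.sum_eq_single (α i)]
  · simp
  · intro j _ hj
    rw [if_neg (Ne.symm hj), inner_zero_left]
  · simp

theorem inner_extend_right {m n : ℕ} (α : Fin m ↪ Fin n) (v : VPow V m) (w : VPow V n) :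
    inner ℂ w (extend α v) = inner ℂ (restrict α w) v := by
  rw [← inner_conj_symm, inner_extend, inner_conj_symm]

/-- The space `F^V_{S⁰}(n)` of linear subspaces of `V^n`, each subspace being represented by the
orthogonal projection onto it, with the topology of the space of endomorphisms. This is the space
of `*`-homomorphisms `ℂ → End(V^n)`, a homomorphism corresponding to the image of `1`. -/
def Gr (_ρ : G →* (V ≃ₗᵢ[ℂ] V)) (n : ℕ) : Type u :=
  {p : VPow V n →L[ℂ] VPow V n // (p : VPow V n →ₗ[ℂ] VPow V n).IsSymmetricProjection}

/-- The diagonal action of the group on `V^n`. -/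
def diag (ρ : G →* (V ≃ₗᵢ[ℂ] V)) (n : ℕ) (g : G) : VPow V n →L[ℂ] VPow V n :=
  (LinearIsometryEquiv.piLpCongrRight 2 fun _ : Fin n => ρ g).toContinuousLinearEquiv

variable (ρ : G →* (V ≃ₗᵢ[ℂ] V))

@[simp]
theorem diag_apply (n : ℕ) (g : G) (v : VPow V n) (i : Fin n) : diag ρ n g v i = ρ g (v i) := rfl

theorem diag_one (n : ℕ) (v : VPow V n) : diag ρ n 1 v = v := by
  ext i
  simp

theorem diag_mul (n : ℕ) (g h : G) (v : VPow V n) :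
    diag ρ n (g * h) v = diag ρ n g (diag ρ n h v) := by
  ext i
  simp

theorem inner_diag (n : ℕ) (g : G) (v w : VPow V n) :
    inner ℂ (diag ρ n g v) w = inner ℂ v (diag ρ n g⁻¹ w) := by
  simp only [PiLp.inner_apply, diag_apply]
  refine Finset.sum_congr rfl fun i _ => ?_
  rw [← (ρ g).inner_map_map (v i)]
  congr 1
  have h : ρ g * ρ g⁻¹ = 1 := by rw [← map_mul, mul_inv_cancel, map_one]
  exact (congrArg (fun e : V ≃ₗᵢ[ℂ] V => e (w i)) h).symm

theorem diag_extend {m n : ℕ} (α : Fin m ↪ Fin n) (g : G) (v : VPow V m) :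
    diag ρ n g (extend α v) = extend α (diag ρ m g v) := by
  ext j
  simp only [diag_apply, extend_apply, map_sum]
  exact Finset.sum_congr rfl fun i _ => by split_ifs <;> simp

theorem diag_restrict {m n : ℕ} (α : Fin m ↪ Fin n) (g : G) (v : VPow V n) :
    diag ρ m g (restrict α v) = restrict α (diag ρ n g v) := rfl

namespace Gr

variable {ρ} {n : ℕ}

instance : TopologicalSpace (Gr ρ n) :=
  inferInstanceAs (TopologicalSpace {p : VPow V n →L[ℂ] VPow V n //
    (p : VPow V n →ₗ[ℂ] VPow V n).IsSymmetricProjection})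

theorem continuous_val : Continuous fun p : Gr ρ n => p.1 := continuous_subtype_val

theorem ext {p q : Gr ρ n} (h : ∀ v, p.1 v = q.1 v) : p = q :=
  Subtype.ext (ContinuousLinearMap.ext h)

theorem idem (p : Gr ρ n) (v : VPow V n) : p.1 (p.1 v) = p.1 v :=
  LinearMap.congr_fun p.2.isIdempotentElem v

theorem symm (p : Gr ρ n) (v w : VPow V n) : inner ℂ (p.1 v) w = inner ℂ v (p.1 w) :=
  p.2.isSymmetric v w

/-- A symmetric idempotent endomorphism as a point of the Grassmannian. -/
def of (ρ : G →* (V ≃ₗᵢ[ℂ] V)) (p : VPow V n →L[ℂ] VPow V n) (h₁ : ∀ v, p (p v) = p v)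
    (h₂ : ∀ v w, inner ℂ (p v) w = inner ℂ v (p w)) : Gr ρ n :=
  ⟨p, ⟨LinearMap.ext h₁, h₂⟩⟩

/-- `g` sends a subspace `W` to `g W`, a projection `p` to `g p g⁻¹`. -/
instance : MulAction G (Gr ρ n) where
  smul g p := of ρ (diag ρ n g ∘L p.1 ∘L diag ρ n g⁻¹)
    (fun v => by
      simp only [ContinuousLinearMap.comp_apply]
      rw [← diag_mul ρ n g⁻¹ g, inv_mul_cancel, diag_one, p.idem])
    (fun v w => by
      simp only [ContinuousLinearMap.comp_apply]
      rw [inner_diag, p.symm, inner_diag, inv_inv])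
  one_smul p := ext fun v => by
    change diag ρ n 1 (p.1 (diag ρ n 1⁻¹ v)) = p.1 v
    rw [inv_one, diag_one, diag_one]
  mul_smul g h p := ext fun v => by
    change diag ρ n (g * h) (p.1 (diag ρ n (g * h)⁻¹ v)) =
      diag ρ n g (diag ρ n h (p.1 (diag ρ n h⁻¹ (diag ρ n g⁻¹ v))))
    rw [diag_mul, mul_inv_rev, diag_mul]

theorem smul_apply (g : G) (p : Gr ρ n) (v : VPow V n) :
    (g • p).1 v = diag ρ n g (p.1 (diag ρ n g⁻¹ v)) := rfl

instance : ContinuousConstSMul G (Gr ρ n) where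
  continuous_const_smul _ := Continuous.subtype_mk
    (continuous_const.clm_comp (continuous_subtype_val.clm_comp continuous_const)) _

/-- The zero subspace. -/
def bot (ρ : G →* (V ≃ₗᵢ[ℂ] V)) (n : ℕ) : Gr ρ n := of ρ 0 (by simp) (by simp)

/-- The whole space `V^n`. -/
def top (ρ : G →* (V ≃ₗᵢ[ℂ] V)) (n : ℕ) : Gr ρ n :=
  of ρ (ContinuousLinearMap.id ℂ _) (by simp) (by simp)

theorem smul_bot (g : G) : g • bot ρ n = bot ρ n := ext fun _ => by
  rw [smul_apply]
  exact map_zero (diag ρ n g)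

theorem smul_top (g : G) : g • top ρ n = top ρ n := ext fun v => by
  rw [smul_apply]
  change diag ρ n g (diag ρ n g⁻¹ v) = v
  rw [← diag_mul, mul_inv_cancel, diag_one]

/-- An injection `α` sends a subspace `W` to `α_* W`, a projection `p` to `α_* p α^*`. -/
def push {m : ℕ} (α : Fin m ↪ Fin n) : C(Gr ρ m, Gr ρ n) where
  toFun p := of ρ (extend α ∘L p.1 ∘L restrict α)
    (fun v => by
      simp only [ContinuousLinearMap.comp_apply]
      rw [restrict_extend, p.idem])
    (fun v w => by
      simp only [ContinuousLinearMap.comp_apply]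
      rw [inner_extend, p.symm, inner_extend_right])
  continuous_toFun := Continuous.subtype_mk
    (continuous_const.clm_comp (continuous_subtype_val.clm_comp continuous_const)) _

theorem push_apply {m : ℕ} (α : Fin m ↪ Fin n) (p : Gr ρ m) (v : VPow V n) :
    (push α p).1 v = extend α (p.1 (restrict α v)) := rfl

theorem push_smul {m : ℕ} (α : Fin m ↪ Fin n) :
    IsEquivariant G (push α : C(Gr ρ m, Gr ρ n)) := fun g p => ext fun v => by
  rw [push_apply, smul_apply, smul_apply, push_apply, diag_extend, diag_restrict]

theorem push_push {k m : ℕ} (α : Fin m ↪ Fin n) (β : Fin k ↪ Fin m) (p : Gr ρ k) :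
    push α (push β p) = push (β.trans α) p := ext fun v => by
  rw [push_apply, push_apply, push_apply, extend_extend]
  rfl

end Gr

/-- The space `F^V_{2₊}(n)` of pairs of orthogonal subspaces of `V^n`. -/
def OrthPair (ρ : G →* (V ≃ₗᵢ[ℂ] V)) (n : ℕ) : Type u :=
  {w : Gr ρ n × Gr ρ n // ∀ v, w.1.1 (w.2.1 v) = 0}

namespace OrthPair

variable {ρ} {n : ℕ}

instance : TopologicalSpace (OrthPair ρ n) :=
  inferInstanceAs (TopologicalSpace {w : Gr ρ n × Gr ρ n // ∀ v, w.1.1 (w.2.1 v) = 0})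

theorem continuous_val : Continuous fun w : OrthPair ρ n => w.1 := continuous_subtype_val

theorem orth (w : OrthPair ρ n) (v : VPow V n) : w.1.1.1 (w.1.2.1 v) = 0 := w.2 v

theorem orth' (w : OrthPair ρ n) (v : VPow V n) : w.1.2.1 (w.1.1.1 v) = 0 :=
  ext_inner_right ℂ fun x => by
    rw [Gr.symm, Gr.symm, w.orth, inner_zero_left, inner_zero_right]

instance : MulAction G (OrthPair ρ n) where
  smul g w := ⟨g • w.1, fun v => by
    rw [Prod.smul_fst, Prod.smul_snd, Gr.smul_apply, Gr.smul_apply, ← diag_mul ρ n g⁻¹ g,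
      inv_mul_cancel, diag_one, w.orth, map_zero]⟩
  one_smul w := Subtype.ext (one_smul G w.1)
  mul_smul g h w := Subtype.ext (mul_smul g h w.1)

instance : ContinuousConstSMul G (OrthPair ρ n) where
  continuous_const_smul g := Continuous.subtype_mk (continuous_subtype_val.const_smul g) _

/-- The inclusion of the space of orthogonal pairs into the space of all pairs. -/
def incl (ρ : G →* (V ≃ₗᵢ[ℂ] V)) (n : ℕ) : C(OrthPair ρ n, Gr ρ n × Gr ρ n) where
  toFun w := w.1
  continuous_toFun := continuous_subtype_val

/-- The sum `(W₁, W₂) ↦ W₁ ⊕ W₂` of orthogonal subspaces. -/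
def sum (ρ : G →* (V ≃ₗᵢ[ℂ] V)) (n : ℕ) : C(OrthPair ρ n, Gr ρ n) where
  toFun w := Gr.of ρ (w.1.1.1 + w.1.2.1)
    (fun v => by
      simp only [add_apply, map_add]
      rw [Gr.idem, Gr.idem, w.orth, w.orth', add_zero, zero_add])
    (fun v x => by
      simp only [add_apply, inner_add_left, inner_add_right]
      rw [Gr.symm, Gr.symm])
  continuous_toFun := by
    have h₁ := Gr.continuous_val.comp (continuous_fst.comp (continuous_val (ρ := ρ) (n := n)))
    have h₂ := Gr.continuous_val.comp (continuous_snd.comp (continuous_val (ρ := ρ) (n := n)))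
    have : ContinuousAdd (VPow V n →L[ℂ] VPow V n) :=
      (SeminormedAddCommGroup.toIsTopologicalAddGroup
        (E := VPow V n →L[ℂ] VPow V n)).toContinuousAdd
    exact Continuous.subtype_mk (h₁.add h₂) _

theorem sum_apply (w : OrthPair ρ n) (v : VPow V n) : (sum ρ n w).1 v = w.1.1.1 v + w.1.2.1 v := rfl

theorem sum_smul : IsEquivariant G (sum ρ n) := fun g w => Gr.ext fun v => by
  rw [sum_apply, Gr.smul_apply, sum_apply, map_add]
  rfl

/-- The map of orthogonal pairs induced by an injection. -/
def push {m : ℕ} (α : Fin m ↪ Fin n) : C(OrthPair ρ m, OrthPair ρ n) where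
  toFun w := ⟨(Gr.push α w.1.1, Gr.push α w.1.2), fun v => by
    rw [Gr.push_apply, Gr.push_apply, restrict_extend, w.orth, map_zero]⟩
  continuous_toFun := Continuous.subtype_mk
    (((Gr.push α).continuous.comp (continuous_fst.comp continuous_val)).prodMk
      ((Gr.push α).continuous.comp (continuous_snd.comp continuous_val))) _

theorem push_smul {m : ℕ} (α : Fin m ↪ Fin n) :
    IsEquivariant G (push α : C(OrthPair ρ m, OrthPair ρ n)) := fun g w =>
  Subtype.ext (Prod.ext (Gr.push_smul α g w.1.1) (Gr.push_smul α g w.1.2))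

theorem sum_push {m : ℕ} (α : Fin m ↪ Fin n) (w : OrthPair ρ m) :
    sum ρ n (push α w) = Gr.push α (sum ρ m w) := Gr.ext fun v => by
  rw [sum_apply, Gr.push_apply, sum_apply, map_add]
  rfl

end OrthPair

/-- The sequence of the spaces `F^V_{S⁰}(n)` and the standard inclusions. -/
def grSeq : GSeq.{u, w} G where
  X := Gr ρ
  map _ := Gr.push Fin.castSuccEmb
  map_smul _ := Gr.push_smul Fin.castSuccEmb

/-- The sequence of the spaces `F^V_{2₊}(n)` and the standard inclusions. -/
def orthSeq : GSeq.{u, w} G where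
  X := OrthPair ρ
  map _ := OrthPair.push Fin.castSuccEmb
  map_smul _ := OrthPair.push_smul Fin.castSuccEmb

/-- The space `F^V_{S⁰}(∞)`. -/
abbrev GrInf : Type u := (grSeq ρ).Colim

/-- The space `F^V_{2₊}(∞)`. -/
abbrev OrthInf : Type u := (orthSeq ρ).Colim

/-- The point of `F^V_{S⁰}(∞)` given by a subspace of `V^n`. -/
def toInf (n : ℕ) : C(Gr ρ n, GrInf ρ) := (grSeq ρ).ι n

theorem toInf_push (n : ℕ) (p : Gr ρ n) : toInf ρ (n + 1) (Gr.push Fin.castSuccEmb p) =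
    toInf ρ n p := (grSeq ρ).ι_map n p

/-- The map `F^V_{2₊}(∞) → F^V_{S⁰}(∞) × F^V_{S⁰}(∞)`. -/
def inclInf : C(OrthInf ρ, GrInf ρ × GrInf ρ) :=
  (orthSeq ρ).desc (fun n => ((toInf ρ n).prodMap (toInf ρ n)).comp (OrthPair.incl ρ n))
    (fun n w => Prod.ext (toInf_push ρ n w.1.1) (toInf_push ρ n w.1.2))

/-- The map `F^V_{2₊}(∞) → F^V_{S⁰}(∞)`, `(W₁, W₂) ↦ W₁ ⊕ W₂`. -/
def sumInf : C(OrthInf ρ, GrInf ρ) :=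
  (orthSeq ρ).desc (fun n => (toInf ρ n).comp (OrthPair.sum ρ n))
    (fun n w => (congrArg (toInf ρ (n + 1)) (OrthPair.sum_push Fin.castSuccEmb w)).trans
      (toInf_push ρ n (OrthPair.sum ρ n w)))

/-- `μ` is a product on `F^V_{S⁰}(∞)` obtained from the `Γ`-space `k₊ ↦ F^V_{k₊}(∞)`: it is
`W₁ ⊕ W₂` on orthogonal pairs, composed with an equivariant homotopy inverse of the inclusion of
the orthogonal pairs into all pairs. -/
def IsGammaProduct (μ : C(GrInf ρ × GrInf ρ, GrInf ρ)) : Prop :=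
  ∃ r : C(GrInf ρ × GrInf ρ, OrthInf ρ), IsEquivariant G r ∧
    GHomotopic G ((inclInf ρ).comp r) (.id _) ∧ GHomotopic G (r.comp (inclInf ρ)) (.id _) ∧
    μ = (sumInf ρ).comp r

/-- The injection onto the first element. -/
def firstEmb (n : ℕ) : Fin 1 ↪ Fin (n + 1) := ⟨fun _ => 0, fun _ _ _ => Subsingleton.elim _ _⟩

/-- The pair `(V ⊕ 0, 0 ⊕ W)` of orthogonal subspaces of `V ⊕ V^n`. -/
def etaPair (n : ℕ) : C(Gr ρ n, OrthPair ρ (n + 1)) where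
  toFun p := ⟨(Gr.push (firstEmb n) (Gr.top ρ 1), Gr.push (Fin.succEmb n) p), fun v => by
    rw [Gr.push_apply, Gr.push_apply, restrict_extend_of_ne, map_zero, map_zero]
    exact fun i _ => Fin.succ_ne_zero i⟩
  continuous_toFun := Continuous.subtype_mk
    (continuous_const.prodMk (Gr.push (Fin.succEmb n)).continuous) _

/-- The map `η : F^V_{S⁰}(n) → F^V_{S⁰}(n + 1)`, `W ↦ V ⊕ W ⊆ V ⊕ V^n`. -/
def eta (n : ℕ) : C(Gr ρ n, Gr ρ (n + 1)) := (OrthPair.sum ρ (n + 1)).comp (etaPair ρ n)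

theorem eta_smul (n : ℕ) : IsEquivariant G (eta ρ n) := fun g p => by
  have h : etaPair ρ n (g • p) = g • etaPair ρ n p := Subtype.ext (Prod.ext
    ((congrArg (Gr.push (firstEmb n)) (Gr.smul_top g).symm).trans (Gr.push_smul (firstEmb n) g _))
    (Gr.push_smul (Fin.succEmb n) g p))
  exact (congrArg (OrthPair.sum ρ (n + 1)) h).trans (OrthPair.sum_smul g _)

theorem eta_push (n : ℕ) (p : Gr ρ n) : eta ρ (n + 1) (Gr.push Fin.castSuccEmb p) =
    Gr.push Fin.castSuccEmb (eta ρ n p) := by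
  have h : etaPair ρ (n + 1) (Gr.push Fin.castSuccEmb p) =
      OrthPair.push Fin.castSuccEmb (etaPair ρ n p) := Subtype.ext (Prod.ext
    (Gr.push_push Fin.castSuccEmb (firstEmb n) (Gr.top ρ 1)).symm
    ((Gr.push_push _ _ p).trans (Gr.push_push Fin.castSuccEmb (Fin.succEmb n) p).symm))
  exact (congrArg (OrthPair.sum ρ (n + 2)) h).trans (OrthPair.sum_push _ _)

/-- The map `η : F^V_{S⁰}(∞) → F^V_{S⁰}(∞)`. -/
def etaInf : C(GrInf ρ, GrInf ρ) :=
  (grSeq ρ).desc (fun n => (toInf ρ (n + 1)).comp (eta ρ n))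
    (fun n p => (congrArg (toInf ρ (n + 2)) (eta_push ρ n p)).trans
      (toInf_push ρ (n + 1) (eta ρ n p)))

theorem etaInf_smul : IsEquivariant G (etaInf ρ) := by
  rintro g ⟨n, p⟩
  exact congrArg (toInf ρ (n + 1)) (eta_smul ρ n g p)

/-- The sequence `X₀ → X₁ → X₂ → ⋯` in which all spaces are `F^V_{S⁰}(∞)` and all maps are `η`. -/
def etaSeq : GSeq.{u, w} G where
  X _ := GrInf ρ
  map _ := etaInf ρ
  map_smul _ := etaInf_smul ρ

/-- The mapping telescope `Tel(X_i, η)`. -/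
abbrev GrTel : Type u := (etaSeq ρ).Tel

/-- The canonical map `F^V_{S⁰}(∞) = X_i → Tel(X_i, η)`. -/
def toTel (i : ℕ) : C(GrInf ρ, GrTel ρ) := (etaSeq ρ).telι i

/-- The zero subspace, the base point `x₀` of `X₀ = F^V_{S⁰}(∞)`. -/
def zeroInf : GrInf ρ := toInf ρ 0 (Gr.bot ρ 0)

end Grassmannians

end TelGC

end

open TelGC

noncomputable section

open unitInterval

namespace TelGC

/-! ## Operators on finitely supported families -/

section Operators

variable {V : Type u} [NormedAddCommGroup V] [InnerProductSpace ℂ V]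

/-! All spaces are described by operators on families indexed by the integers. A subspace `W` of
`V^n` is replaced by the orthogonal projection onto the sum of `W`, placed in the coordinates `[0,
n)`, and all negative coordinates. This projection does not change under the standard inclusions.
The map `η` becomes translation by one (`Gr.op_eta`): coordinate `-1`, which is always in the image,
moves to `0` and is the added copy of `V`. Translation is invertible on operators, so a point of the
telescope is a pair of a time `t ≥ 0` and a projection that differs from the projection `negProj`
onto the negative coordinates only in a window `[-a, b)` with `a ≤ t` (`opTel_timeTel_injective`,
`ofTel`). Since time can be pushed forward, equivariant maps into the telescope with the same
operators are homotopic (`gHomotopicRel_of_opTel`).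

The product is interleaving: the first summand goes to the even coordinates and the second to the
odd ones (`isum`). It is compatible with translation in the form `X_n × X_n → X_{2n}`
(`isum_shift`). Associativity, commutativity and the unit laws hold up to an injection of the
integers that respects signs, and such an injection acts on the Grassmannian and on the telescope as
the identity up to homotopy: coordinates are rotated one after another to a sparse set, and two
isometries with orthogonal images are rotated into each other (`CIsom.rel_one`). Everything commutes
with the group, which acts on `V` and not on the indices. The same rotations, performed on
orthogonal pairs, show that interleaving is a homotopy inverse of the inclusion of the orthogonal
pairs; hence every admissible `μ` is homotopic to the interleaved sum (`IsGammaProduct.gHomotopic`).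
On the Grassmannian the homotopies are automatically based, because the zero subspace is an isolated
point.

Colimits and telescopes have the quotient topology, but homotopies and products live on product
spaces. This is controlled by the fact that a product of two Hausdorff spaces, each determined by
countably many compact spaces, is again determined by the products of the compact pieces
(`IsCompactFamily.isOpen_prod`). On a piece the windows are uniformly bounded, and continuity is
checked on matrix coefficients.

For the group completion, fix a subgroup `K`. Translation by the point `V` is homotopic to `η`. The
fixed points of the telescope are the increasing union of the open sets of time less than `m`, and
each of these deforms into stage `m`. Simplices are compact, so path components and homology of the
union come from the stages; this says that they are obtained by inverting the class of `V`
(`isHomotopyGroupCompletion_of_telescope`). Inverting `V` suffices, because an invariant subspace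
and its orthogonal complement add up to `V^n` (`exists_compl`), so every component becomes
invertible. Localizing the monoid ring at the powers of one element is then the base change required
by the definition. -/

/-- The space of finitely supported families in `V` indexed by the integers. -/
abbrev VSum (V : Type u) [NormedAddCommGroup V] : Type u := ℤ →₀ V

/-- The ring of linear endomorphisms of `VSum V`. -/
abbrev Op (V : Type u) [NormedAddCommGroup V] [InnerProductSpace ℂ V] : Type u :=
  Module.End ℂ (VSum V)

theorem Op.ext_single {S T : Op V}
    (h : ∀ i v, S (Finsupp.single i v) = T (Finsupp.single i v)) : S = T :=
  Finsupp.lhom_ext h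

/-- The inner product of finitely supported families. -/
def form (x y : VSum V) : ℂ := x.sum fun i v => inner ℂ v (y i)

theorem form_single (i : ℤ) (v : V) (y : VSum V) :
    form (Finsupp.single i v) y = inner ℂ v (y i) :=
  Finsupp.sum_single_index (inner_zero_left _)

theorem form_add_left (x x' y : VSum V) : form (x + x') y = form x y + form x' y :=
  Finsupp.sum_add_index' (fun _ => inner_zero_left _) fun _ _ _ => inner_add_left _ _ _

theorem form_zero_left (y : VSum V) : form 0 y = 0 := Finsupp.sum_zero_index

theorem form_add_right (x y y' : VSum V) : form x (y + y') = form x y + form x y' := by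
  simp only [form, Finsupp.add_apply, inner_add_right, Finsupp.sum_add]

theorem form_neg_left (x y : VSum V) : form (-x) y = -form x y :=
  eq_neg_of_add_eq_zero_left (by rw [← form_add_left, neg_add_cancel, form_zero_left])

theorem form_zero_right (x : VSum V) : form x 0 = 0 := by
  simp [form]

theorem form_neg_right (x y : VSum V) : form x (-y) = -form x y :=
  eq_neg_of_add_eq_zero_left (by rw [← form_add_right, neg_add_cancel, form_zero_right])

theorem form_conj_symm (x y : VSum V) : starRingEnd ℂ (form x y) = form y x := by
  induction x using Finsupp.induction_linear with
  | zero => rw [form_zero_left, form_zero_right, map_zero]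
  | add a b ha hb => rw [form_add_left, form_add_right, map_add, ha, hb]
  | single i v =>
    induction y using Finsupp.induction_linear with
    | zero => rw [form_zero_left, form_zero_right, map_zero]
    | add a b ha hb => rw [form_add_left, form_add_right, map_add, ha, hb]
    | single j w =>
      classical
      rw [form_single, form_single, Finsupp.single_apply, Finsupp.single_apply]
      by_cases h : j = i
      · rw [if_pos h, if_pos h.symm, inner_conj_symm]
      · rw [if_neg h, if_neg (Ne.symm h), inner_zero_right, inner_zero_right, map_zero]

/-- `T` is adjoint to `S`. -/
def Adj (S T : Op V) : Prop := ∀ x y, form (S x) y = form x (T y)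

namespace Adj

theorem of_single {S T : Op V}
    (h : ∀ i v y, form (S (Finsupp.single i v)) y = inner ℂ v (T y i)) : Adj S T := by
  intro x y
  induction x using Finsupp.induction_linear with
  | zero => rw [map_zero, form_zero_left, form_zero_left]
  | add a b ha hb => rw [map_add, form_add_left, form_add_left, ha, hb]
  | single i v => rw [h, form_single]

theorem one : Adj (1 : Op V) 1 := fun _ _ => rfl

theorem mul {S T S' T' : Op V} (h : Adj S T) (h' : Adj S' T') : Adj (S * S') (T' * T) :=
  fun x y => (h (S' x) y).trans (h' x (T y))

theorem add {S T S' T' : Op V} (h : Adj S T) (h' : Adj S' T') : Adj (S + S') (T + T') :=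
  fun x y => by
    rw [LinearMap.add_apply, LinearMap.add_apply, form_add_left, form_add_right, h, h']

theorem symm {S T : Op V} (h : Adj S T) : Adj T S := fun x y => by
  rw [← form_conj_symm, ← h, form_conj_symm]

theorem neg {S T : Op V} (h : Adj S T) : Adj (-S) (-T) := fun x y => by
  rw [LinearMap.neg_apply, LinearMap.neg_apply, form_neg_left, form_neg_right, h]

theorem sub {S T S' T' : Op V} (h : Adj S T) (h' : Adj S' T') : Adj (S - S') (T - T') := by
  rw [sub_eq_add_neg, sub_eq_add_neg]
  exact h.add h'.neg

/-- An adjoint operator in terms of coefficients. -/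
theorem inner_apply {S T : Op V} (h : Adj S T) (i j : ℤ) (v w : V) :
    inner ℂ (S (Finsupp.single i v) j) w = inner ℂ v (T (Finsupp.single j w) i) := by
  classical
  have e : ∀ x : VSum V, form x (Finsupp.single j w) = inner ℂ (x j) w := fun x => by
    induction x using Finsupp.induction_linear with
    | zero => rw [form_zero_left, Finsupp.zero_apply, inner_zero_left]
    | add a b ha hb => rw [form_add_left, ha, hb, Finsupp.add_apply, inner_add_left]
    | single i v =>
      rw [form_single, Finsupp.single_apply, Finsupp.single_apply]
      by_cases hij : i = j
      · rw [if_pos hij, if_pos hij.symm]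
      · rw [if_neg hij, if_neg (Ne.symm hij), inner_zero_left, inner_zero_right]
  rw [← e, h, form_single]

/-- Taking adjoints of `S * p = p * S` gives the claim; an adjoint is determined by its
coefficients. -/
theorem comm_right {S T p : Op V} (hp : Adj p p) (h : Adj S T) (hc : S * p = p * S) :
    T * p = p * T := by
  refine Op.ext_single fun i v => Finsupp.ext fun j => ext_inner_left ℂ fun w => ?_
  rw [← (hp.mul h).inner_apply, ← (h.mul hp).inner_apply, hc]

end Adj

/-- The operator permuting the coordinates by an injection. -/
def mv (V : Type u) [NormedAddCommGroup V] [InnerProductSpace ℂ V] (α : ℤ ↪ ℤ) : Op V :=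
  Finsupp.lmapDomain V ℂ α

/-- The adjoint of `mv V α`. -/
def mvAdj (V : Type u) [NormedAddCommGroup V] [InnerProductSpace ℂ V] (α : ℤ ↪ ℤ) : Op V :=
  Finsupp.lcomapDomain α α.injective

@[simp]
theorem mv_single (α : ℤ ↪ ℤ) (i : ℤ) (v : V) :
    mv V α (Finsupp.single i v) = Finsupp.single (α i) v :=
  Finsupp.mapDomain_single

@[simp]
theorem mvAdj_apply (α : ℤ ↪ ℤ) (x : VSum V) (i : ℤ) : mvAdj V α x i = x (α i) := rfl

@[simp]
theorem mvAdj_single (α : ℤ ↪ ℤ) (i : ℤ) (v : V) :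
    mvAdj V α (Finsupp.single (α i) v) = Finsupp.single i v := by
  classical
  ext j
  rw [mvAdj_apply, Finsupp.single_apply, Finsupp.single_apply]
  exact if_congr α.injective.eq_iff rfl rfl

theorem mvAdj_single_of_ne {α : ℤ ↪ ℤ} {j : ℤ} (h : ∀ i, α i ≠ j) (v : V) :
    mvAdj V α (Finsupp.single j v) = 0 := by
  classical
  ext i
  rw [mvAdj_apply, Finsupp.single_apply, if_neg (h i).symm, Finsupp.zero_apply]

theorem adj_mv (α : ℤ ↪ ℤ) : Adj (mv V α) (mvAdj V α) := Adj.of_single fun i v y => by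
  rw [mv_single, form_single, mvAdj_apply]

theorem mvAdj_mul_mv (α : ℤ ↪ ℤ) : mvAdj V α * mv V α = 1 := Op.ext_single fun i v => by
  rw [Module.End.mul_apply, mv_single, mvAdj_single, Module.End.one_apply]

theorem mvAdj_mul_mv_of_ne {α β : ℤ ↪ ℤ} (h : ∀ i j, α i ≠ β j) : mvAdj V α * mv V β = 0 :=
  Op.ext_single fun i v => by
    rw [Module.End.mul_apply, mv_single, mvAdj_single_of_ne fun j => h j i, LinearMap.zero_apply]

theorem mv_mul_mv (α β : ℤ ↪ ℤ) : mv V α * mv V β = mv V (β.trans α) :=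
  Op.ext_single fun i v => by
    rw [Module.End.mul_apply, mv_single, mv_single, mv_single, Function.Embedding.trans_apply]

theorem mvAdj_mul_mvAdj (α β : ℤ ↪ ℤ) : mvAdj V β * mvAdj V α = mvAdj V (β.trans α) :=
  LinearMap.ext fun _ => Finsupp.ext fun _ => rfl

/-- The diagonal operator with the given real entries. -/
def dg (V : Type u) [NormedAddCommGroup V] [InnerProductSpace ℂ V] (c : ℤ → ℝ) : Op V :=
  Finsupp.lsum ℂ fun i => ((c i : ℝ) : ℂ) • Finsupp.lsingle i

@[simp]
theorem dg_single (c : ℤ → ℝ) (i : ℤ) (v : V) :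
    dg V c (Finsupp.single i v) = Finsupp.single i ((c i : ℂ) • v) := by
  simp [dg]

@[simp]
theorem dg_apply (c : ℤ → ℝ) (x : VSum V) (i : ℤ) : dg V c x i = (c i : ℂ) • x i := by
  classical
  induction x using Finsupp.induction_linear with
  | zero => simp
  | add a b ha hb => rw [map_add, Finsupp.add_apply, ha, hb, Finsupp.add_apply, smul_add]
  | single j v =>
    rw [dg_single, Finsupp.single_apply, Finsupp.single_apply]
    split_ifs with h
    · rw [h]
    · rw [smul_zero]

theorem adj_dg (c : ℤ → ℝ) : Adj (dg V c) (dg V c) := Adj.of_single fun i v y => by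
  rw [dg_single, form_single, dg_apply, inner_smul_left, inner_smul_right, Complex.conj_ofReal]

theorem dg_mul_dg (c d : ℤ → ℝ) : dg V c * dg V d = dg V fun i => c i * d i :=
  Op.ext_single fun i v => by
    rw [Module.End.mul_apply, dg_single, dg_single, dg_single, smul_smul, Complex.ofReal_mul]

theorem dg_add_dg (c d : ℤ → ℝ) : dg V c + dg V d = dg V fun i => c i + d i :=
  Op.ext_single fun i v => by
    rw [LinearMap.add_apply, dg_single, dg_single, dg_single, ← Finsupp.single_add, ← add_smul,
      Complex.ofReal_add]

theorem dg_one : dg V (fun _ => 1) = 1 := Op.ext_single fun i v => by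
  rw [dg_single, Complex.ofReal_one, one_smul, Module.End.one_apply]

theorem dg_zero : dg V (fun _ => 0) = 0 := Op.ext_single fun i v => by
  rw [dg_single, Complex.ofReal_zero, zero_smul, Finsupp.single_zero, LinearMap.zero_apply]

theorem dg_mul_mv (c : ℤ → ℝ) (α : ℤ ↪ ℤ) : dg V c * mv V α = mv V α * dg V fun i => c (α i) :=
  Op.ext_single fun i v => by
    rw [Module.End.mul_apply, Module.End.mul_apply, mv_single, dg_single, dg_single, mv_single]

theorem mvAdj_mul_dg (c : ℤ → ℝ) (α : ℤ ↪ ℤ) :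
    mvAdj V α * dg V c = dg V (fun i => c (α i)) * mvAdj V α :=
  LinearMap.ext fun x => Finsupp.ext fun i => by
    rw [Module.End.mul_apply, Module.End.mul_apply, mvAdj_apply, dg_apply, dg_apply, mvAdj_apply]

/-- The projection onto the negative coordinates. -/
def negProj (V : Type u) [NormedAddCommGroup V] [InnerProductSpace ℂ V] : Op V :=
  dg V fun i => if i < 0 then 1 else 0

theorem adj_negProj : Adj (negProj V) (negProj V) := adj_dg _

theorem negProj_idem : negProj V * negProj V = negProj V :=
  (dg_mul_dg _ _).trans (congrArg (dg V) (funext fun i => by split_ifs <;> norm_num))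

theorem negProj_single_of_neg {i : ℤ} (h : i < 0) (v : V) :
    negProj V (Finsupp.single i v) = Finsupp.single i v := by
  rw [negProj, dg_single, if_pos h, Complex.ofReal_one, one_smul]

theorem negProj_single_of_nonneg {i : ℤ} (h : 0 ≤ i) (v : V) :
    negProj V (Finsupp.single i v) = 0 := by
  rw [negProj, dg_single, if_neg h.not_gt, Complex.ofReal_zero, zero_smul, Finsupp.single_zero]

theorem mv_mul_negProj {α : ℤ ↪ ℤ} (h : ∀ i, α i < 0 ↔ i < 0) :
    mv V α * negProj V = negProj V * mv V α := by
  rw [negProj, dg_mul_mv]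
  simp only [h]

theorem dg_mul_negProj (c : ℤ → ℝ) : dg V c * negProj V = negProj V * dg V c := by
  rw [negProj, dg_mul_dg, dg_mul_dg]
  simp only [mul_comm]

/-! ### Isometries of coordinates -/

/-- `J` is an isometry with adjoint `J'` which respects the splitting into negative and nonnegative
coordinates, and `c` is a bound for its expansion. -/
structure IsIsom (c : ℤ) (J J' : Op V) : Prop where
  inv : J' * J = 1
  adj : Adj J J'
  comm : J * negProj V = negProj V * J
  -- The two bounds are chosen so that transport along `J` takes the window `[-a, b)` into `[-c a, c
  -- b)`: `j < b` gives `l < c b`, and `-a ≤ j` gives `-c a ≤ l`.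
  nonneg : ∀ l w j, J' (Finsupp.single l w) j ≠ 0 → 0 ≤ j → 0 ≤ l ∧ l < c * (j + 1)
  neg : ∀ l w j, J' (Finsupp.single l w) j ≠ 0 → j < 0 → c * j ≤ l ∧ l < 0

namespace IsIsom

variable {c d : ℤ} {J J' K K' : Op V}

theorem comm' (h : IsIsom c J J') : J' * negProj V = negProj V * J' :=
  Adj.comm_right adj_negProj h.adj h.comm

theorem mono (h : IsIsom c J J') (hcd : c ≤ d) : IsIsom d J J' where
  inv := h.inv
  adj := h.adj
  comm := h.comm
  nonneg l w j hj h0 := ⟨(h.nonneg l w j hj h0).1, by nlinarith [(h.nonneg l w j hj h0).2]⟩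
  neg l w j hj h0 := ⟨by nlinarith [(h.neg l w j hj h0).1], (h.neg l w j hj h0).2⟩

theorem one (hc : 1 ≤ c) : IsIsom c (1 : Op V) 1 := by
  classical
  refine IsIsom.mono (c := 1) ⟨one_mul 1, Adj.one, by rw [one_mul, mul_one], ?_, ?_⟩ hc
  · intro l w j hj h0
    rw [Module.End.one_apply, Finsupp.single_apply] at hj
    have : l = j := by
      by_contra h
      exact hj (if_neg h)
    omega
  · intro l w j hj h0
    rw [Module.End.one_apply, Finsupp.single_apply] at hj
    have : l = j := by
      by_contra h
      exact hj (if_neg h)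
    omega

theorem mul (h : IsIsom c J J') (k : IsIsom d K K') (hc : 0 ≤ c) :
    IsIsom (c * d) (J * K) (K' * J') := by
  -- A nonzero coefficient of a composite passes through some intermediate index, and there the two
  -- bounds can be chained.
  have key : ∀ l w j, (K' * J') (Finsupp.single l w) j ≠ 0 →
      ∃ i, J' (Finsupp.single l w) i ≠ 0 ∧
        K' (Finsupp.single i (J' (Finsupp.single l w) i)) j ≠ 0 := by
    intro l w j hj
    by_contra hcon
    push Not at hcon
    refine hj ?_
    rw [Module.End.mul_apply]
    conv_lhs => rw [← Finsupp.sum_single (J' (Finsupp.single l w))]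
    rw [Finsupp.sum, map_sum, Finsupp.finsetSum_apply]
    exact Finset.sum_eq_zero fun i hi => hcon i (Finsupp.mem_support_iff.1 hi)
  refine ⟨?_, h.adj.mul k.adj, ?_, ?_, ?_⟩
  · rw [mul_assoc, ← mul_assoc J', h.inv, one_mul, k.inv]
  · rw [mul_assoc, k.comm, ← mul_assoc, h.comm, mul_assoc]
  · intro l w j hj h0
    obtain ⟨i, h₁, h₂⟩ := key l w j hj
    have h₃ := k.nonneg _ _ _ h₂ h0
    have h₄ := h.nonneg _ _ _ h₁ h₃.1
    refine ⟨h₄.1, h₄.2.trans_le ?_⟩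
    rw [mul_assoc]
    exact mul_le_mul_of_nonneg_left (Int.add_one_le_iff.2 h₃.2) hc
  · intro l w j hj h0
    obtain ⟨i, h₁, h₂⟩ := key l w j hj
    have h₃ := k.neg _ _ _ h₂ h0
    have h₄ := h.neg _ _ _ h₁ h₃.2
    refine ⟨le_trans ?_ h₄.1, h₄.2⟩
    rw [mul_assoc]
    exact mul_le_mul_of_nonneg_left h₃.1 hc

end IsIsom

/-- An injection that respects signs and expands at most by the factor `c`. -/
structure Expands (c : ℤ) (α : ℤ ↪ ℤ) : Prop where
  nonneg : ∀ i, 0 ≤ i → 0 ≤ α i ∧ α i < c * (i + 1)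
  neg : ∀ i, i < 0 → c * i ≤ α i ∧ α i < 0

theorem Expands.neg_iff {c : ℤ} {α : ℤ ↪ ℤ} (h : Expands c α) (i : ℤ) : α i < 0 ↔ i < 0 :=
  ⟨fun hi => by
    by_contra hcon
    exact (h.nonneg i (not_lt.1 hcon)).1.not_gt hi, fun hi => (h.neg i hi).2⟩

theorem Expands.mono {c d : ℤ} {α : ℤ ↪ ℤ} (h : Expands c α) (hcd : c ≤ d) : Expands d α where
  nonneg i hi := ⟨(h.nonneg i hi).1, by nlinarith [(h.nonneg i hi).2]⟩
  neg i hi := ⟨by nlinarith [(h.neg i hi).1], (h.neg i hi).2⟩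

theorem eq_of_mvAdj_single_ne {α : ℤ ↪ ℤ} {l j : ℤ} {w : V}
    (h : mvAdj V α (Finsupp.single l w) j ≠ 0) : l = α j := by
  classical
  rw [mvAdj_apply, Finsupp.single_apply] at h
  by_contra hcon
  exact h (if_neg hcon)

theorem Expands.isIsom {c : ℤ} {α : ℤ ↪ ℤ} (h : Expands c α) : IsIsom c (mv V α) (mvAdj V α) where
  inv := mvAdj_mul_mv α
  adj := adj_mv α
  comm := mv_mul_negProj h.neg_iff
  nonneg _ _ j hj h0 := eq_of_mvAdj_single_ne hj ▸ h.nonneg j h0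
  neg _ _ j hj h0 := eq_of_mvAdj_single_ne hj ▸ h.neg j h0

/-- The coordinate rotation from the identity to `mv V α`. -/
theorem isIsom_dg_add_mv_mul_dg {k : ℤ} {α : ℤ ↪ ℤ} (h : Expands k α) (hk : 1 ≤ k) {c s : ℤ → ℝ}
    (h₁ : ∀ i, c i * c i + s i * s i = 1) (h₀ : ∀ i, c (α i) * s i = 0) :
    IsIsom k (dg V c + mv V α * dg V s) (dg V c + dg V s * mvAdj V α) where
  inv := by
    have e : ∀ a b m n : Op V, (a + b * m) * (a + n * b) =
        a * a + a * n * b + b * (m * a) + b * (m * n) * b := fun a b m n => by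
      noncomm_ring
    rw [e, mvAdj_mul_dg, mvAdj_mul_mv, mul_one, ← mul_assoc (dg V s), dg_mul_dg, dg_mul_mv,
      mul_assoc, dg_mul_dg, dg_mul_dg, dg_mul_dg]
    -- The cross terms vanish because coordinate `i` turns towards the place `α i` only when
    -- coordinate `α i` has left it completely.
    have z : (fun i => s i * c (α i)) = fun _ => 0 := funext fun i => (mul_comm _ _).trans (h₀ i)
    have z' : (fun i => c (α i) * s i) = fun _ => 0 := funext h₀
    rw [z, z', dg_zero, zero_mul, mul_zero, add_zero, add_zero, dg_add_dg, ← dg_one]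
    exact congrArg (dg V) (funext h₁)
  adj := (adj_dg c).add ((adj_mv α).mul (adj_dg s))
  comm := by
    rw [add_mul, mul_add, dg_mul_negProj, mul_assoc, dg_mul_negProj, ← mul_assoc,
      mv_mul_negProj h.neg_iff, mul_assoc]
  nonneg l w j hj h0 := by
    rw [LinearMap.add_apply, Finsupp.add_apply, Module.End.mul_apply, dg_apply, dg_apply] at hj
    rcases eq_or_ne (Finsupp.single l w j) 0 with h1 | h1
    · rw [h1, smul_zero, zero_add] at hj
      exact eq_of_mvAdj_single_ne (right_ne_zero_of_smul hj) ▸ h.nonneg j h0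
    · rw [Finsupp.single_apply_ne_zero] at h1
      rw [← h1.1]
      exact ⟨h0, by nlinarith⟩
  neg l w j hj h0 := by
    rw [LinearMap.add_apply, Finsupp.add_apply, Module.End.mul_apply, dg_apply, dg_apply] at hj
    rcases eq_or_ne (Finsupp.single l w j) 0 with h1 | h1
    · rw [h1, smul_zero, zero_add] at hj
      exact eq_of_mvAdj_single_ne (right_ne_zero_of_smul hj) ▸ h.neg j h0
    · rw [Finsupp.single_apply_ne_zero] at h1
      rw [← h1.1]
      exact ⟨by nlinarith, h0⟩

/-- The rotation between two isometries with orthogonal images. -/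
theorem IsIsom.rotate {k : ℤ} {J J' K K' : Op V} (h : IsIsom k J J') (h' : IsIsom k K K')
    (h₀ : J' * K = 0) (h₀' : K' * J = 0) {c s : ℝ} (h₁ : c * c + s * s = 1) :
    IsIsom k ((c : ℂ) • J + (s : ℂ) • K) ((c : ℂ) • J' + (s : ℂ) • K') where
  inv := by
    simp only [add_mul, mul_add, smul_mul_smul_comm, h₀, h₀', h.inv, h'.inv, smul_zero, add_zero,
      zero_add]
    rw [← add_smul, ← Complex.ofReal_mul, ← Complex.ofReal_mul, ← Complex.ofReal_add, h₁,
      Complex.ofReal_one, one_smul]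
  adj := by
    have e : ∀ r : ℝ, (r : ℂ) • (1 : Op V) = dg V fun _ => r := fun r =>
      Op.ext_single fun i v => by simp
    have e' : ∀ (r : ℝ) (T : Op V), (r : ℂ) • T = (dg V fun _ => r) * T := fun r T => by
      rw [← e, smul_mul_assoc, one_mul]
    have e'' : ∀ (r : ℝ) (T : Op V), (r : ℂ) • T = T * (dg V fun _ => r) := fun r T => by
      rw [← e, mul_smul_comm, mul_one]
    rw [e', e', e'', e'']
    exact ((adj_dg _).mul h.adj).add ((adj_dg _).mul h'.adj)
  comm := by
    rw [add_mul, mul_add, smul_mul_assoc, smul_mul_assoc, mul_smul_comm, mul_smul_comm, h.comm,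
      h'.comm]
  nonneg l w j hj h0 := by
    rcases eq_or_ne (J' (Finsupp.single l w) j) 0 with h1 | h1
    · refine h'.nonneg l w j (fun h2 => hj ?_) h0
      simp [h1, h2]
    · exact h.nonneg l w j h1 h0
  neg l w j hj h0 := by
    rcases eq_or_ne (J' (Finsupp.single l w) j) 0 with h1 | h1
    · refine h'.neg l w j (fun h2 => hj ?_) h0
      simp [h1, h2]
    · exact h.neg l w j h1 h0

end Operators

end TelGC

end

noncomputable section

open unitInterval

namespace TelGC

/-! ## Projections of finite type -/

section Points

variable {V : Type u} [NormedAddCommGroup V] [InnerProductSpace ℂ V]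

/-- `P` is an orthogonal projection that agrees with the projection onto the negative coordinates
outside of the coordinates in `[-a, b)`. -/
structure IsPt (a b : ℕ) (P : Op V) : Prop where
  idem : P * P = P
  symm : Adj P P
  supp : ∀ i v, i < -(a : ℤ) ∨ (b : ℤ) ≤ i → P (Finsupp.single i v) = negProj V (Finsupp.single i v)

/-- Transport of a projection along an isometry of coordinates. -/
def conj (J J' P : Op V) : Op V := negProj V + J * (P - negProj V) * J'

/-- The projection onto the sum of two subspaces which are orthogonal relative to the negative
coordinates. -/
def osum (P Q : Op V) : Op V := P + Q - negProj V

theorem conj_sub (J J' P : Op V) : conj J J' P - negProj V = J * (P - negProj V) * J' :=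
  add_sub_cancel_left _ _

theorem osum_sub (P Q : Op V) :
    osum P Q - negProj V = (P - negProj V) + (Q - negProj V) := by
  rw [osum]
  abel

/-- On the differences from `negProj V`, transport is plain conjugation and `osum` is plain
addition, so identities between these operations are checked there. -/
theorem op_ext_sub {P Q : Op V} (h : P - negProj V = Q - negProj V) : P = Q := sub_left_inj.1 h

theorem conj_conj (J J' K K' P : Op V) : conj J J' (conj K K' P) = conj (J * K) (K' * J') P :=
  op_ext_sub (by simp only [conj_sub, mul_assoc])

theorem conj_osum (J J' P Q : Op V) :
    conj J J' (osum P Q) = osum (conj J J' P) (conj J J' Q) :=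
  op_ext_sub (by simp only [conj_sub, osum_sub, mul_add, add_mul])

theorem conj_negProj (J J' : Op V) : conj J J' (negProj V) = negProj V := by
  rw [conj, sub_self, mul_zero, zero_mul, add_zero]

theorem conj_one (P : Op V) : conj 1 1 P = P :=
  op_ext_sub (by rw [conj_sub, one_mul, mul_one])

theorem osum_negProj_left (Q : Op V) : osum (negProj V) Q = Q := add_sub_cancel_left _ _

theorem osum_negProj_right (P : Op V) : osum P (negProj V) = P := add_sub_cancel_right _ _

theorem osum_comm (P Q : Op V) : osum P Q = osum Q P := by
  rw [osum, osum, add_comm]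

theorem osum_assoc (P Q R : Op V) : osum (osum P Q) R = osum P (osum Q R) := by
  simp only [osum]
  abel

/-- `P` and `Q` are orthogonal relative to the negative coordinates. -/
def Orth (P Q : Op V) : Prop := (P - negProj V) * (Q - negProj V) = 0

namespace IsPt

variable {a b a' b' : ℕ} {P Q : Op V}

theorem mono (h : IsPt a b P) (ha : a ≤ a') (hb : b ≤ b') : IsPt a' b' P :=
  ⟨h.idem, h.symm, fun i v hi => h.supp i v (by omega)⟩

theorem sub_single (h : IsPt a b P) {i : ℤ} (hi : i < -(a : ℤ) ∨ (b : ℤ) ≤ i) (v : V) :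
    (P - TelGC.negProj V) (Finsupp.single i v) = 0 := by
  rw [LinearMap.sub_apply, h.supp i v hi, sub_self]

/-- The window condition speaks of the columns of `P`; since `P` is self-adjoint, it holds for the
rows as well. -/
theorem apply_of_notMem (h : IsPt a b P) {i : ℤ} (hi : i < -(a : ℤ) ∨ (b : ℤ) ≤ i)
    (x : VSum V) : P x i = TelGC.negProj V x i := by
  induction x using Finsupp.induction_linear with
  | zero => rw [map_zero, map_zero]
  | add x y hx hy => rw [map_add, map_add, Finsupp.add_apply, Finsupp.add_apply, hx, hy]
  | single j v =>
    refine ext_inner_right ℂ fun w => ?_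
    rw [h.symm.inner_apply, adj_negProj.inner_apply, h.supp i w hi]

/-- The product in the other order is the adjoint of the given one, and the adjoint of zero is zero.
-/
theorem orth_symm (h : IsPt a b P) (h' : IsPt a' b' Q) (ho : Orth P Q) : Orth Q P := by
  have hs := (h.symm.sub adj_negProj).mul (h'.symm.sub adj_negProj)
  rw [show (P - TelGC.negProj V) * (Q - TelGC.negProj V) = 0 from ho] at hs
  refine Op.ext_single fun i v => Finsupp.ext fun j => ext_inner_left ℂ fun w => ?_
  rw [← hs.inner_apply, LinearMap.zero_apply, LinearMap.zero_apply, Finsupp.zero_apply,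
    Finsupp.zero_apply, inner_zero_left, inner_zero_right]

theorem osum (h : IsPt a b P) (h' : IsPt a b Q) (ho : Orth P Q) : IsPt a b (osum P Q) where
  idem := by
    have h₁ := h.idem
    have h₂ := h'.idem
    have h₃ := negProj_idem (V := V)
    have h₄ : (P - TelGC.negProj V) * (Q - TelGC.negProj V) = 0 := ho
    have h₅ : (Q - TelGC.negProj V) * (P - TelGC.negProj V) = 0 := orth_symm h h' ho
    have e : ∀ P Q p : Op V, (P + Q - p) * (P + Q - p) = P * P + Q * Q - p * p +
        (P - p) * (Q - p) + (Q - p) * (P - p) := fun P Q p => by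
      simp only [mul_add, add_mul, mul_sub, sub_mul]
      abel
    rw [TelGC.osum, e, h₁, h₂, h₃, h₄, h₅, add_zero, add_zero]
  symm := (h.symm.add h'.symm).sub adj_negProj
  supp i v hi := by
    rw [TelGC.osum, LinearMap.sub_apply, LinearMap.add_apply, h.supp i v hi, h'.supp i v hi,
      add_sub_cancel_right]

theorem conj (h : IsPt a b P) {c : ℕ} {J J' : Op V} (hJ : IsIsom (c : ℤ) J J') :
    IsPt (c * a) (c * b) (conj J J' P) where
  idem := by
    -- With `p = negProj V` and `D = P - p`, idempotence of `P` and `p` amounts to `p D + D p + D D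
    -- = D`. This relation is transported by `J`, which commutes with `p`.
    have h₁ : TelGC.negProj V * (P - TelGC.negProj V) + (P - TelGC.negProj V) * TelGC.negProj V +
        (P - TelGC.negProj V) * (P - TelGC.negProj V) = P - TelGC.negProj V := by
      have e : ∀ P p : Op V, p * (P - p) + (P - p) * p + (P - p) * (P - p) = P * P - p * p :=
        fun P p => by
          simp only [mul_sub, sub_mul]
          abel
      rw [e, h.idem, negProj_idem]
    have e : ∀ p J D J' : Op V, (p + J * D * J') * (p + J * D * J') =
        p * p + (p * J) * D * J' + J * D * (J' * p) + J * D * (J' * J) * D * J' :=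
      fun p J D J' => by
        simp only [mul_add, add_mul, mul_assoc]
        abel
    have e' : ∀ p J D J' : Op V, p + J * p * D * J' + J * D * (p * J') + J * D * D * J' =
        p + J * (p * D + D * p + D * D) * J' := fun p J D J' => by
      simp only [mul_add, add_mul, mul_assoc]
      abel
    rw [TelGC.conj, e, negProj_idem, ← hJ.comm, hJ.comm', hJ.inv, mul_one, e', h₁]
  symm := adj_negProj.add (by
    have := (hJ.adj.mul (h.symm.sub adj_negProj)).mul hJ.adj.symm
    rwa [← mul_assoc] at this)
  supp l w hl := by
    rw [TelGC.conj, LinearMap.add_apply, add_eq_left, Module.End.mul_apply, Module.End.mul_apply]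
    -- The bounds in `IsIsom` force every index `j` in the support of `J'` applied to a vector at
    -- `l` to lie outside `[-a, b)` when `l` is outside the dilated window.
    have : (P - TelGC.negProj V) (J' (Finsupp.single l w)) = 0 := by
      rw [← Finsupp.sum_single (J' (Finsupp.single l w)), Finsupp.sum, map_sum]
      refine Finset.sum_eq_zero fun j hj => h.sub_single ?_ _
      have hj := Finsupp.mem_support_iff.1 hj
      rcases lt_or_ge j 0 with h0 | h0
      · have := hJ.neg l w j hj h0
        rcases hl with hl | hl
        · left
          push_cast at hl
          by_contra hcon
          nlinarith
        · exfalso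
          push_cast at hl
          nlinarith
      · have := hJ.nonneg l w j hj h0
        rcases hl with hl | hl
        · exfalso
          push_cast at hl
          nlinarith
        · right
          push_cast at hl
          by_contra hcon
          nlinarith
    rw [this, map_zero]

end IsPt

theorem orth_conj {J J' P Q : Op V} {c : ℤ} (hJ : IsIsom c J J') (h : Orth P Q) :
    Orth (conj J J' P) (conj J J' Q) := by
  unfold Orth at *
  rw [conj_sub, conj_sub]
  have e : ∀ D D' : Op V, J * D * J' * (J * D' * J') = J * (D * (J' * J) * D') * J' :=
    fun D D' => by simp only [mul_assoc]
  rw [e, hJ.inv, mul_one, h, mul_zero, zero_mul]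

theorem orth_conj_of_eq_zero {J J' K K' : Op V} (hJK : J' * K = 0) (P Q : Op V) :
    Orth (conj J J' P) (conj K K' Q) := by
  unfold Orth
  rw [conj_sub, conj_sub]
  have e : ∀ D D' : Op V, J * D * J' * (K * D' * K') = J * D * (J' * K) * D' * K' :=
    fun D D' => by simp only [mul_assoc]
  rw [e, hJK, mul_zero, zero_mul, zero_mul]

/-- Since `J' * (r • J + s • K) = r`, the product of the two differences is a multiple of the
conjugate of the product for `P` and `Q`. Thus the second member of an orthogonal pair can rotate
away while the first one stays. -/
theorem orth_conj_rotate {J J' K K' P Q : Op V} {c : ℤ} (hJ : IsIsom c J J') (hJK : J' * K = 0)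
    (h : Orth P Q) (r s : ℂ) :
    Orth (conj J J' P) (conj (r • J + s • K) (r • J' + s • K') Q) := by
  unfold Orth at *
  rw [conj_sub, conj_sub]
  have e : ∀ D D' L L' : Op V, J * D * J' * (L * D' * L') = J * D * (J' * L) * D' * L' :=
    fun D D' L L' => by simp only [mul_assoc]
  have e' : J' * (r • J + s • K) = r • 1 := by
    rw [mul_add, mul_smul_comm, mul_smul_comm, hJ.inv, hJK, smul_zero, add_zero]
  rw [e, e', mul_smul_comm, mul_one, smul_mul_assoc, mul_assoc J, h, mul_zero, smul_zero, zero_mul]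

/-! ### Continuous families of operators -/

/-- A family of operators, locally finite in columns, with continuous coefficients. -/
structure FinCont {Z : Type*} [TopologicalSpace Z] (P : Z → Op V) : Prop where
  fin : ∀ k, ∃ F : Finset ℤ, ∀ z v, ∀ i ∉ F, P z (Finsupp.single k v) i = 0
  -- Joint continuity in the parameter and the vector is what makes products of families continuous,
  -- since there the vector depends on the parameter too.
  cont : ∀ k i, Continuous fun q : Z × V => P q.1 (Finsupp.single k q.2) i

namespace FinCont

variable {Z Z' : Type*} [TopologicalSpace Z] [TopologicalSpace Z'] {P Q : Z → Op V}

theorem add (hP : FinCont P) (hQ : FinCont Q) : FinCont fun z => P z + Q z where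
  fin k := by
    classical
    obtain ⟨F, hF⟩ := hP.fin k
    obtain ⟨F', hF'⟩ := hQ.fin k
    refine ⟨F ∪ F', fun z v i hi => ?_⟩
    rw [Finset.notMem_union] at hi
    rw [LinearMap.add_apply, Finsupp.add_apply, hF z v i hi.1, hF' z v i hi.2, add_zero]
  cont k i := (hP.cont k i).add (hQ.cont k i)

theorem sub (hP : FinCont P) (hQ : FinCont Q) : FinCont fun z => P z - Q z where
  fin k := by
    classical
    obtain ⟨F, hF⟩ := hP.fin k
    obtain ⟨F', hF'⟩ := hQ.fin k
    refine ⟨F ∪ F', fun z v i hi => ?_⟩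
    rw [Finset.notMem_union] at hi
    rw [LinearMap.sub_apply, Finsupp.sub_apply, hF z v i hi.1, hF' z v i hi.2, sub_zero]
  cont k i := (hP.cont k i).sub (hQ.cont k i)

theorem smul (hP : FinCont P) {f : Z → ℂ} (hf : Continuous f) : FinCont fun z => f z • P z where
  fin k := by
    obtain ⟨F, hF⟩ := hP.fin k
    refine ⟨F, fun z v i hi => ?_⟩
    rw [LinearMap.smul_apply, Finsupp.smul_apply, hF z v i hi, smul_zero]
  cont k i := (hf.comp continuous_fst).smul (hP.cont k i)

theorem comp (hP : FinCont P) {f : Z' → Z} (hf : Continuous f) : FinCont fun z => P (f z) where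
  fin k := by
    obtain ⟨F, hF⟩ := hP.fin k
    exact ⟨F, fun z v i hi => hF (f z) v i hi⟩
  cont k i := (hP.cont k i).comp ((hf.comp continuous_fst).prodMk continuous_snd)

theorem apply_single_eq_sum {S : Op V} {x : VSum V} {F : Finset ℤ} (hF : ∀ i ∉ F, x i = 0)
    (i : ℤ) : S x i = ∑ l ∈ F, S (Finsupp.single l (x l)) i := by
  have hx : x.sum Finsupp.single = ∑ l ∈ F, Finsupp.single l (x l) := by
    refine Finset.sum_subset (fun l hl => ?_) fun l _ hl => ?_
    · by_contra hcon
      exact Finsupp.mem_support_iff.1 hl (hF l hcon)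
    · rw [Finsupp.notMem_support_iff.1 hl, Finsupp.single_zero]
  conv_lhs => rw [← Finsupp.sum_single x, hx, map_sum, Finsupp.finsetSum_apply]

/-- A column of `Q z` is supported in a finite set independent of `z`, so a coefficient of the
product is a finite sum with a fixed range of summation. -/
theorem mul (hP : FinCont P) (hQ : FinCont Q) : FinCont fun z => P z * Q z where
  fin k := by
    classical
    obtain ⟨F, hF⟩ := hQ.fin k
    choose G hG using hP.fin
    refine ⟨F.biUnion G, fun z v i hi => ?_⟩
    rw [Module.End.mul_apply, apply_single_eq_sum (hF z v)]
    refine Finset.sum_eq_zero fun l hl => hG l z _ i fun hcon => hi ?_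
    exact Finset.mem_biUnion.2 ⟨l, hl, hcon⟩
  cont k i := by
    obtain ⟨F, hF⟩ := hQ.fin k
    have e : (fun q : Z × V => (P q.1 * Q q.1) (Finsupp.single k q.2) i) = fun q =>
        ∑ l ∈ F, P q.1 (Finsupp.single l (Q q.1 (Finsupp.single k q.2) l)) i := by
      funext q
      rw [Module.End.mul_apply, apply_single_eq_sum (hF q.1 q.2)]
    rw [e]
    exact continuous_finsetSum _ fun l _ =>
      (hP.cont l i).comp (continuous_fst.prodMk (hQ.cont k l))

theorem apply (hP : FinCont P) (x : VSum V) (i : ℤ) : Continuous fun z => P z x i := by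
  induction x using Finsupp.induction_linear with
  | zero => simpa using continuous_const
  | add x y hx hy =>
    simp only [map_add, Finsupp.add_apply]
    exact hx.add hy
  | single k v => exact (hP.cont k i).comp (continuous_id.prodMk continuous_const)

theorem dg {c : Z → ℤ → ℝ} (hc : ∀ i, Continuous fun z => c z i) :
    FinCont fun z => TelGC.dg V (c z) where
  fin k := by
    classical
    refine ⟨{k}, fun z v i hi => ?_⟩
    rw [dg_apply, Finsupp.single_apply, if_neg, smul_zero]
    exact fun h => hi (Finset.mem_singleton.2 h.symm)
  cont k i := by
    classical
    simp only [dg_apply]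
    refine (Complex.continuous_ofReal.comp ((hc i).comp continuous_fst)).smul ?_
    simp only [Finsupp.single_apply]
    split_ifs
    · exact continuous_snd
    · exact continuous_const

theorem negProj : FinCont fun _ : Z => TelGC.negProj V := dg fun _ => continuous_const

theorem one : FinCont fun _ : Z => (1 : Op V) := by
  rw [← dg_one]
  exact dg fun _ => continuous_const

theorem mv (α : ℤ ↪ ℤ) : FinCont fun _ : Z => TelGC.mv V α where
  fin k := by
    classical
    refine ⟨{α k}, fun z v i hi => ?_⟩
    rw [mv_single, Finsupp.single_apply, if_neg]
    exact fun h => hi (Finset.mem_singleton.2 h.symm)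
  cont k i := by
    classical
    simp only [mv_single, Finsupp.single_apply]
    split_ifs
    · exact continuous_snd
    · exact continuous_const

theorem mvAdj (α : ℤ ↪ ℤ) : FinCont fun _ : Z => TelGC.mvAdj V α where
  fin k := by
    classical
    -- If `k` is not a value of `α`, the column is zero and the default value of `invFun` does no
    -- harm.
    refine ⟨{Function.invFun α k}, fun z v i hi => ?_⟩
    rw [mvAdj_apply, Finsupp.single_apply, if_neg]
    rintro rfl
    exact hi (Finset.mem_singleton.2 (Function.leftInverse_invFun α.injective i).symm)
  cont k i := by
    classical
    simp only [mvAdj_apply, Finsupp.single_apply]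
    split_ifs
    · exact continuous_snd
    · exact continuous_const

theorem conj {J J' : Z → Op V} (hJ : FinCont J) (hJ' : FinCont J') (hP : FinCont P) :
    FinCont fun z => TelGC.conj (J z) (J' z) (P z) :=
  negProj.add ((hJ.mul (hP.sub negProj)).mul hJ')

theorem osum (hP : FinCont P) (hQ : FinCont Q) : FinCont fun z => TelGC.osum (P z) (Q z) :=
  (hP.add hQ).sub negProj

end FinCont

end Points

end TelGC

end

noncomputable section

open unitInterval

namespace TelGC

/-! ## Products of spaces coinduced by countably many compact spaces -/

section CompactFamilies

open Set

/-- `κ` is a countable family of maps from compact spaces which determines the topology of `X`. -/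
structure IsCompactFamily {ι : Type*} {K : ι → Type*} [∀ i, TopologicalSpace (K i)]
    {X : Type*} [TopologicalSpace X] (κ : ∀ i, K i → X) : Prop where
  cont : ∀ i, Continuous (κ i)
  surj : ∀ x, ∃ i k, κ i k = x
  open_of : ∀ U : Set X, (∀ i, IsOpen (κ i ⁻¹' U)) → IsOpen U

namespace IsCompactFamily

theorem continuous_iff {ι : Type*} {K : ι → Type*} [∀ i, TopologicalSpace (K i)] {X : Type*}
    [TopologicalSpace X] {κ : ∀ i, K i → X} (h : IsCompactFamily κ) {Z : Type*}
    [TopologicalSpace Z] {f : X → Z} : Continuous f ↔ ∀ i, Continuous (f ∘ κ i) := by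
  refine ⟨fun hf i => hf.comp (h.cont i), fun hf => ⟨fun U hU => h.open_of _ fun i => ?_⟩⟩
  exact hU.preimage (hf i)

theorem continuousOn {ι : Type*} {K : ι → Type*} [∀ i, TopologicalSpace (K i)] {X : Type*}
    [TopologicalSpace X] {κ : ∀ i, K i → X} (h : IsCompactFamily κ) {Z : Type*}
    [TopologicalSpace Z] {f : X → Z} {U : Set X} (hU : IsOpen U)
    (hf : ∀ i, ContinuousOn (f ∘ κ i) (κ i ⁻¹' U)) : ContinuousOn f U := by
  rw [continuousOn_open_iff hU]
  intro O hO
  refine h.open_of _ fun i => ?_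
  exact (hf i).isOpen_inter_preimage (hU.preimage (h.cont i)) hO

/-- The identity of a compact space. -/
theorem id {X : Type*} [TopologicalSpace X] :
    IsCompactFamily fun (_ : Unit) (x : X) => x :=
  ⟨fun _ => continuous_id, fun x => ⟨(), x, rfl⟩, fun _ h => h ()⟩

/-- The intervals in the line. -/
theorem real : IsCompactFamily fun (n : ℕ) (x : Icc (-(n : ℝ)) n) => (x : ℝ) where
  cont _ := continuous_subtype_val
  surj x := by
    obtain ⟨n, hn⟩ := exists_nat_ge |x|
    exact ⟨n, ⟨x, abs_le.1 hn⟩, rfl⟩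
  open_of U hU := by
    refine isOpen_iff_mem_nhds.2 fun x hx => ?_
    obtain ⟨n, hn⟩ := exists_nat_gt |x|
    obtain ⟨O, hO, h⟩ := hU n
    have hx' := abs_lt.1 hn
    have hxO : x ∈ O := by
      have : (⟨x, hx'.1.le, hx'.2.le⟩ : Icc (-(n : ℝ)) n) ∈ Subtype.val ⁻¹' O := by
        rw [h]
        exact hx
      exact this
    filter_upwards [hO.mem_nhds hxO, Ioo_mem_nhds hx'.1 hx'.2] with y hy hy'
    have : (⟨y, hy'.1.le, hy'.2.le⟩ : Icc (-(n : ℝ)) n) ∈ Subtype.val ⁻¹' O := hy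
    rw [h] at this
    exact this

/-! ### Binary products of Hausdorff spaces determined by countably many compact spaces -/

section Prod

variable {ι ι' : Type*} [Countable ι] [Countable ι'] {K : ι → Type*} {L : ι' → Type*}
  {X Y : Type*} {κ : ∀ i, K i → X} {l : ∀ i, L i → Y}

/-- The union of the images of the first `n` members of a family. -/
def stage (κ : ∀ i, K i → X) (n : ℕ) : Set X :=
  ⋃ i ∈ {i : ι | (nonempty_embedding_nat ι).some i ≤ n}, range (κ i)

theorem finite_index (n : ℕ) : {i : ι | (nonempty_embedding_nat ι).some i ≤ n}.Finite :=
  (finite_le_nat n).preimage (nonempty_embedding_nat ι).some.injective.injOn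

theorem stage_mono : Monotone (stage κ) := fun _ _ hmn =>
  biUnion_subset_biUnion_left fun _ hi => le_trans hi hmn

variable [∀ i, TopologicalSpace (K i)] [∀ i, TopologicalSpace (L i)] [TopologicalSpace X]
  [TopologicalSpace Y]

theorem exists_mem_stage (h : IsCompactFamily κ) (x : X) : ∃ n, x ∈ stage κ n := by
  obtain ⟨i, k, rfl⟩ := h.surj x
  exact ⟨_, mem_biUnion (show (nonempty_embedding_nat ι).some i ≤ _ from le_rfl) ⟨k, rfl⟩⟩

/-- A set is open if its traces on all stages are relatively open. -/
theorem isOpen_of_stage (h : IsCompactFamily κ) {U : Set X}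
    (hU : ∀ n, ∃ O, IsOpen O ∧ U ∩ stage κ n = O ∩ stage κ n) : IsOpen U := by
  refine h.open_of U fun i => ?_
  obtain ⟨O, hO, e⟩ := hU ((nonempty_embedding_nat ι).some i)
  have : κ i ⁻¹' U = κ i ⁻¹' O := by
    ext k
    have hk : κ i k ∈ stage κ ((nonempty_embedding_nat ι).some i) :=
      mem_biUnion (show (nonempty_embedding_nat ι).some i ≤ _ from le_rfl) ⟨k, rfl⟩
    have := Set.ext_iff.1 e (κ i k)
    simp only [mem_inter_iff, hk, and_true] at this
    exact this
  rw [this]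
  exact hO.preimage (h.cont i)

variable [∀ i, CompactSpace (K i)] [∀ i, CompactSpace (L i)]

theorem isCompact_stage (h : IsCompactFamily κ) (n : ℕ) : IsCompact (stage κ n) :=
  (finite_index n).isCompact_biUnion fun i _ => isCompact_range (h.cont i)

/-- The trace is a finite union of continuous images of closed subsets of compact spaces, hence
compact, hence closed in a Hausdorff space. -/
theorem isClosed_trace [T2Space X] [T2Space Y] (h : IsCompactFamily κ) (h' : IsCompactFamily l)
    {W : Set (X × Y)} (hW : ∀ i j, IsOpen (Prod.map (κ i) (l j) ⁻¹' W)) (m n : ℕ) :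
    IsClosed (Wᶜ ∩ stage κ m ×ˢ stage l n) := by
  have e : Wᶜ ∩ stage κ m ×ˢ stage l n =
      ⋃ i ∈ {i : ι | (nonempty_embedding_nat ι).some i ≤ m},
      ⋃ j ∈ {i : ι' | (nonempty_embedding_nat ι').some i ≤ n},
        Prod.map (κ i) (l j) '' (Prod.map (κ i) (l j) ⁻¹' Wᶜ) := by
    ext ⟨x, y⟩
    simp only [stage, mem_inter_iff, mem_prod, mem_iUnion, mem_range, mem_image, exists_prop,
      Prod.exists, mem_preimage, Prod.map_apply, Prod.mk.injEq]
    constructor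
    · rintro ⟨hxy, ⟨i, hi, k, rfl⟩, ⟨j, hj, k', rfl⟩⟩
      exact ⟨i, hi, j, hj, k, k', hxy, rfl, rfl⟩
    · rintro ⟨i, hi, j, hj, k, k', hxy, rfl, rfl⟩
      exact ⟨hxy, ⟨i, hi, k, rfl⟩, ⟨j, hj, k', rfl⟩⟩
  rw [e]
  refine (finite_index m).isClosed_biUnion fun i _ => (finite_index n).isClosed_biUnion
    fun j _ => ?_
  refine (IsCompact.image ?_ ((h.cont i).prodMap (h'.cont j))).isClosed
  rw [preimage_compl]
  exact (hW i j).isClosed_compl.isCompact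

/-- One step in the construction of a neighbourhood in a product. -/
theorem exists_box [T2Space X] [T2Space Y] {C : Set X} {D : Set Y} (hC : IsCompact C)
    (hD : IsCompact D) {A : Set X} {B : Set Y} (hA : IsCompact A) (hB : IsCompact B)
    {F : Set (X × Y)} (hF : IsClosed F) (hAB : Disjoint (A ×ˢ B) F) :
    ∃ A' B', IsCompact A' ∧ IsCompact B' ∧ Disjoint (A' ×ˢ B') F ∧ A' ⊆ C ∧ B' ⊆ D ∧
      ∃ O O', IsOpen O ∧ IsOpen O' ∧ A ⊆ O ∧ B ⊆ O' ∧ O ∩ C ⊆ A' ∧ O' ∩ D ⊆ B' := by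
  obtain ⟨U, U', hU, hU', hAU, hBU, hUF⟩ :=
    generalized_tube_lemma hA hB hF.isOpen_compl hAB.subset_compl_right
  -- Separating `A` from `C \ U` by disjoint open sets `O` and `N` makes `C \ N` compact, contained
  -- in `U`, and a neighbourhood of `A` relative to `C`.
  obtain ⟨O, N, hO, hN, hAO, hCN, hON⟩ := SeparatedNhds.of_isCompact_isCompact hA
    (hC.diff hU) (disjoint_left.2 fun x hx hx' => hx'.2 (hAU hx))
  obtain ⟨O', N', hO', hN', hBO, hDN, hON'⟩ := SeparatedNhds.of_isCompact_isCompact hB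
    (hD.diff hU') (disjoint_left.2 fun x hx hx' => hx'.2 (hBU hx))
  refine ⟨C \ N, D \ N', hC.diff hN, hD.diff hN', ?_, sdiff_subset, sdiff_subset, O, O', hO, hO',
    hAO, hBO, fun x hx => ⟨hx.2, disjoint_left.1 hON hx.1⟩,
    fun x hx => ⟨hx.2, disjoint_left.1 hON' hx.1⟩⟩
  refine disjoint_left.2 fun p hp hpF => hUF ⟨?_, ?_⟩ hpF
  · by_contra hcon
    exact hp.1.2 (hCN ⟨hp.1.1, hcon⟩)
  · by_contra hcon
    exact hp.2.2 (hDN ⟨hp.2.1, hcon⟩)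

/-- Starting with a point of `W`, compact boxes inside `W` are enlarged stage by stage, each
containing a relative neighbourhood of the preceding one in the next stage. Their union is a box
with open sides. This makes homotopies and products on colimits continuous for the product topology.
-/
theorem isOpen_prod [T2Space X] [T2Space Y] (h : IsCompactFamily κ) (h' : IsCompactFamily l)
    {W : Set (X × Y)} (hW : ∀ i j, IsOpen (Prod.map (κ i) (l j) ⁻¹' W)) : IsOpen W := by
  refine isOpen_iff_forall_mem_open.2 ?_
  rintro ⟨x, y⟩ hxy
  obtain ⟨m, hm⟩ := h.exists_mem_stage x
  obtain ⟨m', hm'⟩ := h'.exists_mem_stage y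
  let C : ℕ → Set X := fun n => stage κ (m + n)
  let D : ℕ → Set Y := fun n => stage l (m' + n)
  let Box : Type _ := {p : Set X × Set Y // IsCompact p.1 ∧ IsCompact p.2 ∧ p.1 ×ˢ p.2 ⊆ W}
  have step : ∀ (n : ℕ) (p : Box), ∃ q : Box, q.1.1 ⊆ C n ∧ q.1.2 ⊆ D n ∧
      (p.1.1 ⊆ C n → p.1.2 ⊆ D n → ∃ O O', IsOpen O ∧ IsOpen O' ∧ p.1.1 ⊆ O ∧ p.1.2 ⊆ O' ∧
        O ∩ C n ⊆ q.1.1 ∧ O' ∩ D n ⊆ q.1.2) := by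
    rintro n ⟨⟨A, B⟩, hA, hB, hAB⟩
    obtain ⟨A', B', hA', hB', hd, hA'C, hB'D, hO⟩ := exists_box (h.isCompact_stage (m + n))
      (h'.isCompact_stage (m' + n)) hA hB (isClosed_trace h h' hW (m + n) (m' + n))
      (disjoint_left.2 fun p hp hp' => hp'.1 (hAB hp))
    refine ⟨⟨(A', B'), hA', hB', fun p hp => ?_⟩, hA'C, hB'D, fun _ _ => hO⟩
    by_contra hcon
    exact disjoint_left.1 hd hp ⟨hcon, hA'C hp.1, hB'D hp.2⟩
  choose next hC hD hnext using step
  let q : ℕ → Box := fun n => Nat.rec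
    ⟨({x}, {y}), isCompact_singleton, isCompact_singleton, by
      rw [singleton_prod_singleton, singleton_subset_iff]
      exact hxy⟩ (fun n p => next (n + 1) p) n
  have hqC : ∀ n, (q n).1.1 ⊆ C n ∧ (q n).1.2 ⊆ D n := by
    rintro (_ | n)
    · exact ⟨singleton_subset_iff.2 hm, singleton_subset_iff.2 hm'⟩
    · exact ⟨hC _ _, hD _ _⟩
  have hC_mono : Monotone C := fun a b hab => stage_mono (Nat.add_le_add_left hab m)
  have hD_mono : Monotone D := fun a b hab => stage_mono (Nat.add_le_add_left hab m')
  have hstep : ∀ n, ∃ O O', IsOpen O ∧ IsOpen O' ∧ (q n).1.1 ⊆ O ∧ (q n).1.2 ⊆ O' ∧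
      O ∩ C (n + 1) ⊆ (q (n + 1)).1.1 ∧ O' ∩ D (n + 1) ⊆ (q (n + 1)).1.2 := fun n =>
    hnext (n + 1) (q n) ((hqC n).1.trans (hC_mono n.le_succ)) ((hqC n).2.trans (hD_mono n.le_succ))
  choose O O' hO hO' hqO hqO' hOq hOq' using hstep
  have mono1 : Monotone fun n => (q n).1.1 := monotone_nat_of_le_succ fun n a ha =>
    hOq n ⟨hqO n ha, hC_mono n.le_succ ((hqC n).1 ha)⟩
  have mono2 : Monotone fun n => (q n).1.2 := monotone_nat_of_le_succ fun n a ha =>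
    hOq' n ⟨hqO' n ha, hD_mono n.le_succ ((hqC n).2 ha)⟩
  refine ⟨(⋃ n, (q n).1.1) ×ˢ ⋃ n, (q n).1.2, ?_, IsOpen.prod ?_ ?_, ?_, ?_⟩
  · rintro ⟨a, b⟩ ⟨ha, hb⟩
    obtain ⟨i, hi⟩ := mem_iUnion.1 ha
    obtain ⟨j, hj⟩ := mem_iUnion.1 hb
    exact (q (max i j)).2.2.2 ⟨mono1 (le_max_left i j) hi, mono2 (le_max_right i j) hj⟩
  -- Only the `O n` with `k ≤ n` are used: for these, stage `k` lies in `C (n + 1)`, where `O n` is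
  -- contained in the next box.
  · refine h.isOpen_of_stage fun k => ⟨⋃ n ∈ {n | k ≤ n}, O n,
      isOpen_biUnion fun n _ => hO n, ?_⟩
    ext a
    simp only [mem_inter_iff, mem_iUnion, mem_ofPred_eq, exists_prop, and_congr_left_iff]
    intro hak
    constructor
    · rintro ⟨n, hn⟩
      exact ⟨max n k, le_max_right n k, hqO _ (mono1 (le_max_left n k) hn)⟩
    · rintro ⟨n, hkn, hn⟩
      exact ⟨n + 1, hOq n ⟨hn, stage_mono (by omega) hak⟩⟩
  · refine h'.isOpen_of_stage fun k => ⟨⋃ n ∈ {n | k ≤ n}, O' n,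
      isOpen_biUnion fun n _ => hO' n, ?_⟩
    ext a
    simp only [mem_inter_iff, mem_iUnion, mem_ofPred_eq, exists_prop, and_congr_left_iff]
    intro hak
    constructor
    · rintro ⟨n, hn⟩
      exact ⟨max n k, le_max_right n k, hqO' _ (mono2 (le_max_left n k) hn)⟩
    · rintro ⟨n, hkn, hn⟩
      exact ⟨n + 1, hOq' n ⟨hn, stage_mono (by omega) hak⟩⟩
  · exact mem_iUnion.2 ⟨0, rfl⟩
  · exact mem_iUnion.2 ⟨0, rfl⟩

theorem prod [T2Space X] [T2Space Y] (h : IsCompactFamily κ) (h' : IsCompactFamily l) :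
    IsCompactFamily fun (i : ι × ι') (k : K i.1 × L i.2) => (κ i.1 k.1, l i.2 k.2) where
  cont i := (h.cont i.1).prodMap (h'.cont i.2)
  surj p := by
    obtain ⟨i, k, hk⟩ := h.surj p.1
    obtain ⟨j, k', hk'⟩ := h'.surj p.2
    exact ⟨(i, j), (k, k'), Prod.ext hk hk'⟩
  open_of _ hU := isOpen_prod h h' fun i j => hU (i, j)

end Prod

end IsCompactFamily

end CompactFamilies

end TelGC

end

noncomputable section

open unitInterval

namespace TelGC

/-! ## The Grassmannians in terms of operators -/

section Coordinates

variable {V : Type u} [NormedAddCommGroup V] [InnerProductSpace ℂ V]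

/-- The inclusion of `V^n` as the coordinates in `[0, n)`. -/
def extV (V : Type u) [NormedAddCommGroup V] [InnerProductSpace ℂ V] (n : ℕ) :
    VPow V n →ₗ[ℂ] VSum V where
  toFun v := ∑ i : Fin n, Finsupp.single (i : ℤ) (v i)
  map_add' v w := by simp [Finset.sum_add_distrib]
  map_smul' c v := by simp [Finset.smul_sum]

/-- The coordinates in `[0, n)`. -/
def resV (V : Type u) [NormedAddCommGroup V] [InnerProductSpace ℂ V] (n : ℕ) :
    VSum V →ₗ[ℂ] VPow V n where
  toFun x := WithLp.toLp 2 fun i => x (i : ℤ)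
  map_add' _ _ := rfl
  map_smul' _ _ := rfl

variable {n : ℕ}

@[simp]
theorem resV_apply (x : VSum V) (i : Fin n) : resV V n x i = x (i : ℤ) := rfl

theorem extV_def (v : VPow V n) : extV V n v = ∑ i : Fin n, Finsupp.single (i : ℤ) (v i) := rfl

theorem extV_apply (v : VPow V n) (i : Fin n) : extV V n v (i : ℤ) = v i := by
  classical
  rw [extV_def, Finsupp.finsetSum_apply, Finset.sum_eq_single i]
  · rw [Finsupp.single_eq_same]
  · intro j _ hj
    rw [Finsupp.single_apply, if_neg]
    exact fun h => hj (Fin.ext (by exact_mod_cast h))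
  · simp

theorem extV_apply_of_notMem (v : VPow V n) {k : ℤ} (hk : k < 0 ∨ (n : ℤ) ≤ k) :
    extV V n v k = 0 := by
  classical
  rw [extV_def, Finsupp.finsetSum_apply]
  refine Finset.sum_eq_zero fun i _ => ?_
  rw [Finsupp.single_apply, if_neg]
  have := i.2
  omega

theorem eq_fin_or (n : ℕ) (k : ℤ) : (∃ i : Fin n, (i : ℤ) = k) ∨ k < 0 ∨ (n : ℤ) ≤ k := by
  rcases lt_or_ge k 0 with h | h
  · exact Or.inr (Or.inl h)
  rcases le_or_gt (n : ℤ) k with h' | h'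
  · exact Or.inr (Or.inr h')
  exact Or.inl ⟨⟨k.toNat, by omega⟩, by simp [h]⟩

theorem resV_extV (v : VPow V n) : resV V n (extV V n v) = v := by
  ext i
  rw [resV_apply, extV_apply]

theorem extV_resV {x : VSum V} (h : ∀ k : ℤ, k < 0 ∨ (n : ℤ) ≤ k → x k = 0) :
    extV V n (resV V n x) = x := by
  ext k
  rcases eq_fin_or n k with ⟨i, rfl⟩ | hk
  · rw [extV_apply, resV_apply]
  · rw [extV_apply_of_notMem _ hk, h k hk]

theorem resV_single_of_notMem {k : ℤ} (hk : k < 0 ∨ (n : ℤ) ≤ k) (v : V) :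
    resV V n (Finsupp.single k v) = 0 := by
  classical
  ext i
  rw [resV_apply, Finsupp.single_apply, if_neg]
  · rfl
  · have := i.2
    omega

theorem form_extV (v : VPow V n) (y : VSum V) : form (extV V n v) y = inner ℂ v (resV V n y) := by
  have : ∀ s : Finset (Fin n), form (∑ i ∈ s, Finsupp.single (i : ℤ) (v i)) y =
      ∑ i ∈ s, inner ℂ (v i) (y (i : ℤ)) := fun s => by
    classical
    induction s using Finset.induction_on with
    | empty => rw [Finset.sum_empty, Finset.sum_empty, form_zero_left]
    | insert a s ha ih => rw [Finset.sum_insert ha, Finset.sum_insert ha, form_add_left, ih,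
        form_single]
  rw [extV_def, this, PiLp.inner_apply]
  rfl

theorem negProj_extV (v : VPow V n) : negProj V (extV V n v) = 0 := by
  ext k
  rw [negProj, dg_apply]
  split_ifs with h
  · rw [extV_apply_of_notMem _ (Or.inl h), smul_zero, Finsupp.zero_apply]
  · rw [Complex.ofReal_zero, zero_smul, Finsupp.zero_apply]

theorem resV_negProj (x : VSum V) : resV V n (negProj V x) = 0 := by
  ext k
  rw [resV_apply, negProj, dg_apply, if_neg (by omega), Complex.ofReal_zero, zero_smul]
  rfl

theorem extV_extend {m : ℕ} (α : Fin m ↪ Fin n) (β : ℤ ↪ ℤ)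
    (h : ∀ i, ((α i : Fin n) : ℤ) = β (i : ℤ)) (v : VPow V m) :
    extV V n (extend α v) = mv V β (extV V m v) := by
  rw [extV_def, extV_def, map_sum]
  simp only [mv_single, ← h, extend_apply]
  have e : ∀ j : Fin n, Finsupp.single (j : ℤ) (∑ i, if α i = j then v i else 0) =
      ∑ i, if α i = j then Finsupp.single (j : ℤ) (v i) else 0 := fun j => by
    rw [← Finsupp.singleAddHom_apply, map_sum]
    exact Finset.sum_congr rfl fun i _ => by split_ifs <;> simp
  simp only [e]
  rw [Finset.sum_comm]
  exact Finset.sum_congr rfl fun i _ => by simp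

theorem restrict_resV {m : ℕ} (α : Fin m ↪ Fin n) (β : ℤ ↪ ℤ)
    (h : ∀ i, ((α i : Fin n) : ℤ) = β (i : ℤ)) (x : VSum V) :
    restrict α (resV V n x) = resV V m (mvAdj V β x) := by
  ext i
  rw [restrict_apply, resV_apply, resV_apply, mvAdj_apply, h]

/-- Translation of coordinates. -/
def shiftEmb (k : ℤ) : ℤ ↪ ℤ := (Equiv.addRight k).toEmbedding

@[simp]
theorem shiftEmb_apply (k i : ℤ) : shiftEmb k i = i + k := rfl

/-- Translation of a projection. -/
def shift (k : ℤ) (P : Op V) : Op V := mv V (shiftEmb k) * P * mv V (shiftEmb (-k))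

theorem mv_shiftEmb_zero : mv V (shiftEmb 0) = 1 := Op.ext_single fun i v => by
  rw [mv_single, shiftEmb_apply, add_zero, Module.End.one_apply]

theorem mv_shiftEmb_mul (k l : ℤ) : mv V (shiftEmb k) * mv V (shiftEmb l) =
    mv V (shiftEmb (k + l)) := Op.ext_single fun i v => by
  rw [Module.End.mul_apply, mv_single, mv_single, mv_single, shiftEmb_apply, shiftEmb_apply,
    shiftEmb_apply, add_right_comm, add_assoc]

theorem mvAdj_shiftEmb (k : ℤ) : mvAdj V (shiftEmb k) = mv V (shiftEmb (-k)) :=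
  Op.ext_single fun i v => by
    obtain ⟨j, rfl⟩ : ∃ j, i = shiftEmb k j := ⟨i - k, (sub_add_cancel i k).symm⟩
    rw [mvAdj_single, mv_single, shiftEmb_apply, shiftEmb_apply, add_neg_cancel_right]

theorem shift_zero (P : Op V) : shift 0 P = P := by
  rw [shift, neg_zero, mv_shiftEmb_zero, one_mul, mul_one]

theorem shift_shift (k l : ℤ) (P : Op V) : shift k (shift l P) = shift (k + l) P := by
  rw [shift, shift, shift, neg_add_rev, ← mv_shiftEmb_mul, ← mv_shiftEmb_mul]
  simp only [mul_assoc]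

theorem shift_dg (k : ℤ) (c : ℤ → ℝ) : shift k (dg V c) = dg V fun i => c (i - k) :=
  Op.ext_single fun i v => by
    rw [shift, Module.End.mul_apply, Module.End.mul_apply, mv_single, dg_single, mv_single,
      dg_single, shiftEmb_apply, shiftEmb_apply, neg_add_cancel_right, sub_eq_add_neg]

/-- The projection `negProj` is not invariant under translation. But an index outside `[-a', b')`
has the same sign as its translate by `-k`, which is outside `[-a, b)`, because all four bounds are
natural numbers. -/
theorem IsPt.shift {a b a' b' : ℕ} {P : Op V} (h : IsPt a b P) {k : ℤ} (ha : (a : ℤ) - k = a')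
    (hb : (b : ℤ) + k = b') : IsPt a' b' (TelGC.shift k P) where
  idem := by
    have e : ∀ S T : Op V, T * S = 1 → S * P * T * (S * P * T) = S * P * T := fun S T hT => by
      have : S * P * T * (S * P * T) = S * (P * (T * S) * P) * T := by simp only [mul_assoc]
      rw [this, hT, mul_one, h.idem]
    exact e _ _ (by rw [mv_shiftEmb_mul, neg_add_cancel, mv_shiftEmb_zero])
  symm := by
    have := ((adj_mv (V := V) (shiftEmb k)).mul h.symm).mul (adj_mv (shiftEmb k)).symm
    rwa [mvAdj_shiftEmb, ← mul_assoc] at this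
  supp i v hi := by
    have hi' : i + -k < -(a : ℤ) ∨ (b : ℤ) ≤ i + -k := by omega
    rw [TelGC.shift, Module.End.mul_apply, Module.End.mul_apply, mv_single, shiftEmb_apply,
      h.supp _ _ hi']
    rcases lt_or_ge i 0 with h0 | h0
    · have : i + -k < 0 := by omega
      rw [negProj_single_of_neg this, negProj_single_of_neg h0, mv_single, shiftEmb_apply,
        neg_add_cancel_right]
    · have : 0 ≤ i + -k := by omega
      rw [negProj_single_of_nonneg this, negProj_single_of_nonneg h0, map_zero]

theorem FinCont.shift {Z : Type*} [TopologicalSpace Z] {P : Z → Op V} (hP : FinCont P) (k : ℤ) :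
    FinCont fun z => TelGC.shift k (P z) := ((FinCont.mv _).mul hP).mul (FinCont.mv _)

end Coordinates

/-! ### Group action on operators, and the finite Grassmannians as spaces of operators -/

section GrassmannianOperators

variable {G : Type w} [Group G] {V : Type u} [NormedAddCommGroup V] [InnerProductSpace ℂ V]

/-- The diagonal action of the group on `VSum V`. -/
def dG (ρ : G →* (V ≃ₗᵢ[ℂ] V)) (g : G) : Op V :=
  Finsupp.mapRange.linearMap (ρ g).toLinearEquiv.toLinearMap

variable (ρ : G →* (V ≃ₗᵢ[ℂ] V))

@[simp]
theorem dG_single (g : G) (i : ℤ) (v : V) :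
    dG ρ g (Finsupp.single i v) = Finsupp.single i (ρ g v) :=
  Finsupp.mapRange_single (hf := map_zero (ρ g))

theorem dG_mul_dG (g h : G) : dG ρ g * dG ρ h = dG ρ (g * h) := Op.ext_single fun i v => by
  simp

theorem dG_one : dG ρ 1 = 1 := Op.ext_single fun i v => by simp

/-- The action of the group on operators. -/
def actOp (g : G) (P : Op V) : Op V := dG ρ g * P * dG ρ g⁻¹

/-- An operator which commutes with the action of the group. -/
def Inv (S : Op V) : Prop := ∀ g, dG ρ g * S = S * dG ρ g

namespace Inv

variable {ρ} {S T : Op V}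

theorem mv (α : ℤ ↪ ℤ) : Inv ρ (mv V α) := fun g => Op.ext_single fun i v => by simp

theorem mvAdj (α : ℤ ↪ ℤ) : Inv ρ (mvAdj V α) := fun _ =>
  LinearMap.ext fun _ => Finsupp.ext fun _ => rfl

theorem dg (c : ℤ → ℝ) : Inv ρ (dg V c) := fun g => Op.ext_single fun i v => by
  simp only [Module.End.mul_apply, dG_single, dg_single, map_smul]

theorem mul (hS : Inv ρ S) (hT : Inv ρ T) : Inv ρ (S * T) := fun g => by
  rw [← mul_assoc, hS, mul_assoc, hT, mul_assoc]

theorem add (hS : Inv ρ S) (hT : Inv ρ T) : Inv ρ (S + T) := fun g => by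
  rw [mul_add, add_mul, hS, hT]

theorem smul (hS : Inv ρ S) (c : ℂ) : Inv ρ (c • S) := fun g => by
  rw [mul_smul_comm, hS, smul_mul_assoc]

theorem one : Inv ρ (1 : Op V) := fun g => by rw [mul_one, one_mul]

theorem negProj : Inv ρ (negProj V) := dg _

theorem actOp_eq (hS : Inv ρ S) (g : G) : actOp ρ g S = S := by
  rw [actOp, hS, mul_assoc, dG_mul_dG, mul_inv_cancel, dG_one, mul_one]

theorem actOp_mul (hS : Inv ρ S) (g : G) (P : Op V) : actOp ρ g (S * P) = S * actOp ρ g P := by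
  rw [actOp, actOp, ← mul_assoc, hS]
  simp only [mul_assoc]

theorem actOp_mul' (hS : Inv ρ S) (g : G) (P : Op V) : actOp ρ g (P * S) = actOp ρ g P * S := by
  rw [actOp, actOp, mul_assoc, mul_assoc, ← hS]
  simp only [mul_assoc]

end Inv

theorem actOp_add (g : G) (P Q : Op V) : actOp ρ g (P + Q) = actOp ρ g P + actOp ρ g Q := by
  rw [actOp, mul_add, add_mul, actOp, actOp]

theorem actOp_sub (g : G) (P Q : Op V) : actOp ρ g (P - Q) = actOp ρ g P - actOp ρ g Q := by
  rw [actOp, mul_sub, sub_mul, actOp, actOp]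

variable {ρ}

theorem actOp_conj {J J' : Op V} (hJ : Inv ρ J) (hJ' : Inv ρ J') (g : G) (P : Op V) :
    actOp ρ g (conj J J' P) = conj J J' (actOp ρ g P) := by
  rw [conj, conj, actOp_add, Inv.negProj.actOp_eq, hJ'.actOp_mul', hJ.actOp_mul, actOp_sub,
    Inv.negProj.actOp_eq]

theorem actOp_osum (g : G) (P Q : Op V) :
    actOp ρ g (osum P Q) = osum (actOp ρ g P) (actOp ρ g Q) := by
  rw [osum, osum, actOp_sub, actOp_add, Inv.negProj.actOp_eq]

theorem actOp_shift (g : G) (k : ℤ) (P : Op V) :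
    actOp ρ g (shift k P) = shift k (actOp ρ g P) := by
  rw [shift, shift, (Inv.mv _).actOp_mul', (Inv.mv _).actOp_mul]

/-! ### Finite stages -/

namespace Gr

variable {n : ℕ}

/-- The operator of a subspace of `V^n`: the projection onto its sum with the negative
coordinates. -/
def op (p : Gr ρ n) : Op V := negProj V + extV V n ∘ₗ (p.1 : VPow V n →ₗ[ℂ] VPow V n) ∘ₗ resV V n

theorem op_apply (p : Gr ρ n) (x : VSum V) :
    p.op x = negProj V x + extV V n (p.1 (resV V n x)) := rfl

theorem op_sub_apply (p : Gr ρ n) (x : VSum V) :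
    (p.op - negProj V) x = extV V n (p.1 (resV V n x)) := by
  rw [LinearMap.sub_apply, op_apply, add_sub_cancel_left]

theorem isPt_op (p : Gr ρ n) : IsPt 0 n p.op where
  idem := LinearMap.ext fun x => by
    rw [Module.End.mul_apply, op_apply, op_apply, map_add, map_add, ← Module.End.mul_apply,
      negProj_idem, negProj_extV, resV_negProj, resV_extV, zero_add, p.idem, add_zero]
  symm := fun x y => by
    rw [op_apply, op_apply, form_add_left, form_add_right, adj_negProj, form_extV, p.symm,
      ← form_conj_symm (extV V n _) x, form_extV, inner_conj_symm]
  supp i v hi := by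
    rw [op_apply, resV_single_of_notMem (by simpa using hi), map_zero, map_zero, add_zero]

theorem op_injective : Function.Injective (op : Gr ρ n → Op V) := fun p q h => ext fun v => by
  have := LinearMap.congr_fun h (extV V n v)
  rw [op_apply, op_apply, resV_extV] at this
  have := congrArg (resV V n) (add_left_cancel this)
  rwa [resV_extV, resV_extV] at this

theorem op_push {m : ℕ} (α : Fin m ↪ Fin n) (β : ℤ ↪ ℤ)
    (h : ∀ i, ((α i : Fin n) : ℤ) = β (i : ℤ)) (p : Gr ρ m) :
    (push α p).op = conj (mv V β) (mvAdj V β) p.op := op_ext_sub <| LinearMap.ext fun x => by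
  rw [op_sub_apply, push_apply, extV_extend α β h, restrict_resV α β h, conj_sub,
    Module.End.mul_apply, Module.End.mul_apply, op_sub_apply]

/-- The standard inclusion is the identity on indices, so the operator descends to the colimit. -/
theorem op_push_castSucc (p : Gr ρ n) : (push Fin.castSuccEmb p).op = p.op := by
  rw [op_push Fin.castSuccEmb (shiftEmb 0) (fun i => by simp), mvAdj_shiftEmb, neg_zero,
    mv_shiftEmb_zero, conj_one]

theorem op_bot : (bot ρ n).op = negProj V := LinearMap.ext fun x => by
  rw [op_apply]
  exact (congrArg (negProj V x + ·) (map_zero _)).trans (add_zero _)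

theorem op_top : (top ρ n).op = dg V fun i => if i < n then 1 else 0 :=
  LinearMap.ext fun x => by
    ext k
    rw [op_apply, Finsupp.add_apply, negProj, dg_apply, dg_apply]
    change _ + extV V n (resV V n x) k = _
    rcases eq_fin_or n k with ⟨i, rfl⟩ | hk | hk
    · rw [extV_apply, resV_apply, if_neg (by omega), if_pos (by exact_mod_cast i.2)]
      simp
    · rw [extV_apply_of_notMem _ (Or.inl hk), if_pos hk, if_pos (by omega)]
      simp
    · rw [extV_apply_of_notMem _ (Or.inr hk), if_neg (by omega), if_neg (by omega)]
      simp

theorem extV_diag (g : G) (v : VPow V n) : extV V n (diag ρ n g v) = dG ρ g (extV V n v) := by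
  rw [extV_def, extV_def, map_sum]
  simp only [dG_single, diag_apply]

theorem op_smul (g : G) (p : Gr ρ n) : (g • p).op = actOp ρ g p.op := by
  have : (g • p).op - negProj V = actOp ρ g (p.op - negProj V) := LinearMap.ext fun x => by
    rw [op_sub_apply, actOp, Module.End.mul_apply, Module.End.mul_apply, op_sub_apply, smul_apply,
      extV_diag]
    rfl
  rw [actOp_sub, Inv.negProj.actOp_eq] at this
  exact sub_left_inj.1 this

theorem finCont_op : FinCont (op : Gr ρ n → Op V) := by
  refine FinCont.add FinCont.negProj ⟨fun k => ⟨Finset.Ico 0 n, fun p v i hi => ?_⟩, fun k i => ?_⟩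
  · rw [Finset.mem_Ico] at hi
    exact extV_apply_of_notMem _ (by omega)
  · change Continuous fun q : Gr ρ n × V => extV V n (q.1.1 (resV V n (Finsupp.single k q.2))) i
    rcases eq_fin_or n i with ⟨j, rfl⟩ | hi
    · simp only [extV_apply]
      have h1 : Continuous fun q : Gr ρ n × V => q.1.1 := continuous_val.comp continuous_fst
      have h2 : Continuous fun q : Gr ρ n × V => resV V n (Finsupp.single k q.2) := by
        classical
        refine (PiLp.continuous_toLp 2 _).comp (continuous_pi fun l => ?_)
        simp only [Finsupp.single_apply]
        split_ifs
        · exact continuous_snd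
        · exact continuous_const
      exact (PiLp.continuous_apply 2 _ j).comp (h1.clm_apply h2)
    · simp only [extV_apply_of_notMem _ hi]
      exact continuous_const

/-- This is the purpose of the negative coordinates: translation by one brings the coordinate `-1`,
which is contained in the image, to the place `0`, and this is the new summand `V`. -/
theorem op_eta (p : Gr ρ n) : (eta ρ n p).op = shift 1 p.op := by
  have e : ∀ w : OrthPair ρ (n + 1), (OrthPair.sum ρ (n + 1) w).op = osum w.1.1.op w.1.2.op :=
    fun w => op_ext_sub <| LinearMap.ext fun x => by
      rw [osum_sub, LinearMap.add_apply, op_sub_apply, op_sub_apply, op_sub_apply,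
        OrthPair.sum_apply, map_add]
  rw [eta, ContinuousMap.comp_apply, e]
  change osum (push (firstEmb n) (top ρ 1)).op (push (Fin.succEmb n) p).op = _
  rw [op_push (firstEmb n) (shiftEmb 0) (fun i => by simp [firstEmb]; rfl),
    op_push (Fin.succEmb n) (shiftEmb 1) (fun i => by simp), mvAdj_shiftEmb, mvAdj_shiftEmb,
    neg_zero, mv_shiftEmb_zero, conj_one, op_top, osum, conj, mul_sub, sub_mul]
  change dg V _ + (negProj V + (shift 1 p.op - shift 1 (negProj V))) - negProj V = _
  rw [negProj, shift_dg]
  have : (fun i : ℤ => if i - 1 < 0 then (1 : ℝ) else 0) =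
      fun i => if i < ((1 : ℕ) : ℤ) then 1 else 0 := by
    funext i
    exact if_congr (by simp) rfl rfl
  rw [this]
  abel

theorem norm_le_one (p : Gr ρ n) : ‖p.1‖ ≤ 1 := by
  refine p.1.opNorm_le_bound zero_le_one fun v => ?_
  rw [one_mul]
  have h : ‖p.1 v‖ * ‖p.1 v‖ ≤ ‖v‖ * ‖p.1 v‖ := by
    have h1 : inner ℂ (p.1 v) (p.1 v) = inner ℂ v (p.1 v) := by rw [p.symm, p.idem]
    calc ‖p.1 v‖ * ‖p.1 v‖ = ‖inner ℂ (p.1 v) (p.1 v)‖ := by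
          rw [inner_self_eq_norm_sq_to_K, norm_pow, RCLike.norm_ofReal, abs_norm, sq]
      _ = ‖inner ℂ v (p.1 v)‖ := by rw [h1]
      _ ≤ ‖v‖ * ‖p.1 v‖ := norm_inner_le_norm _ _
  rcases (norm_nonneg (p.1 v)).eq_or_lt with h0 | h0
  · rw [← h0]
    exact norm_nonneg v
  · exact le_of_mul_le_mul_right h h0

variable [FiniteDimensional ℂ V]

/-- The subspace of `V^n` given by an operator. -/
def ofOp (ρ : G →* (V ≃ₗᵢ[ℂ] V)) {P : Op V} (h : IsPt 0 n P) : Gr ρ n :=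
  of ρ (LinearMap.toContinuousLinearMap (resV V n ∘ₗ P ∘ₗ extV V n))
    (fun v => by
      change resV V n (P (extV V n (resV V n (P (extV V n v))))) = resV V n (P (extV V n v))
      rw [extV_resV, ← Module.End.mul_apply, h.idem]
      intro k hk
      rw [h.apply_of_notMem (by simpa using hk), negProj_extV, Finsupp.zero_apply])
    (fun v w => by
      change inner ℂ (resV V n (P (extV V n v))) w = inner ℂ v (resV V n (P (extV V n w)))
      rw [← form_extV, ← h.symm, ← inner_conj_symm, ← form_extV, form_conj_symm])

theorem ofOp_apply {P : Op V} (h : IsPt 0 n P) (v : VPow V n) :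
    (ofOp ρ h).1 v = resV V n (P (extV V n v)) := rfl

theorem op_ofOp {P : Op V} (h : IsPt 0 n P) : (ofOp ρ h).op = P := by
  refine Op.ext_single fun k v => ?_
  rw [op_apply, ofOp_apply]
  rcases eq_fin_or n k with ⟨i, rfl⟩ | hk
  · have e : extV V n (resV V n (Finsupp.single (i : ℤ) v)) = Finsupp.single (i : ℤ) v := by
      classical
      refine extV_resV fun k hk => ?_
      rw [Finsupp.single_apply, if_neg]
      have := i.2
      omega
    rw [e, extV_resV, negProj_single_of_nonneg (by omega), zero_add]
    intro k hk
    rw [h.apply_of_notMem (by simpa using hk), negProj_single_of_nonneg (by omega),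
      Finsupp.zero_apply]
  · rw [resV_single_of_notMem hk, map_zero, map_zero, map_zero, map_zero, add_zero,
      h.supp k v (by simpa using hk)]

/-- As `V^n` is finite-dimensional, the topology of its endomorphisms is that of pointwise
convergence, so continuous coefficients suffice. -/
theorem continuous_of_op {Z : Type*} [TopologicalSpace Z] {f : Z → Gr ρ n}
    (hf : FinCont fun z => (f z).op) : Continuous f := by
  refine Continuous.subtype_mk (f := fun z => (f z).1) ?_ fun z => (f z).2
  refine continuous_clm_apply.2 fun v => ?_
  have e : ∀ z, (f z).1 v = WithLp.toLp 2 fun i : Fin n => (f z).op (extV V n v) (i : ℤ) :=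
    fun z => by
      ext i
      change (f z).1 v i = (f z).op (extV V n v) (i : ℤ)
      rw [op_apply, negProj_extV, zero_add, resV_extV, extV_apply]
  simp only [e]
  exact (PiLp.continuous_toLp 2 _).comp (continuous_pi fun i => hf.apply _ _)

/-- Projections form a closed set, cut out by the pointwise equations, and they have norm at most
one in a finite-dimensional space. -/
instance : CompactSpace (Gr ρ n) := by
  have : FiniteDimensional ℂ (VPow V n) := inferInstance
  have : FiniteDimensional ℂ (VPow V n →L[ℂ] VPow V n) := inferInstance
  have : ProperSpace (VPow V n →L[ℂ] VPow V n) := FiniteDimensional.proper ℂ _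
  refine isCompact_iff_compactSpace.1 (Metric.isCompact_of_isClosed_isBounded
    (s := {p : VPow V n →L[ℂ] VPow V n | (p : VPow V n →ₗ[ℂ] VPow V n).IsSymmetricProjection})
    ?_ ?_)
  · have e : {p : VPow V n →L[ℂ] VPow V n |
        (p : VPow V n →ₗ[ℂ] VPow V n).IsSymmetricProjection} =
        (⋂ v, {p | p (p v) = p v}) ∩ ⋂ v, ⋂ w, {p | inner ℂ (p v) w = inner ℂ v (p w)} := by
      ext p
      simp only [Set.mem_inter_iff, Set.mem_iInter]
      exact ⟨fun h => ⟨fun v => LinearMap.congr_fun h.isIdempotentElem v, h.isSymmetric⟩,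
        fun h => ⟨LinearMap.ext h.1, h.2⟩⟩
    rw [e]
    have c : ∀ v, Continuous fun p : VPow V n →L[ℂ] VPow V n => p v := fun v =>
      (ContinuousLinearMap.apply ℂ (VPow V n) v).continuous
    refine (isClosed_iInter fun v => ?_).inter (isClosed_iInter fun v => isClosed_iInter fun w => ?_)
    · exact isClosed_eq (continuous_id.clm_apply (c v)) (c v)
    · exact isClosed_eq ((c v).inner continuous_const) (continuous_const.inner (c w))
  · refine isBounded_iff_forall_norm_le.2 ⟨1, fun p hp => ?_⟩
    -- The points of `Gr` do not depend on the representation, so the norm bound may be quoted for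
    -- the trivial one.
    exact norm_le_one (ρ := (1 : Unit →* (V ≃ₗᵢ[ℂ] V))) ⟨p, hp⟩

end Gr

end GrassmannianOperators

end TelGC

end

noncomputable section

open unitInterval

namespace TelGC

/-! ## The colimits in terms of operators -/

section Colimits

variable {G : Type w} [Group G] {V : Type u} [NormedAddCommGroup V] [InnerProductSpace ℂ V]
  {ρ : G →* (V ≃ₗᵢ[ℂ] V)}

namespace OrthPair

variable {n : ℕ}

theorem op_sum (w : OrthPair ρ n) : (sum ρ n w).op = osum w.1.1.op w.1.2.op :=
  op_ext_sub <| LinearMap.ext fun x => by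
    rw [osum_sub, LinearMap.add_apply, Gr.op_sub_apply, Gr.op_sub_apply, Gr.op_sub_apply,
      sum_apply, map_add]

theorem orth_op (w : OrthPair ρ n) : Orth w.1.1.op w.1.2.op := LinearMap.ext fun x => by
  rw [Module.End.mul_apply, Gr.op_sub_apply, Gr.op_sub_apply, resV_extV, w.orth, map_zero]
  rfl

/-- A pair of orthogonal subspaces as a pair of operators. -/
theorem orth_of_op {p q : Gr ρ n} (h : Orth p.op q.op) (v : VPow V n) : p.1 (q.1 v) = 0 := by
  have := LinearMap.congr_fun h (extV V n v)
  rw [Module.End.mul_apply, Gr.op_sub_apply, Gr.op_sub_apply, resV_extV, resV_extV] at this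
  rw [← resV_extV (p.1 (q.1 v)), this, LinearMap.zero_apply, map_zero]

variable [FiniteDimensional ℂ V]

instance : CompactSpace (OrthPair ρ n) := by
  refine isCompact_iff_compactSpace.1 (IsClosed.isCompact
    (s := {w : Gr ρ n × Gr ρ n | ∀ v, w.1.1 (w.2.1 v) = 0}) ?_)
  rw [Set.ofPred_forall]
  refine isClosed_iInter fun v => isClosed_eq ?_ continuous_const
  exact (Gr.continuous_val.comp continuous_fst).clm_apply
    ((Gr.continuous_val.comp continuous_snd).clm_apply continuous_const)

/-- The orthogonal pair given by a pair of operators. -/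
def ofOp (ρ : G →* (V ≃ₗᵢ[ℂ] V)) {P Q : Op V} (hP : IsPt 0 n P) (hQ : IsPt 0 n Q)
    (h : Orth P Q) : OrthPair ρ n :=
  ⟨(Gr.ofOp ρ hP, Gr.ofOp ρ hQ), orth_of_op (by rwa [Gr.op_ofOp, Gr.op_ofOp])⟩

end OrthPair

/-! ### The space of subspaces -/

variable (ρ) in
theorem isCompactFamily_toInf : IsCompactFamily fun n => (toInf ρ n : Gr ρ n → GrInf ρ) where
  cont n := (toInf ρ n).continuous
  surj := by
    rintro ⟨n, p⟩
    exact ⟨n, p, rfl⟩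
  open_of U hU := isOpen_coinduced.2 (isOpen_sigma_iff.2 hU)

/-- The operator of a point of the infinite Grassmannian. -/
def opInf : GrInf ρ → Op V := Quot.lift (fun p => p.2.op) (by
  rintro _ _ ⟨n, p⟩
  exact (Gr.op_push_castSucc (ρ := ρ) p).symm)

theorem opInf_toInf (n : ℕ) (p : Gr ρ n) : opInf (toInf ρ n p) = p.op := rfl

theorem exists_isPt_opInf (x : GrInf ρ) : ∃ n, IsPt 0 n (opInf x) := by
  obtain ⟨n, p⟩ := x
  exact ⟨n, Gr.isPt_op (ρ := ρ) p⟩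

theorem toInf_of_le {m n : ℕ} (h : m ≤ n) (p : Gr ρ m) :
    ∃ q : Gr ρ n, toInf ρ n q = toInf ρ m p := by
  induction n, h using Nat.le_induction with
  | base => exact ⟨p, rfl⟩
  | succ n _ ih =>
    obtain ⟨q, hq⟩ := ih
    exact ⟨Gr.push Fin.castSuccEmb q, (toInf_push ρ n q).trans hq⟩

theorem opInf_injective : Function.Injective (opInf (ρ := ρ)) := by
  rintro ⟨m, p⟩ ⟨n, q⟩ h
  obtain ⟨p', hp⟩ := toInf_of_le (ρ := ρ) (le_max_left m n) p
  obtain ⟨q', hq⟩ := toInf_of_le (ρ := ρ) (le_max_right m n) q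
  change toInf ρ m p = toInf ρ n q
  rw [← hp, ← hq]
  refine congrArg _ (Gr.op_injective (ρ := ρ) ?_)
  rw [← opInf_toInf, ← opInf_toInf, hp, hq]
  exact h

theorem opInf_smul (g : G) (x : GrInf ρ) : opInf (g • x) = actOp ρ g (opInf x) := by
  obtain ⟨n, p⟩ := x
  exact Gr.op_smul (ρ := ρ) g p

theorem opInf_zeroInf : opInf (zeroInf ρ) = negProj V := Gr.op_bot (ρ := ρ)

theorem opInf_etaInf (x : GrInf ρ) : opInf (etaInf ρ x) = shift 1 (opInf x) := by
  obtain ⟨n, p⟩ := x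
  exact Gr.op_eta (ρ := ρ) p

/-! ### The space of orthogonal pairs -/

variable (ρ) in
theorem isCompactFamily_orth :
    IsCompactFamily fun n => ((orthSeq ρ).ι n : OrthPair ρ n → OrthInf ρ) where
  cont n := ((orthSeq ρ).ι n).continuous
  surj := by
    rintro ⟨n, p⟩
    exact ⟨n, p, rfl⟩
  open_of U hU := isOpen_coinduced.2 (isOpen_sigma_iff.2 hU)

theorem orth_inclInf (x : OrthInf ρ) :
    Orth (opInf (inclInf ρ x).1) (opInf (inclInf ρ x).2) := by
  obtain ⟨n, w⟩ := x
  exact w.orth_op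

theorem opInf_sumInf (x : OrthInf ρ) :
    opInf (sumInf ρ x) = osum (opInf (inclInf ρ x).1) (opInf (inclInf ρ x).2) := by
  obtain ⟨n, w⟩ := x
  exact w.op_sum

theorem orthι_of_le {m n : ℕ} (h : m ≤ n) (p : OrthPair ρ m) :
    ∃ q : OrthPair ρ n, (orthSeq ρ).ι n q = (orthSeq ρ).ι m p := by
  induction n, h using Nat.le_induction with
  | base => exact ⟨p, rfl⟩
  | succ n _ ih =>
    obtain ⟨q, hq⟩ := ih
    exact ⟨OrthPair.push Fin.castSuccEmb q, ((orthSeq ρ).ι_map n q).trans hq⟩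

theorem inclInf_injective : Function.Injective (inclInf ρ) := by
  rintro ⟨m, p⟩ ⟨n, q⟩ h
  obtain ⟨p', hp⟩ := orthι_of_le (ρ := ρ) (le_max_left m n) p
  obtain ⟨q', hq⟩ := orthι_of_le (ρ := ρ) (le_max_right m n) q
  change inclInf ρ ((orthSeq ρ).ι m p) = inclInf ρ ((orthSeq ρ).ι n q) at h
  change (orthSeq ρ).ι m p = (orthSeq ρ).ι n q
  rw [← hp, ← hq] at h ⊢
  refine congrArg _ (Subtype.ext (Prod.ext (Gr.op_injective (ρ := ρ) ?_) (Gr.op_injective (ρ := ρ) ?_)))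
  · exact congrArg (fun z => opInf z.1) h
  · exact congrArg (fun z => opInf z.2) h

theorem inclInf_smul (g : G) (x : OrthInf ρ) : inclInf ρ (g • x) = g • inclInf ρ x := by
  obtain ⟨n, w⟩ := x
  rfl

theorem sumInf_smul (g : G) (x : OrthInf ρ) : sumInf ρ (g • x) = g • sumInf ρ x := by
  refine opInf_injective ?_
  rw [opInf_smul, opInf_sumInf, opInf_sumInf, inclInf_smul, actOp_osum, Prod.smul_fst,
    Prod.smul_snd, opInf_smul, opInf_smul]

theorem continuous_opInf_apply (x : VSum V) (i : ℤ) :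
    Continuous fun p : GrInf ρ => opInf p x i :=
  (isCompactFamily_toInf ρ).continuous_iff.2 fun _ => (Gr.finCont_op (ρ := ρ)).apply x i

/-- The coefficients of the operators are continuous and separate points. The Hausdorff property is
needed for the theorem on products of compact families. -/
instance : T2Space (GrInf ρ) :=
  T2Space.of_injective_continuous (f := fun p : GrInf ρ => fun (q : VSum V × ℤ) => opInf p q.1 q.2)
    (fun _ _ h => opInf_injective (LinearMap.ext fun x => Finsupp.ext fun i => congrFun h (x, i)))
    (continuous_pi fun q => continuous_opInf_apply q.1 q.2)

variable [FiniteDimensional ℂ V]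

/-- The point of the infinite Grassmannian given by an operator. -/
def ofOpInf (ρ : G →* (V ≃ₗᵢ[ℂ] V)) (P : Op V) (h : ∃ n, IsPt 0 n P) : GrInf ρ :=
  toInf ρ h.choose (Gr.ofOp ρ h.choose_spec)

theorem opInf_ofOpInf {P : Op V} (h : ∃ n, IsPt 0 n P) : opInf (ofOpInf ρ P h) = P :=
  Gr.op_ofOp (ρ := ρ) h.choose_spec

/-- A uniform window makes the map factor through the finite stage `n`, where continuity can be
tested on coefficients. -/
theorem continuous_of_opInf {Z : Type*} [TopologicalSpace Z] {f : Z → GrInf ρ}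
    (hf : FinCont fun z => opInf (f z)) {n : ℕ} (hn : ∀ z, IsPt 0 n (opInf (f z))) :
    Continuous f := by
  have e : f = fun z => toInf ρ n (Gr.ofOp ρ (hn z)) := funext fun z => opInf_injective (by
    rw [opInf_toInf, Gr.op_ofOp])
  rw [e]
  refine (toInf ρ n).continuous.comp (Gr.continuous_of_op ?_)
  simpa only [Gr.op_ofOp] using hf

/-- The point of the infinite space of orthogonal pairs given by a pair of operators. -/
theorem exists_orthInf {x : GrInf ρ × GrInf ρ} (h : Orth (opInf x.1) (opInf x.2)) :
    ∃ w, inclInf ρ w = x := by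
  obtain ⟨m, hm⟩ := exists_isPt_opInf x.1
  obtain ⟨n, hn⟩ := exists_isPt_opInf x.2
  refine ⟨(orthSeq ρ).ι (max m n) (OrthPair.ofOp ρ (hm.mono le_rfl (le_max_left _ _))
    (hn.mono le_rfl (le_max_right _ _)) h), Prod.ext (opInf_injective ?_) (opInf_injective ?_)⟩
  · exact Gr.op_ofOp (ρ := ρ) (hm.mono le_rfl (le_max_left _ _))
  · exact Gr.op_ofOp (ρ := ρ) (hn.mono le_rfl (le_max_right _ _))

theorem continuous_of_inclInf {Z : Type*} [TopologicalSpace Z] {f : Z → OrthInf ρ}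
    (hf₁ : FinCont fun z => opInf (inclInf ρ (f z)).1)
    (hf₂ : FinCont fun z => opInf (inclInf ρ (f z)).2) {n : ℕ}
    (h₁ : ∀ z, IsPt 0 n (opInf (inclInf ρ (f z)).1))
    (h₂ : ∀ z, IsPt 0 n (opInf (inclInf ρ (f z)).2)) : Continuous f := by
  have e : f = fun z => (orthSeq ρ).ι n (OrthPair.ofOp ρ (h₁ z) (h₂ z) (orth_inclInf (f z))) :=
    funext fun z => inclInf_injective (Prod.ext (opInf_injective (Gr.op_ofOp (ρ := ρ) (h₁ z)).symm)
      (opInf_injective (Gr.op_ofOp (ρ := ρ) (h₂ z)).symm))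
  rw [e]
  refine ((orthSeq ρ).ι n).continuous.comp (Continuous.subtype_mk (Continuous.prodMk ?_ ?_) _)
  · refine Gr.continuous_of_op ?_
    simpa only [Gr.op_ofOp] using hf₁
  · refine Gr.continuous_of_op ?_
    simpa only [Gr.op_ofOp] using hf₂

instance : T2Space (OrthInf ρ) :=
  T2Space.of_injective_continuous inclInf_injective (inclInf ρ).continuous

end Colimits

end TelGC

end

noncomputable section

open unitInterval

namespace TelGC

/-! ## The telescope in terms of operators -/

section Telescope

variable {G : Type w} [Group G] {V : Type u} [NormedAddCommGroup V] [InnerProductSpace ℂ V]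
  {ρ : G →* (V ≃ₗᵢ[ℂ] V)}

/-- The cylinders of the telescope. -/
def cylTel (ρ : G →* (V ≃ₗᵢ[ℂ] V)) (n : ℕ) : C(GrInf ρ × I, GrTel ρ) := (etaSeq ρ).telCyl n

theorem cylTel_one (n : ℕ) (x : GrInf ρ) : cylTel ρ n (x, 1) = cylTel ρ (n + 1) (etaInf ρ x, 0) :=
  Quot.sound (GSeq.TelRel.glue (S := etaSeq ρ) n x)

theorem toTel_eq (n : ℕ) (x : GrInf ρ) : toTel ρ n x = cylTel ρ n (x, 0) := rfl

theorem exists_cylTel (z : GrTel ρ) : ∃ n x s, cylTel ρ n (x, s) = z := by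
  obtain ⟨n, x, s⟩ := z
  exact ⟨n, x, s, rfl⟩

/-- The position of a point of the telescope on the half-line. -/
def timeTel : GrTel ρ → ℝ := Quot.lift (fun q => q.1 + (q.2.2 : ℝ)) (by
  rintro _ _ ⟨n, x⟩
  simp)

/-- The operator of a point of the telescope. -/
def opTel : GrTel ρ → Op V := Quot.lift (fun q => shift (-(q.1 : ℤ)) (opInf (ρ := ρ) q.2.1)) (by
  rintro _ _ ⟨n, x⟩
  -- The gluing applies `η`, a translation by one, and raises the index, which translates back by
  -- one.
  have key : ∀ y : GrInf ρ,
      shift (-(n : ℤ)) (opInf y) = shift (-((n + 1 : ℕ) : ℤ)) (opInf (etaInf ρ y)) := fun y => by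
    rw [opInf_etaInf, shift_shift]
    congr 1
    push_cast
    ring
  exact key x)

theorem timeTel_cylTel (n : ℕ) (x : GrInf ρ) (s : I) :
    timeTel (cylTel ρ n (x, s)) = n + (s : ℝ) := rfl

theorem opTel_cylTel (n : ℕ) (x : GrInf ρ) (s : I) :
    opTel (cylTel ρ n (x, s)) = shift (-(n : ℤ)) (opInf x) := rfl

theorem timeTel_toTel (n : ℕ) (x : GrInf ρ) : timeTel (toTel ρ n x) = n := by
  rw [toTel_eq, timeTel_cylTel, Set.Icc.coe_zero, add_zero]

theorem opTel_toTel (n : ℕ) (x : GrInf ρ) : opTel (toTel ρ n x) = shift (-(n : ℤ)) (opInf x) := rfl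

theorem timeTel_nonneg (z : GrTel ρ) : 0 ≤ timeTel z := by
  obtain ⟨n, x, s, rfl⟩ := exists_cylTel z
  rw [timeTel_cylTel]
  exact add_nonneg n.cast_nonneg s.2.1

theorem timeTel_smul (g : G) (z : GrTel ρ) : timeTel (g • z) = timeTel z := by
  obtain ⟨n, x, s⟩ := z
  rfl

theorem opTel_smul (g : G) (z : GrTel ρ) : opTel (g • z) = actOp ρ g (opTel z) := by
  obtain ⟨n, x, s, rfl⟩ := exists_cylTel z
  change shift (-(n : ℤ)) (opInf (g • x)) = _
  rw [opInf_smul, opTel_cylTel, actOp_shift]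

theorem isPt_shift_neg {m : ℕ} {P : Op V} (h : IsPt 0 m P) (n : ℕ) :
    IsPt n m (shift (-(n : ℤ)) P) :=
  (h.mono le_rfl (Nat.le_add_right m n)).shift (by simp) (by push_cast; ring)

theorem isPt_shift {a b : ℕ} {P : Op V} (h : IsPt a b P) {n : ℕ} (hn : a ≤ n) :
    IsPt 0 (b + n) (shift n P) :=
  (h.mono hn le_rfl).shift (by simp) (by push_cast; rfl)

/-- The only constraint between operator and time: the window reaches into the negative coordinates
no further than the time. `ofTel` is the converse. -/
theorem exists_isPt_opTel (z : GrTel ρ) : ∃ a b : ℕ, (a : ℝ) ≤ timeTel z ∧ IsPt a b (opTel z) := by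
  obtain ⟨n, x, s, rfl⟩ := exists_cylTel z
  obtain ⟨m, hm⟩ := exists_isPt_opInf x
  exact ⟨n, m, le_add_of_nonneg_right s.2.1, isPt_shift_neg hm n⟩

theorem exists_cylTel_lt (z : GrTel ρ) : ∃ (n : ℕ) (x : GrInf ρ) (s : I), (s : ℝ) < 1 ∧ cylTel ρ n (x, s) = z := by
  obtain ⟨n, x, s, rfl⟩ := exists_cylTel z
  rcases s.2.2.lt_or_eq with h | h
  · exact ⟨n, x, s, h, rfl⟩
  · refine ⟨n + 1, etaInf ρ x, 0, zero_lt_one, ?_⟩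
    rw [← cylTel_one, show s = 1 from Subtype.ext h]

/-- If points are represented with interval coordinate less than one, the time determines the
cylinder as its integral part and then the interval coordinate; undoing the translation recovers the
subspace. -/
theorem opTel_timeTel_injective {y z : GrTel ρ} (h : opTel y = opTel z)
    (ht : timeTel y = timeTel z) : y = z := by
  obtain ⟨m, x, s, hs, rfl⟩ := exists_cylTel_lt y
  obtain ⟨n, x', s', hs', rfl⟩ := exists_cylTel_lt z
  rw [timeTel_cylTel, timeTel_cylTel] at ht
  have hmn : m = n := by
    have h1 : (m : ℝ) < n + 1 := by linarith [s.2.1]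
    have h2 : (n : ℝ) < m + 1 := by linarith [s'.2.1]
    have h1' : m < n + 1 := by exact_mod_cast h1
    have h2' : n < m + 1 := by exact_mod_cast h2
    omega
  subst hmn
  have hss : s = s' := Subtype.ext (add_left_cancel ht)
  subst hss
  have := congrArg (shift (m : ℤ)) h
  rw [opTel_cylTel, opTel_cylTel, shift_shift, shift_shift, add_neg_cancel, shift_zero,
    shift_zero] at this
  rw [opInf_injective this]

theorem finCont_opTel_cyl (i : ℕ × ℕ) : FinCont fun q : Gr ρ i.2 × I =>
    opTel (cylTel ρ i.1 (toInf ρ i.2 q.1, q.2)) := by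
  simp only [opTel_cylTel, opInf_toInf]
  exact (Gr.finCont_op.comp continuous_fst).shift _

theorem isPt_opTel_cyl (i : ℕ × ℕ) (q : Gr ρ i.2 × I) :
    IsPt i.1 i.2 (opTel (cylTel ρ i.1 (toInf ρ i.2 q.1, q.2))) :=
  isPt_shift_neg q.1.isPt_op _

theorem le_timeTel_cyl (i : ℕ × ℕ) (q : Gr ρ i.2 × I) :
    (i.1 : ℝ) ≤ timeTel (cylTel ρ i.1 (toInf ρ i.2 q.1, q.2)) :=
  le_add_of_nonneg_right q.2.2.1

variable [FiniteDimensional ℂ V]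

variable (ρ) in
theorem isCompactFamily_tel : IsCompactFamily fun (i : ℕ × ℕ) (q : Gr ρ i.2 × I) =>
    cylTel ρ i.1 (toInf ρ i.2 q.1, q.2) where
  cont i := by fun_prop
  surj := by
    rintro ⟨n, ⟨m, p⟩, s⟩
    exact ⟨(n, m), (p, s), rfl⟩
  open_of U hU := by
    refine isOpen_coinduced.2 (isOpen_sigma_iff.2 fun n => ?_)
    -- A cylinder carries the product topology of the colimit with the interval, so the theorem on
    -- products is already needed here.
    exact ((isCompactFamily_toInf ρ).prod IsCompactFamily.id).open_of _ fun i => hU (n, i.1)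

theorem continuous_timeTel : Continuous (timeTel : GrTel ρ → ℝ) :=
  (isCompactFamily_tel ρ).continuous_iff.2 fun i => by
    have : Continuous fun q : Gr ρ i.2 × I => (i.1 : ℝ) + (q.2 : ℝ) := by fun_prop
    exact this

instance : T2Space (GrTel ρ) :=
  T2Space.of_injective_continuous
    (f := fun z : GrTel ρ => (timeTel z, fun (q : VSum V × ℤ) => opTel z q.1 q.2))
    (fun _ _ h => opTel_timeTel_injective
      (LinearMap.ext fun x => Finsupp.ext fun i => congrFun (congrArg Prod.snd h) (x, i))
      (congrArg Prod.fst h))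
    (continuous_timeTel.prodMk (continuous_pi fun q =>
      (isCompactFamily_tel ρ).continuous_iff.2 fun i => (finCont_opTel_cyl i).apply q.1 q.2))

/-- The point of the telescope given by an operator and a position. -/
def ofTel (ρ : G →* (V ≃ₗᵢ[ℂ] V)) (P : Op V) (t : ℝ)
    (h : ∃ a b : ℕ, (a : ℝ) ≤ t ∧ IsPt a b P) : GrTel ρ :=
  cylTel ρ ⌊t⌋₊ (ofOpInf ρ (shift ⌊t⌋₊ P) (by
    obtain ⟨a, b, ha, h⟩ := h
    exact ⟨_, isPt_shift h (Nat.le_floor ha)⟩),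
    ⟨t - ⌊t⌋₊, by
      obtain ⟨a, b, ha, h⟩ := h
      exact sub_nonneg.2 (Nat.floor_le (a.cast_nonneg.trans ha)), by
      linarith [Nat.lt_floor_add_one t]⟩)

theorem timeTel_ofTel {P : Op V} {t : ℝ} (h : ∃ a b : ℕ, (a : ℝ) ≤ t ∧ IsPt a b P) :
    timeTel (ofTel ρ P t h) = t := by
  rw [ofTel, timeTel_cylTel]
  exact add_sub_cancel _ _

theorem opTel_ofTel {P : Op V} {t : ℝ} (h : ∃ a b : ℕ, (a : ℝ) ≤ t ∧ IsPt a b P) :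
    opTel (ofTel ρ P t h) = P := by
  rw [ofTel, opTel_cylTel, opInf_ofOpInf, shift_shift, neg_add_cancel, shift_zero]

theorem locallyFinite_Icc (n : ℕ) :
    LocallyFinite fun j : ℕ => Set.Icc ((n : ℝ) + j) (n + j + 1) := fun x => by
  refine ⟨Set.Iio (x + 1), Iio_mem_nhds (lt_add_one x), ?_⟩
  refine (Set.finite_le_nat ⌈x + 1⌉₊).subset ?_
  rintro j ⟨y, hy, hy'⟩
  have h1 : (j : ℝ) ≤ x + 1 := by
    have := hy.1
    have := Set.mem_Iio.1 hy'
    have := (Nat.cast_nonneg n : (0 : ℝ) ≤ n)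
    linarith
  exact_mod_cast h1.trans (Nat.le_ceil _)

/-- The times are at least `a`, so the preimages of the closed intervals `[a + j, a + j + 1]` form a
locally finite closed cover. Over each of them the map goes to the single cylinder `a + j`, where a
uniform window is available after translation. -/
theorem continuous_of_opTel {Z : Type*} [TopologicalSpace Z] {f : Z → GrTel ρ}
    (hf : FinCont fun z => opTel (f z)) (ht : Continuous fun z => timeTel (f z)) {a b : ℕ}
    (h : ∀ z, IsPt a b (opTel (f z))) (ha : ∀ z, (a : ℝ) ≤ timeTel (f z)) : Continuous f := by
  refine ((locallyFinite_Icc a).preimage_continuous ht).continuous ?_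
    (fun j => isClosed_Icc.preimage ht) fun j => ?_
  · refine Set.eq_univ_of_forall fun z => Set.mem_iUnion.2 ⟨⌊timeTel (f z) - a⌋₊, ?_, ?_⟩
    · have := Nat.floor_le (sub_nonneg.2 (ha z))
      linarith
    · have := (Nat.lt_floor_add_one (timeTel (f z) - a)).le
      linarith
  · have hz : ∀ z, IsPt 0 (b + (a + j)) (shift ((a + j : ℕ) : ℤ) (opTel (f z))) := fun z =>
      isPt_shift (h z) (Nat.le_add_right a j)
    -- Clamping the interval coordinate by `projIcc` gives a continuous map on all of `Z` that
    -- agrees with `f` on the `j`-th closed set.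
    have hc : Continuous fun z => cylTel ρ (a + j) (ofOpInf ρ _ ⟨_, hz z⟩,
        Set.projIcc (0 : ℝ) 1 zero_le_one (timeTel (f z) - (a + j))) := by
      refine (cylTel ρ (a + j)).continuous.comp (Continuous.prodMk ?_ ?_)
      · refine continuous_of_opInf ?_ (n := b + (a + j)) fun z => ?_
        · simp only [opInf_ofOpInf]
          exact hf.shift _
        · rw [opInf_ofOpInf]
          exact hz z
      · exact continuous_projIcc.comp (ht.sub continuous_const)
    refine hc.continuousOn.congr fun z hzj => opTel_timeTel_injective ?_ ?_
    · rw [opTel_cylTel, opInf_ofOpInf, shift_shift, neg_add_cancel, shift_zero]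
    · have h1 := hzj.1
      have h2 := hzj.2
      rw [timeTel_cylTel, Set.projIcc_of_mem zero_le_one ⟨by linarith, by linarith⟩]
      push_cast
      ring

/-! ### The flow -/

/-- Moving a point of the telescope along the half-line. -/
def flow (z : GrTel ρ) (r : ℝ) : GrTel ρ := ofTel ρ (opTel z) (timeTel z + max r 0) (by
  -- Moving forward preserves the bound `a ≤ t` on the window, moving backward may not; this is the
  -- reason for `max r 0`.
  obtain ⟨a, b, ha, h⟩ := exists_isPt_opTel z
  exact ⟨a, b, ha.trans (le_add_of_nonneg_right (le_max_right r 0)), h⟩)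

theorem opTel_flow (z : GrTel ρ) (r : ℝ) : opTel (flow z r) = opTel z := opTel_ofTel _

theorem timeTel_flow (z : GrTel ρ) (r : ℝ) : timeTel (flow z r) = timeTel z + max r 0 :=
  timeTel_ofTel _

theorem flow_zero (z : GrTel ρ) : flow z 0 = z :=
  opTel_timeTel_injective (opTel_flow z 0) (by rw [timeTel_flow, max_self, add_zero])

theorem flow_smul (g : G) (z : GrTel ρ) (r : ℝ) : flow (g • z) r = g • flow z r :=
  opTel_timeTel_injective (by rw [opTel_flow, opTel_smul, opTel_smul, opTel_flow])
    (by rw [timeTel_flow, timeTel_smul, timeTel_smul, timeTel_flow])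

theorem continuous_flow : Continuous fun q : GrTel ρ × ℝ => flow q.1 q.2 := by
  refine ((isCompactFamily_tel ρ).prod IsCompactFamily.real).continuous_iff.2 fun i => ?_
  refine continuous_of_opTel (a := i.1.1) (b := i.1.2) ?_ ?_ (fun q => ?_) fun q => ?_
  · simp only [Function.comp_apply, opTel_flow]
    exact (finCont_opTel_cyl i.1).comp continuous_fst
  · simp only [Function.comp_apply, timeTel_flow]
    refine Continuous.add ?_ ((continuous_subtype_val.comp continuous_snd).max continuous_const)
    exact (continuous_timeTel.comp ((isCompactFamily_tel ρ).cont i.1)).comp continuous_fst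
  · simp only [Function.comp_apply, opTel_flow]
    exact isPt_opTel_cyl i.1 q.1
  · simp only [Function.comp_apply, timeTel_flow]
    exact (le_timeTel_cyl i.1 q.1).trans (le_add_of_nonneg_right (le_max_right _ _))

end Telescope

end TelGC

end

noncomputable section

open unitInterval

namespace TelGC

/-! ## Deformations of isometries of coordinates -/

section Deformations

variable {G : Type w} [Group G] {V : Type u} [NormedAddCommGroup V] [InnerProductSpace ℂ V]

/-- An equivariant isometry of coordinates of expansion at most `4`. -/
@[ext]
structure CIsom (ρ : G →* (V ≃ₗᵢ[ℂ] V)) where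
  /-- the isometry -/
  J : Op V
  /-- its adjoint -/
  J' : Op V
  isIsom : IsIsom 4 J J'
  fin : FinCont fun _ : Unit => J
  fin' : FinCont fun _ : Unit => J'
  inv : Inv ρ J
  inv' : Inv ρ J'

variable {ρ : G →* (V ≃ₗᵢ[ℂ] V)}

/-- A continuous path of equivariant isometries of coordinates. -/
def IsomPath (A B : CIsom ρ) : Prop :=
  ∃ γ : I → CIsom ρ, (FinCont fun s => (γ s).J) ∧ (FinCont fun s => (γ s).J') ∧ γ 0 = A ∧ γ 1 = B

namespace CIsom

theorem finCont (A : CIsom ρ) {Z : Type*} [TopologicalSpace Z] : FinCont fun _ : Z => A.J :=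
  A.fin.comp (continuous_const : Continuous fun _ : Z => ())

theorem finCont' (A : CIsom ρ) {Z : Type*} [TopologicalSpace Z] : FinCont fun _ : Z => A.J' :=
  A.fin'.comp (continuous_const : Continuous fun _ : Z => ())

/-- The isometry given by an injection. -/
def ofEmb (ρ : G →* (V ≃ₗᵢ[ℂ] V)) (φ : ℤ ↪ ℤ) (h : Expands 4 φ) : CIsom ρ :=
  ⟨mv V φ, mvAdj V φ, h.isIsom, FinCont.mv φ, FinCont.mvAdj φ, Inv.mv φ, Inv.mvAdj φ⟩

/-- The identity. -/
def one (ρ : G →* (V ≃ₗᵢ[ℂ] V)) : CIsom ρ :=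
  ⟨1, 1, IsIsom.one (by norm_num), FinCont.one, FinCont.one, Inv.one, Inv.one⟩

end CIsom

theorem cos_sin_half_pi (x : ℝ) : Real.cos x * Real.cos x + Real.sin x * Real.sin x = 1 := by
  rw [← sq, ← sq, Real.cos_sq_add_sin_sq]

/-- The rotation between two isometries with orthogonal images. -/
def rotateIsom (A B : CIsom ρ) (h : A.J' * B.J = 0) (h' : B.J' * A.J = 0) (s : I) : CIsom ρ where
  J := ((Real.cos (Real.pi / 2 * s) : ℝ) : ℂ) • A.J + ((Real.sin (Real.pi / 2 * s) : ℝ) : ℂ) • B.J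
  J' := ((Real.cos (Real.pi / 2 * s) : ℝ) : ℂ) • A.J' +
    ((Real.sin (Real.pi / 2 * s) : ℝ) : ℂ) • B.J'
  isIsom := A.isIsom.rotate B.isIsom h h' (cos_sin_half_pi _)
  fin := (A.fin.smul continuous_const).add (B.fin.smul continuous_const)
  fin' := (A.fin'.smul continuous_const).add (B.fin'.smul continuous_const)
  inv := (A.inv.smul _).add (B.inv.smul _)
  inv' := (A.inv'.smul _).add (B.inv'.smul _)

section rotateIsom

variable (A B : CIsom ρ) (h : A.J' * B.J = 0) (h' : B.J' * A.J = 0)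

theorem finCont_rotateIsom : FinCont fun s => (rotateIsom A B h h' s).J :=
  (A.finCont.smul (by fun_prop)).add (B.finCont.smul (by fun_prop))

theorem finCont_rotateIsom' : FinCont fun s => (rotateIsom A B h h' s).J' :=
  (A.finCont'.smul (by fun_prop)).add (B.finCont'.smul (by fun_prop))

theorem rotateIsom_zero : rotateIsom A B h h' 0 = A := CIsom.ext (by simp [rotateIsom])
  (by simp [rotateIsom])

theorem rotateIsom_one : rotateIsom A B h h' 1 = B := CIsom.ext (by simp [rotateIsom])
  (by simp [rotateIsom])

end rotateIsom

theorem isomPath_rotate (A B : CIsom ρ) (h : A.J' * B.J = 0) (h' : B.J' * A.J = 0) :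
    IsomPath A B :=
  ⟨rotateIsom A B h h', finCont_rotateIsom A B h h', finCont_rotateIsom' A B h h',
    rotateIsom_zero A B h h', rotateIsom_one A B h h'⟩

/-- The angles in the deformation of the identity to an injection. -/
def angle (i : ℤ) (s : ℝ) : ℝ :=
  Real.pi / 2 * max 0 (min 1 ((i.natAbs + 1) * ((i.natAbs + 2) * s - 1)))

theorem continuous_angle (i : ℤ) : Continuous fun s : I => angle i s := by
  unfold angle
  fun_prop

theorem angle_zero (i : ℤ) : angle i 0 = 0 := by
  have : ((i.natAbs : ℝ) + 1) * ((i.natAbs + 2) * 0 - 1) ≤ 0 := by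
    have := (Nat.cast_nonneg i.natAbs : (0 : ℝ) ≤ i.natAbs)
    nlinarith
  rw [angle, max_eq_left ((min_le_right _ _).trans this), mul_zero]

theorem angle_one (i : ℤ) : angle i 1 = Real.pi / 2 := by
  have : 1 ≤ ((i.natAbs : ℝ) + 1) * ((i.natAbs + 2) * 1 - 1) := by
    have := (Nat.cast_nonneg i.natAbs : (0 : ℝ) ≤ i.natAbs)
    nlinarith
  rw [angle, min_eq_left this, max_eq_right zero_le_one, mul_one]

/-- For `n = |i|` the angle grows from `0` to `π / 2` exactly while `s` runs from `1 / (n + 2)` to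
`1 / (n + 1)`. So a coordinate of larger absolute value has finished its rotation when a smaller one
begins. -/
theorem cos_angle_mul_sin_angle {i j : ℤ} (h : i.natAbs < j.natAbs) (s : ℝ) :
    Real.cos (angle j s) * Real.sin (angle i s) = 0 := by
  have hi := (Nat.cast_nonneg i.natAbs : (0 : ℝ) ≤ i.natAbs)
  have hij : (i.natAbs : ℝ) + 1 ≤ j.natAbs := by exact_mod_cast h
  rcases le_or_gt (((i.natAbs : ℝ) + 2) * s) 1 with hs | hs
  · have : ((i.natAbs : ℝ) + 1) * ((i.natAbs + 2) * s - 1) ≤ 0 :=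
      mul_nonpos_of_nonneg_of_nonpos (by linarith) (by linarith)
    rw [angle.eq_def i, max_eq_left ((min_le_right _ _).trans this), mul_zero, Real.sin_zero,
      mul_zero]
  · have h0 : 0 < s := by
      by_contra hcon
      nlinarith
    have h1 : 1 < ((j.natAbs : ℝ) + 1) * s := by nlinarith
    have : 1 ≤ ((j.natAbs : ℝ) + 1) * ((j.natAbs + 2) * s - 1) := by
      have e : ((j.natAbs : ℝ) + 1) * ((j.natAbs + 2) * s - 1) =
        (j.natAbs + 1) * ((j.natAbs + 1) * s - 1) + (j.natAbs + 1) * s := by ring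
      rw [e]
      nlinarith
    rw [angle.eq_def j, min_eq_left this, max_eq_right zero_le_one, mul_one, Real.cos_pi_div_two,
      zero_mul]

/-- The identity is rotated into `mv V α` coordinate by coordinate, the outer ones first, and the
result is composed with `mv V φ`. Infinitely many coordinates move near `s = 0`, which is harmless
because continuity concerns one column at a time. The hypothesis `hα'` says that `α` moves every
index outward, as the order of the rotations requires. -/
theorem isomPath_trans {k d : ℤ} {α φ : ℤ ↪ ℤ} (hα : Expands k α)
    (hα' : ∀ i, i.natAbs < (α i).natAbs) (hφ : Expands d φ) (hk : 1 ≤ k) (hkd : k * d ≤ 4)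
    (h : Expands 4 φ) (h' : Expands 4 (φ.trans α)) :
    IsomPath (CIsom.ofEmb ρ φ h) (CIsom.ofEmb ρ (φ.trans α) h') := by
  have hJ : ∀ s, IsIsom 4 ((dg V (fun i => Real.cos (angle i s)) +
      mv V α * dg V fun i => Real.sin (angle i s)) * mv V φ)
      (mvAdj V φ * (dg V (fun i => Real.cos (angle i s)) +
        dg V (fun i => Real.sin (angle i s)) * mvAdj V α)) := fun s =>
    ((isIsom_dg_add_mv_mul_dg hα hk (fun i => cos_sin_half_pi _)
      (fun i => cos_angle_mul_sin_angle (hα' i) s)).mul hφ.isIsom (by omega)).mono hkd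
  have hc : ∀ i, Continuous fun s : I => Real.cos (angle i s) := fun i =>
    Real.continuous_cos.comp (continuous_angle i)
  have hs : ∀ i, Continuous fun s : I => Real.sin (angle i s) := fun i =>
    Real.continuous_sin.comp (continuous_angle i)
  let c : ℝ → Op V := fun s => dg V fun i => Real.cos (angle i s)
  let t : ℝ → Op V := fun s => dg V fun i => Real.sin (angle i s)
  have hcu : ∀ s, FinCont fun _ : Unit => c s := fun s => FinCont.dg fun _ => continuous_const
  have htu : ∀ s, FinCont fun _ : Unit => t s := fun s => FinCont.dg fun _ => continuous_const
  have hcI : FinCont fun s : I => c s := FinCont.dg hc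
  have htI : FinCont fun s : I => t s := FinCont.dg hs
  let γ : I → CIsom ρ := fun s =>
    { J := (c s + mv V α * t s) * mv V φ
      J' := mvAdj V φ * (c s + t s * mvAdj V α)
      isIsom := hJ s
      fin := ((hcu s).add ((FinCont.mv α).mul (htu s))).mul (FinCont.mv φ)
      fin' := (FinCont.mvAdj φ).mul ((hcu s).add ((htu s).mul (FinCont.mvAdj α)))
      inv := ((Inv.dg _).add ((Inv.mv α).mul (Inv.dg _))).mul (Inv.mv φ)
      inv' := (Inv.mvAdj φ).mul ((Inv.dg _).add ((Inv.dg _).mul (Inv.mvAdj α))) }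
  refine ⟨γ, (hcI.add ((FinCont.mv α).mul htI)).mul (FinCont.mv φ),
    (FinCont.mvAdj φ).mul (hcI.add (htI.mul (FinCont.mvAdj α))),
    CIsom.ext ?_ ?_, CIsom.ext ?_ ?_⟩
  · simp only [γ, c, t, Set.Icc.coe_zero, angle_zero, Real.cos_zero, Real.sin_zero, dg_one, dg_zero,
      mul_zero, add_zero, one_mul, CIsom.ofEmb]
  · simp only [γ, c, t, Set.Icc.coe_zero, angle_zero, Real.cos_zero, Real.sin_zero, dg_one, dg_zero,
      zero_mul, add_zero, mul_one, CIsom.ofEmb]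
  · simp only [γ, c, t, Set.Icc.coe_one, angle_one, Real.cos_pi_div_two, Real.sin_pi_div_two, dg_one,
      dg_zero, mul_one, zero_add, CIsom.ofEmb, mv_mul_mv]
  · simp only [γ, c, t, Set.Icc.coe_one, angle_one, Real.cos_pi_div_two, Real.sin_pi_div_two, dg_one,
      dg_zero, one_mul, zero_add, CIsom.ofEmb, mvAdj_mul_mvAdj]

/-- An injection with odd values on nonnegative and even values on negative numbers. -/
def farEmb : ℤ ↪ ℤ := ⟨fun i => if 0 ≤ i then 2 * i + 1 else 2 * i, fun i j h => by
  dsimp only at h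
  split_ifs at h <;> omega⟩

/-- An injection with even values on nonnegative and odd values on negative numbers. -/
def farEmb' : ℤ ↪ ℤ := ⟨fun i => if 0 ≤ i then 2 * i + 2 else 2 * i - 1, fun i j h => by
  dsimp only at h
  split_ifs at h <;> omega⟩

theorem farEmb_apply (i : ℤ) : farEmb i = if 0 ≤ i then 2 * i + 1 else 2 * i := rfl

theorem farEmb'_apply (i : ℤ) : farEmb' i = if 0 ≤ i then 2 * i + 2 else 2 * i - 1 := rfl

theorem expands_farEmb : Expands 2 farEmb where
  nonneg i hi := by rw [farEmb_apply, if_pos hi]; omega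
  neg i hi := by rw [farEmb_apply, if_neg (by omega)]; omega

theorem expands_farEmb' : Expands 3 farEmb' where
  nonneg i hi := by rw [farEmb'_apply, if_pos hi]; omega
  neg i hi := by rw [farEmb'_apply, if_neg (by omega)]; omega

theorem farEmb_ne_farEmb' (i j : ℤ) : farEmb i ≠ farEmb' j := by
  rw [farEmb_apply, farEmb'_apply]
  split_ifs <;> omega

theorem Expands.trans {c d : ℤ} {α β : ℤ ↪ ℤ} (hα : Expands c α) (hβ : Expands d β)
    (hc : 0 ≤ c) : Expands (c * d) (β.trans α) where
  nonneg i hi := by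
    have h1 := hβ.nonneg i hi
    have h2 := hα.nonneg _ h1.1
    refine ⟨h2.1, h2.2.trans_le ?_⟩
    rw [mul_assoc]
    exact mul_le_mul_of_nonneg_left (Int.add_one_le_iff.2 h1.2) hc
  neg i hi := by
    have h1 := hβ.neg i hi
    have h2 := hα.neg _ h1.2
    refine ⟨le_trans ?_ h2.1, h2.2⟩
    rw [mul_assoc]
    exact mul_le_mul_of_nonneg_left h1.1 hc

theorem Expands.refl : Expands 1 (Function.Embedding.refl ℤ) where
  nonneg i hi := by simpa using hi
  neg i hi := by simpa using hi

theorem CIsom.ofEmb_refl :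
    CIsom.ofEmb ρ (Function.Embedding.refl ℤ) (Expands.refl.mono (by norm_num)) = CIsom.one ρ :=
  CIsom.ext (Op.ext_single fun i v => mv_single _ i v)
    (LinearMap.ext fun _ => Finsupp.ext fun _ => rfl)

/-- An invariant of paths of isometries does not distinguish an injection from the identity. -/
theorem CIsom.rel_one {T : Type*} {r : T → T → Prop} (hr : Equivalence r) {c : CIsom ρ → T}
    (hc : ∀ A B, IsomPath A B → r (c A) (c B)) {φ : ℤ ↪ ℤ} (hφ : Expands 2 φ) :
    r (c (CIsom.ofEmb ρ φ (hφ.mono (by norm_num)))) (c (CIsom.one ρ)) := by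
  -- The path runs from `φ` to `farEmb ∘ φ`, then to `farEmb'`, then to the identity. The outer
  -- parts are coordinate rotations along maps that move indices outward; the middle part is a
  -- rotation between orthogonal images, as `farEmb` and `farEmb'` have no common value. The
  -- expansion bound `4` covers `2 * 2` for `farEmb ∘ φ` and `3` for `farEmb'`.
  have h₁ : Expands 4 (φ.trans farEmb) := expands_farEmb.trans hφ (by norm_num)
  have p₁ := isomPath_trans (ρ := ρ) expands_farEmb (fun i => by
    rw [farEmb_apply]; split_ifs <;> omega) hφ (by norm_num) (by norm_num)
    (hφ.mono (by norm_num)) h₁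
  have p₂ := isomPath_rotate (CIsom.ofEmb ρ _ h₁)
    (CIsom.ofEmb ρ farEmb' (expands_farEmb'.mono (by norm_num)))
    (mvAdj_mul_mv_of_ne fun i j => farEmb_ne_farEmb' _ _)
    (mvAdj_mul_mv_of_ne fun i j => (farEmb_ne_farEmb' _ _).symm)
  have p₃ := isomPath_trans (ρ := ρ) expands_farEmb' (fun i => by
    rw [farEmb'_apply]; split_ifs <;> omega) Expands.refl (by norm_num) (by norm_num)
    (Expands.refl.mono (by norm_num)) (expands_farEmb'.mono (by norm_num))
  rw [CIsom.ofEmb_refl] at p₃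
  exact hr.trans (hc _ _ p₁) (hr.trans (hc _ _ p₂) (hr.symm (hc _ _ p₃)))

/-! ### Interleaving -/

/-- The injection onto the even numbers. -/
def evenEmb : ℤ ↪ ℤ := ⟨fun i => 2 * i, fun i j h => by dsimp only at h; omega⟩

/-- The injection onto the odd numbers. -/
def oddEmb : ℤ ↪ ℤ := ⟨fun i => 2 * i + 1, fun i j h => by dsimp only at h; omega⟩

/-- The permutation exchanging `2 i` and `2 i + 1`. -/
def swapEmb : ℤ ↪ ℤ := ⟨fun i => if i % 2 = 0 then i + 1 else i - 1, fun i j h => by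
  dsimp only at h
  split_ifs at h <;> omega⟩

/-- The permutation comparing the two ways to interleave three sequences. -/
def assocEmb : ℤ ↪ ℤ := ⟨fun i => if i % 4 = 0 then i / 2 else if i % 4 = 2 then i - 1 else
  2 * i + 1, fun i j h => by
  dsimp only at h
  split_ifs at h <;> omega⟩

@[simp] theorem evenEmb_apply (i : ℤ) : evenEmb i = 2 * i := rfl

@[simp] theorem oddEmb_apply (i : ℤ) : oddEmb i = 2 * i + 1 := rfl

theorem swapEmb_apply (i : ℤ) : swapEmb i = if i % 2 = 0 then i + 1 else i - 1 := rfl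

theorem assocEmb_apply (i : ℤ) :
    assocEmb i = if i % 4 = 0 then i / 2 else if i % 4 = 2 then i - 1 else 2 * i + 1 := rfl

theorem expands_evenEmb : Expands 2 evenEmb where
  nonneg i hi := by rw [evenEmb_apply]; omega
  neg i hi := by rw [evenEmb_apply]; omega

theorem expands_oddEmb : Expands 2 oddEmb where
  nonneg i hi := by rw [oddEmb_apply]; omega
  neg i hi := by rw [oddEmb_apply]; omega

theorem expands_swapEmb : Expands 2 swapEmb where
  nonneg i hi := by rw [swapEmb_apply]; split_ifs <;> omega
  neg i hi := by rw [swapEmb_apply]; split_ifs <;> omega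

theorem expands_assocEmb : Expands 2 assocEmb where
  nonneg i hi := by rw [assocEmb_apply]; split_ifs <;> omega
  neg i hi := by rw [assocEmb_apply]; split_ifs <;> omega

/-- The image of a projection under an injection of coordinates. -/
def emb (φ : ℤ ↪ ℤ) (P : Op V) : Op V := conj (mv V φ) (mvAdj V φ) P

theorem emb_emb (φ τ : ℤ ↪ ℤ) (P : Op V) : emb φ (emb τ P) = emb (τ.trans φ) P := by
  rw [emb, emb, emb, conj_conj, mv_mul_mv, mvAdj_mul_mvAdj]

theorem emb_osum (φ : ℤ ↪ ℤ) (P Q : Op V) : emb φ (osum P Q) = osum (emb φ P) (emb φ Q) :=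
  conj_osum _ _ _ _

theorem emb_negProj (φ : ℤ ↪ ℤ) : emb φ (negProj V) = negProj V := conj_negProj _ _

/-- The interleaved sum. -/
def isum (P Q : Op V) : Op V := osum (emb evenEmb P) (emb oddEmb Q)

theorem orth_isum (P Q : Op V) : Orth (emb evenEmb P) (emb oddEmb Q) :=
  orth_conj_of_eq_zero (mvAdj_mul_mv_of_ne fun i j => by
    rw [evenEmb_apply, oddEmb_apply]; omega) P Q

theorem IsPt.emb {a b : ℕ} {P : Op V} (h : IsPt a b P) {φ : ℤ ↪ ℤ} (hφ : Expands 2 φ) :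
    IsPt (2 * a) (2 * b) (emb φ P) := h.conj (c := 2) hφ.isIsom

theorem IsPt.isum {a b : ℕ} {P Q : Op V} (h : IsPt a b P) (h' : IsPt a b Q) :
    IsPt (2 * a) (2 * b) (isum P Q) :=
  (h.emb expands_evenEmb).osum (h'.emb expands_oddEmb) (orth_isum P Q)

theorem FinCont.emb {Z : Type*} [TopologicalSpace Z] {P : Z → Op V} (hP : FinCont P)
    (φ : ℤ ↪ ℤ) : FinCont fun z => emb φ (P z) := FinCont.conj (FinCont.mv φ) (FinCont.mvAdj φ) hP

theorem FinCont.isum {Z : Type*} [TopologicalSpace Z] {P Q : Z → Op V} (hP : FinCont P)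
    (hQ : FinCont Q) : FinCont fun z => isum (P z) (Q z) := (hP.emb _).osum (hQ.emb _)

theorem actOp_emb (g : G) (φ : ℤ ↪ ℤ) (P : Op V) : actOp ρ g (emb φ P) = emb φ (actOp ρ g P) :=
  actOp_conj (Inv.mv φ) (Inv.mvAdj φ) g P

theorem actOp_isum (g : G) (P Q : Op V) :
    actOp ρ g (isum P Q) = isum (actOp ρ g P) (actOp ρ g Q) := by
  rw [isum, isum, actOp_osum, actOp_emb, actOp_emb]

theorem isum_negProj_left (Q : Op V) : isum (negProj V) Q = emb oddEmb Q := by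
  rw [isum, emb_negProj, osum_negProj_left]

theorem isum_negProj_right (P : Op V) : isum P (negProj V) = emb evenEmb P := by
  rw [isum, emb_negProj, osum_negProj_right]

theorem emb_swapEmb_isum (P Q : Op V) : emb swapEmb (isum P Q) = isum Q P := by
  have h₁ : evenEmb.trans swapEmb = oddEmb := by
    ext i
    rw [Function.Embedding.trans_apply, swapEmb_apply, evenEmb_apply, oddEmb_apply,
      if_pos (by omega)]
  have h₂ : oddEmb.trans swapEmb = evenEmb := by
    ext i
    rw [Function.Embedding.trans_apply, swapEmb_apply, evenEmb_apply, oddEmb_apply,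
      if_neg (by omega)]
    ring
  rw [isum, isum, emb_osum, emb_emb, emb_emb, h₁, h₂, osum_comm]

/-- On one side `P`, `Q`, `R` occupy the places `4 i`, `4 i + 2`, `2 i + 1`; on the other side `2
i`, `4 i + 1`, `4 i + 3`. -/
theorem emb_assocEmb_isum (P Q R : Op V) :
    emb assocEmb (isum (isum P Q) R) = isum P (isum Q R) := by
  have h₁ : (evenEmb.trans evenEmb).trans assocEmb = evenEmb := by
    ext i
    simp only [Function.Embedding.trans_apply, assocEmb_apply, evenEmb_apply]
    split_ifs <;> omega
  have h₂ : (oddEmb.trans evenEmb).trans assocEmb = evenEmb.trans oddEmb := by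
    ext i
    simp only [Function.Embedding.trans_apply, assocEmb_apply, evenEmb_apply, oddEmb_apply]
    split_ifs <;> omega
  have h₃ : oddEmb.trans assocEmb = oddEmb.trans oddEmb := by
    ext i
    simp only [Function.Embedding.trans_apply, assocEmb_apply, oddEmb_apply]
    split_ifs <;> omega
  simp only [isum, emb_osum, emb_emb, osum_assoc, h₁, h₂, h₃]

/-- Functoriality of conjugation, applied to two factorizations of one injection. It uses plain
conjugation instead of `emb`, since the correction by `negProj` is not invariant under translation.
-/
theorem emb_shift {φ τ : ℤ ↪ ℤ} {k l : ℤ} (h : ∀ i, φ (i + k) = τ i + l) (P : Op V) :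
    mv V φ * shift k P * mvAdj V φ = shift l (mv V τ * P * mvAdj V τ) := by
  have h₁ : (shiftEmb k).trans φ = τ.trans (shiftEmb l) := Function.Embedding.ext h
  have e : ∀ k : ℤ, mv V (shiftEmb (-k)) = mvAdj V (shiftEmb k) := fun k => (mvAdj_shiftEmb k).symm
  calc mv V φ * shift k P * mvAdj V φ = (mv V φ * mv V (shiftEmb k)) * P *
        (mvAdj V (shiftEmb k) * mvAdj V φ) := by simp only [shift, e, mul_assoc]
    _ = (mv V (shiftEmb l) * mv V τ) * P * (mvAdj V τ * mvAdj V (shiftEmb l)) := by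
      rw [mv_mul_mv, mvAdj_mul_mvAdj, mv_mul_mv, mvAdj_mul_mvAdj, h₁]
    _ = shift l (mv V τ * P * mvAdj V τ) := by simp only [shift, e, mul_assoc]

theorem shift_add (k : ℤ) (P Q : Op V) : shift k (P + Q) = shift k P + shift k Q := by
  rw [shift, mul_add, add_mul, shift, shift]

/-- Even and odd numbers together exhaust the integers, so the two conjugates of `negProj` add up to
`negProj` and the corrections in `emb` and `osum` cancel. -/
theorem isum_eq (P Q : Op V) : isum P Q = mv V evenEmb * P * mvAdj V evenEmb +
    mv V oddEmb * Q * mvAdj V oddEmb := by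
  have e : mv V evenEmb * negProj V * mvAdj V evenEmb + mv V oddEmb * negProj V * mvAdj V oddEmb =
      negProj V := by
    rw [expands_evenEmb.isIsom.comm, expands_oddEmb.isIsom.comm, mul_assoc, mul_assoc, ← mul_add]
    have : mv V evenEmb * mvAdj V evenEmb + mv V oddEmb * mvAdj V oddEmb = 1 :=
      Op.ext_single fun i v => by
        rw [LinearMap.add_apply, Module.End.mul_apply, Module.End.mul_apply]
        rcases Int.even_or_odd' i with ⟨k, rfl | rfl⟩
        · rw [← evenEmb_apply, mvAdj_single, mv_single, mvAdj_single_of_ne (fun j => by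
            rw [oddEmb_apply, evenEmb_apply]; omega), map_zero, add_zero, Module.End.one_apply]
        · rw [← oddEmb_apply, mvAdj_single, mv_single, mvAdj_single_of_ne (fun j => by
            rw [oddEmb_apply, evenEmb_apply]; omega), map_zero, zero_add, Module.End.one_apply]
    rw [this, mul_one]
  rw [isum, osum, emb, emb, conj, conj, mul_sub, mul_sub, sub_mul, sub_mul]
  have e' : ∀ a b c d p : Op V, c + d = p → p + (a - c) + (p + (b - d)) - p = a + b := by
    rintro a b c d _ rfl
    abel
  exact e' _ _ _ _ _ e

/-- Translating the input by `n` translates both even and odd places by `2 n`; this is why the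
product takes stage `n` to stage `2 n`. -/
theorem isum_shift (n : ℤ) (P Q : Op V) :
    isum (shift n P) (shift n Q) = shift (2 * n) (isum P Q) := by
  rw [isum_eq, isum_eq, shift_add, emb_shift (k := n) (l := 2 * n) (τ := evenEmb) (fun i => by
    simp only [evenEmb_apply]; ring), emb_shift (k := n) (l := 2 * n) (τ := oddEmb) (fun i => by
    simp only [oddEmb_apply]; ring)]

/-- Adding a copy of `V` is translation. -/
theorem isum_shift_negProj (Q : Op V) :
    isum (shift 1 (negProj V)) Q = shift 1 (emb evenEmb Q) := by
  have h := isum_negProj_right (V := V) Q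
  rw [isum_eq] at h ⊢
  -- From `2 (i + 1) = (2 i + 1) + 1` and the fact that odd places are even places moved by one, the
  -- left side is the translate of the interleaving of `Q` with `negProj V` in the other order.
  rw [← h, shift_add, emb_shift (k := 1) (l := 1) (τ := oddEmb) (fun i => by
    simp only [oddEmb_apply, evenEmb_apply]; ring), ← emb_shift (φ := oddEmb) (τ := evenEmb)
    (k := 0) (l := 1) (fun i => by simp only [oddEmb_apply, evenEmb_apply]; ring), shift_zero,
    add_comm]

end Deformations

end TelGC

end

noncomputable section

open unitInterval

namespace TelGC

/-! ## Equivariant homotopies -/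

section GHomotopies

variable {G : Type w} [Group G] {X Y Z : Type*} [TopologicalSpace X] [TopologicalSpace Y]
  [TopologicalSpace Z] [MulAction G X] [MulAction G Y] [MulAction G Z]

theorem gHomotopicRel_empty {f f' : C(X, Y)} : GHomotopicRel G f f' ∅ ↔ GHomotopic G f f' :=
  ⟨fun ⟨H, hH⟩ => ⟨H.toHomotopy, hH⟩,
    fun ⟨H, hH⟩ => ⟨⟨H, fun _ _ h => absurd h (Set.notMem_empty _)⟩, hH⟩⟩

theorem IsEquivariant.comp {g : C(Y, Z)} {f : C(X, Y)} (hg : IsEquivariant G g)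
    (hf : IsEquivariant G f) : IsEquivariant G (g.comp f) := fun a x => by
  rw [ContinuousMap.comp_apply, hf, hg, ContinuousMap.comp_apply]

theorem IsEquivariant.id : IsEquivariant G (ContinuousMap.id X) := fun _ _ => rfl

theorem IsEquivariant.prodMap {X' Y' : Type*} [TopologicalSpace X'] [TopologicalSpace Y']
    [MulAction G X'] [MulAction G Y'] {f : C(X, Y)} {f' : C(X', Y')} (hf : IsEquivariant G f)
    (hf' : IsEquivariant G f') : IsEquivariant G (f.prodMap f') := fun a x =>
  Prod.ext (hf a x.1) (hf' a x.2)

namespace GHomotopicRel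

variable {f f' f'' : C(X, Y)} {S : Set X}

theorem of_map (H : I → X → Y) (hc : Continuous fun q : I × X => H q.1 q.2)
    (h₀ : ∀ x, H 0 x = f x) (h₁ : ∀ x, H 1 x = f' x) (hS : ∀ t, ∀ x ∈ S, H t x = f x)
    (hg : ∀ (g : G) t x, H t (g • x) = g • H t x) : GHomotopicRel G f f' S :=
  ⟨{ toFun := fun q => H q.1 q.2
     continuous_toFun := hc
     map_zero_left := h₀
     map_one_left := h₁
     prop' := fun t x hx => hS t x hx }, hg⟩

theorem refl (hf : IsEquivariant G f) : GHomotopicRel G f f S :=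
  ⟨ContinuousMap.HomotopyRel.refl f S, fun g _ x => hf g x⟩

theorem symm (h : GHomotopicRel G f f' S) : GHomotopicRel G f' f S := by
  obtain ⟨H, hH⟩ := h
  exact ⟨H.symm, fun g t x => hH g _ x⟩

theorem trans (h : GHomotopicRel G f f' S) (h' : GHomotopicRel G f' f'' S) :
    GHomotopicRel G f f'' S := by
  obtain ⟨H, hH⟩ := h
  obtain ⟨H', hH'⟩ := h'
  refine ⟨H.trans H', fun g t x => ?_⟩
  rw [ContinuousMap.HomotopyRel.trans_apply, ContinuousMap.HomotopyRel.trans_apply]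
  split_ifs
  · exact hH g _ x
  · exact hH' g _ x

theorem equivalence : Equivalence fun f f' : {f : C(X, Y) // IsEquivariant G f} =>
    GHomotopicRel G f.1 f'.1 S := ⟨fun f => refl f.2, symm, trans⟩

theorem comp_left (h : GHomotopicRel G f f' S) {g : C(Y, Z)} (hg : IsEquivariant G g) :
    GHomotopicRel G (g.comp f) (g.comp f') S := by
  obtain ⟨H, hH⟩ := h
  exact of_map (fun t x => g (H (t, x))) (g.continuous.comp (map_continuous H)) (by simp) (by simp)
    (fun t x hx => congrArg g (H.eq_fst t hx)) fun a t x => by rw [hH, hg]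

theorem comp_right {g g' : C(Y, Z)} {T : Set Y} (h : GHomotopicRel G g g' T)
    (hf : IsEquivariant G f) (hS : Set.MapsTo f S T) :
    GHomotopicRel G (g.comp f) (g'.comp f) S := by
  obtain ⟨H, hH⟩ := h
  exact of_map (fun t x => H (t, f x))
    ((map_continuous H).comp (continuous_fst.prodMk (f.continuous.comp continuous_snd)))
    (by simp) (by simp)
    (fun t x hx => H.eq_fst t (hS hx)) fun a t x => by rw [hf, hH]

end GHomotopicRel

namespace GHomotopic

variable {f f' f'' : C(X, Y)}

theorem refl (hf : IsEquivariant G f) : GHomotopic G f f :=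
  gHomotopicRel_empty.1 (.refl hf)

theorem symm (h : GHomotopic G f f') : GHomotopic G f' f :=
  gHomotopicRel_empty.1 (gHomotopicRel_empty.2 h).symm

theorem trans (h : GHomotopic G f f') (h' : GHomotopic G f' f'') : GHomotopic G f f'' :=
  gHomotopicRel_empty.1 ((gHomotopicRel_empty.2 h).trans (gHomotopicRel_empty.2 h'))

theorem comp_left (h : GHomotopic G f f') {g : C(Y, Z)} (hg : IsEquivariant G g) :
    GHomotopic G (g.comp f) (g.comp f') :=
  gHomotopicRel_empty.1 ((gHomotopicRel_empty.2 h).comp_left hg)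

theorem comp_right {g g' : C(Y, Z)} (h : GHomotopic G g g') (hf : IsEquivariant G f) :
    GHomotopic G (g.comp f) (g'.comp f) :=
  gHomotopicRel_empty.1 ((gHomotopicRel_empty.2 h).comp_right hf (Set.mapsTo_empty _ _))

theorem prodMap {X' Y' : Type*} [TopologicalSpace X'] [TopologicalSpace Y']
    [MulAction G X'] [MulAction G Y'] {k k' : C(X', Y')} (h : GHomotopic G f f')
    (h' : GHomotopic G k k') : GHomotopic G (f.prodMap k) (f'.prodMap k') := by
  obtain ⟨H, hH⟩ := h
  obtain ⟨H', hH'⟩ := h'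
  refine gHomotopicRel_empty.1 (GHomotopicRel.of_map
    (fun t x => (H (t, x.1), H' (t, x.2))) (by fun_prop) (fun x => Prod.ext (by simp) (by simp))
    (fun x => Prod.ext (by simp) (by simp)) (fun _ _ h => absurd h (Set.notMem_empty _)) fun g t x => ?_)
  exact Prod.ext (hH g t x.1) (hH' g t x.2)

end GHomotopic

theorem GHomotopicRel.toGHomotopic {f f' : C(X, Y)} {S : Set X} (h : GHomotopicRel G f f' S) :
    GHomotopic G f f' := by
  obtain ⟨H, hH⟩ := h
  exact ⟨H.toHomotopy, hH⟩

/-- Homotopies are constant at points that go to isolated points. -/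
theorem GHomotopic.rel {f f' : C(X, Y)} (h : GHomotopic G f f') {x : X} {y : Y}
    (hx : f x = y) (hy : IsClopen {y}) : GHomotopicRel G f f' {x} := by
  obtain ⟨H, hH⟩ := h
  have key : ∀ t, H (t, x) = y := fun t => by
    have hc : IsClopen ((fun t : I => H (t, x)) ⁻¹' {y}) := hy.preimage (by fun_prop)
    have := hc.eq_univ ⟨0, (H.apply_zero x).trans hx⟩
    exact Set.eq_univ_iff_forall.1 this t
  refine ⟨⟨H, fun t x' hx' => ?_⟩, hH⟩
  rw [Set.mem_singleton_iff.1 hx']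
  exact (key t).trans hx.symm

end GHomotopies

/-! ## The H-space of subspaces -/

section GrassmannianHSpace

variable {G : Type w} [Group G] {V : Type u} [NormedAddCommGroup V] [InnerProductSpace ℂ V]
  {ρ : G →* (V ≃ₗᵢ[ℂ] V)}

/-- The isometry of coordinates onto the even ones. -/
def evenIsom (ρ : G →* (V ≃ₗᵢ[ℂ] V)) : CIsom ρ :=
  CIsom.ofEmb ρ evenEmb (expands_evenEmb.mono (by norm_num))

/-- The isometry of coordinates onto the odd ones. -/
def oddIsom (ρ : G →* (V ≃ₗᵢ[ℂ] V)) : CIsom ρ :=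
  CIsom.ofEmb ρ oddEmb (expands_oddEmb.mono (by norm_num))

theorem even_mul_odd : (evenIsom ρ).J' * (oddIsom ρ).J = 0 :=
  mvAdj_mul_mv_of_ne fun i j => by rw [evenEmb_apply, oddEmb_apply]; omega

theorem odd_mul_even : (oddIsom ρ).J' * (evenIsom ρ).J = 0 :=
  mvAdj_mul_mv_of_ne fun i j => by rw [evenEmb_apply, oddEmb_apply]; omega

/-- Two isometries that preserve orthogonality. -/
def PresOrth (A B : CIsom ρ) : Prop :=
  ∀ P Q : Op V, Orth P Q → Orth (conj A.J A.J' P) (conj B.J B.J' Q)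

theorem presOrth_self (A : CIsom ρ) : PresOrth A A := fun _ _ h => orth_conj A.isIsom h

theorem IsGammaProduct.equivariant {μ : C(GrInf ρ × GrInf ρ, GrInf ρ)} (h : IsGammaProduct ρ μ) :
    IsEquivariant G μ := by
  obtain ⟨r, hr, -, -, rfl⟩ := h
  exact IsEquivariant.comp sumInf_smul hr

theorem smul_zeroInf (g : G) : g • zeroInf ρ = zeroInf ρ := congrArg (toInf ρ 0) (Gr.smul_bot g)

variable [FiniteDimensional ℂ V]

/-- The action of an isometry on subspaces. -/
def CIsom.act (A : CIsom ρ) (x : GrInf ρ) : GrInf ρ :=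
  ofOpInf ρ (conj A.J A.J' (opInf x)) (by
    obtain ⟨n, h⟩ := exists_isPt_opInf x
    exact ⟨4 * n, h.conj (c := 4) A.isIsom⟩)

theorem opInf_act (A : CIsom ρ) (x : GrInf ρ) : opInf (A.act x) = conj A.J A.J' (opInf x) :=
  opInf_ofOpInf _

theorem isPt_act (A : CIsom ρ) {n : ℕ} (p : Gr ρ n) : IsPt 0 (4 * n) (opInf (A.act (toInf ρ n p))) := by
  rw [opInf_act]
  exact p.isPt_op.conj (c := 4) A.isIsom

theorem act_smul (A : CIsom ρ) (g : G) (x : GrInf ρ) : A.act (g • x) = g • A.act x :=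
  opInf_injective (by rw [opInf_act, opInf_smul, opInf_smul, opInf_act, actOp_conj A.inv A.inv'])

theorem act_one (x : GrInf ρ) : (CIsom.one ρ).act x = x :=
  opInf_injective ((opInf_act _ x).trans (conj_one _))

theorem act_zeroInf (A : CIsom ρ) : A.act (zeroInf ρ) = zeroInf ρ :=
  opInf_injective (by rw [opInf_act, opInf_zeroInf, conj_negProj])

theorem continuous_act_path {Z : Type*} [TopologicalSpace Z] [CompactSpace Z] [T2Space Z]
    {γ : Z → CIsom ρ} (h : FinCont fun s => (γ s).J) (h' : FinCont fun s => (γ s).J') :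
    Continuous fun q : Z × GrInf ρ => (γ q.1).act q.2 := by
  refine (IsCompactFamily.id.prod (isCompactFamily_toInf ρ)).continuous_iff.2 fun i => ?_
  refine continuous_of_opInf (n := 4 * i.2) ?_ fun q => isPt_act _ _
  simp only [Function.comp_apply, opInf_act, opInf_toInf]
  exact FinCont.conj (h.comp continuous_fst) (h'.comp continuous_fst)
    (Gr.finCont_op.comp continuous_snd)

theorem continuous_act (A : CIsom ρ) : Continuous A.act := by
  refine (isCompactFamily_toInf ρ).continuous_iff.2 fun i => ?_
  refine continuous_of_opInf (n := 4 * i) ?_ fun q => isPt_act _ _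
  simp only [Function.comp_apply, opInf_act, opInf_toInf]
  exact FinCont.conj A.finCont A.finCont' Gr.finCont_op

theorem opInf_act_ofEmb {φ : ℤ ↪ ℤ} (h : Expands 4 φ) (x : GrInf ρ) :
    opInf ((CIsom.ofEmb ρ φ h).act x) = emb φ (opInf x) := opInf_act _ x

/-- The action of an isometry as an equivariant map. -/
def CIsom.actMap (A : CIsom ρ) : {f : C(GrInf ρ, GrInf ρ) // IsEquivariant G f} :=
  ⟨⟨A.act, continuous_act A⟩, act_smul A⟩

theorem gHomotopicRel_actMap_of_path {A B : CIsom ρ} (h : IsomPath A B) :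
    GHomotopicRel G A.actMap.1 B.actMap.1 {zeroInf ρ} := by
  obtain ⟨γ, h, h', rfl, rfl⟩ := h
  exact GHomotopicRel.of_map (fun s => (γ s).act) (continuous_act_path h h') (fun _ => rfl)
    (fun _ => rfl)
    (fun t x hx => by
      rw [Set.mem_singleton_iff.1 hx, act_zeroInf]
      exact (act_zeroInf _).symm)
    fun g t x => act_smul _ g x

/-- The action of an injection on subspaces is homotopic to the identity. -/
theorem gHomotopicRel_actMap {φ : ℤ ↪ ℤ} (hφ : Expands 2 φ) :
    GHomotopicRel G (CIsom.ofEmb ρ φ (hφ.mono (by norm_num))).actMap.1 (.id _) {zeroInf ρ} := by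
  have h := CIsom.rel_one (ρ := ρ) GHomotopicRel.equivalence (c := CIsom.actMap)
    (fun _ _ => gHomotopicRel_actMap_of_path) hφ
  have e : (CIsom.one ρ).actMap.1 = .id _ := ContinuousMap.ext act_one
  rwa [e] at h

/-! ### Orthogonal pairs -/

/-- The point of the space of orthogonal pairs given by two orthogonal subspaces. -/
def mkOrth (x y : GrInf ρ) (h : Orth (opInf x) (opInf y)) : OrthInf ρ :=
  (exists_orthInf (x := (x, y)) h).choose

theorem inclInf_mkOrth {x y : GrInf ρ} (h : Orth (opInf x) (opInf y)) :
    inclInf ρ (mkOrth x y h) = (x, y) := (exists_orthInf (x := (x, y)) h).choose_spec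

theorem PresOrth.orth {A B : CIsom ρ} (h : PresOrth A B) (w : OrthInf ρ) :
    Orth (opInf (A.act (inclInf ρ w).1)) (opInf (B.act (inclInf ρ w).2)) := by
  rw [opInf_act, opInf_act]
  exact h _ _ (orth_inclInf w)

/-- The action of two isometries on orthogonal pairs. -/
def actOrth {A B : CIsom ρ} (h : PresOrth A B) (w : OrthInf ρ) : OrthInf ρ :=
  mkOrth (A.act (inclInf ρ w).1) (B.act (inclInf ρ w).2) (h.orth w)

theorem inclInf_actOrth {A B : CIsom ρ} (h : PresOrth A B) (w : OrthInf ρ) :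
    inclInf ρ (actOrth h w) = (A.act (inclInf ρ w).1, B.act (inclInf ρ w).2) := inclInf_mkOrth _

/-- The two members of a pair may be moved by different isometries, provided that orthogonality
survives at every time. -/
theorem gHomotopic_actOrth {γ δ : I → CIsom ρ} (h₁ : FinCont fun s => (γ s).J)
    (h₂ : FinCont fun s => (γ s).J') (h₃ : FinCont fun s => (δ s).J)
    (h₄ : FinCont fun s => (δ s).J') (h : ∀ s, PresOrth (γ s) (δ s)) {f f' : C(OrthInf ρ, OrthInf ρ)}
    (hf : ∀ w, inclInf ρ (f w) = ((γ 0).act (inclInf ρ w).1, (δ 0).act (inclInf ρ w).2))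
    (hf' : ∀ w, inclInf ρ (f' w) = ((γ 1).act (inclInf ρ w).1, (δ 1).act (inclInf ρ w).2)) :
    GHomotopic G f f' := by
  refine gHomotopicRel_empty.1 (GHomotopicRel.of_map (fun s => actOrth (h s)) ?_ ?_ ?_ ?_ ?_)
  · have : ∀ i, CompactSpace ((orthSeq ρ).X i) := fun i =>
      inferInstanceAs (CompactSpace (OrthPair ρ i))
    refine (IsCompactFamily.id.prod (isCompactFamily_orth ρ)).continuous_iff.2 fun i => ?_
    have c₁ : Continuous fun q : I × OrthPair ρ i.2 => q.2.1.1 :=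
      continuous_fst.comp (OrthPair.continuous_val.comp continuous_snd)
    have c₂ : Continuous fun q : I × OrthPair ρ i.2 => q.2.1.2 :=
      continuous_snd.comp (OrthPair.continuous_val.comp continuous_snd)
    refine continuous_of_inclInf (n := 4 * i.2) ?_ ?_ (fun q => ?_) fun q => ?_
    · simp only [Function.comp_apply, inclInf_actOrth, opInf_act]
      exact FinCont.conj (h₁.comp continuous_fst) (h₂.comp continuous_fst)
        (Gr.finCont_op.comp c₁)
    · simp only [Function.comp_apply, inclInf_actOrth, opInf_act]
      exact FinCont.conj (h₃.comp continuous_fst) (h₄.comp continuous_fst)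
        (Gr.finCont_op.comp c₂)
    · simp only [Function.comp_apply, inclInf_actOrth]
      exact isPt_act _ _
    · simp only [Function.comp_apply, inclInf_actOrth]
      exact isPt_act _ _
  · exact fun w => inclInf_injective ((inclInf_actOrth _ _).trans (hf w).symm)
  · exact fun w => inclInf_injective ((inclInf_actOrth _ _).trans (hf' w).symm)
  · exact fun _ _ h => absurd h (Set.notMem_empty _)
  · intro g t w
    refine inclInf_injective ?_
    rw [inclInf_actOrth, inclInf_smul, inclInf_smul, inclInf_actOrth, Prod.smul_fst, Prod.smul_snd,
      act_smul, act_smul]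
    rfl

/-- The interleaving of two subspaces. -/
def interleave (ρ : G →* (V ≃ₗᵢ[ℂ] V)) : C(GrInf ρ × GrInf ρ, OrthInf ρ) where
  toFun x := mkOrth ((evenIsom ρ).act x.1) ((oddIsom ρ).act x.2) (by
    rw [opInf_act, opInf_act]
    exact orth_isum _ _)
  continuous_toFun := by
    refine ((isCompactFamily_toInf ρ).prod (isCompactFamily_toInf ρ)).continuous_iff.2 fun i => ?_
    refine continuous_of_inclInf (n := max (4 * i.1) (4 * i.2)) ?_ ?_ (fun q => ?_) fun q => ?_
    · simp only [Function.comp_apply, inclInf_mkOrth, opInf_act, opInf_toInf]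
      exact FinCont.conj (evenIsom ρ).finCont (evenIsom ρ).finCont'
        (Gr.finCont_op.comp continuous_fst)
    · simp only [Function.comp_apply, inclInf_mkOrth, opInf_act, opInf_toInf]
      exact FinCont.conj (oddIsom ρ).finCont (oddIsom ρ).finCont'
        (Gr.finCont_op.comp continuous_snd)
    · simp only [Function.comp_apply, inclInf_mkOrth]
      exact (isPt_act _ _).mono le_rfl (le_max_left _ _)
    · simp only [Function.comp_apply, inclInf_mkOrth]
      exact (isPt_act _ _).mono le_rfl (le_max_right _ _)

theorem inclInf_interleave (x : GrInf ρ × GrInf ρ) :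
    inclInf ρ (interleave ρ x) = ((evenIsom ρ).act x.1, (oddIsom ρ).act x.2) :=
  inclInf_mkOrth (by rw [opInf_act, opInf_act]; exact orth_isum _ _)

theorem interleave_smul : IsEquivariant G (interleave ρ) := fun g x => inclInf_injective (by
  rw [inclInf_interleave, inclInf_smul, inclInf_interleave, Prod.smul_fst, Prod.smul_snd, act_smul,
    act_smul]
  rfl)

theorem gHomotopic_inclInf_interleave : GHomotopic G ((inclInf ρ).comp (interleave ρ)) (.id _) := by
  have e : (inclInf ρ).comp (interleave ρ) =
      (evenIsom ρ).actMap.1.prodMap (oddIsom ρ).actMap.1 := ContinuousMap.ext inclInf_interleave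
  rw [e]
  exact (gHomotopicRel_actMap expands_evenEmb).toGHomotopic.prodMap
    (gHomotopicRel_actMap expands_oddEmb).toGHomotopic

/-- For an orthogonal pair there is an intermediate map that applies the even isometry to both
members. It is homotopic to the identity through isometries acting on both members, and to
interleaving by rotating the second member alone. -/
theorem gHomotopic_interleave_inclInf : GHomotopic G ((interleave ρ).comp (inclInf ρ)) (.id _) := by
  have hc : ∀ A : CIsom ρ, Continuous (actOrth (presOrth_self A)) := fun A => by
    refine (isCompactFamily_orth ρ).continuous_iff.2 fun i => ?_
    refine continuous_of_inclInf (n := 4 * i) ?_ ?_ (fun q => ?_) fun q => ?_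
    · simp only [Function.comp_apply, inclInf_actOrth, opInf_act]
      exact FinCont.conj A.finCont A.finCont'
        (Gr.finCont_op.comp (continuous_fst.comp OrthPair.continuous_val))
    · simp only [Function.comp_apply, inclInf_actOrth, opInf_act]
      exact FinCont.conj A.finCont A.finCont'
        (Gr.finCont_op.comp (continuous_snd.comp OrthPair.continuous_val))
    · simp only [Function.comp_apply, inclInf_actOrth]
      exact isPt_act _ _
    · simp only [Function.comp_apply, inclInf_actOrth]
      exact isPt_act _ _
  let c : CIsom ρ → {f : C(OrthInf ρ, OrthInf ρ) // IsEquivariant G f} := fun A =>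
    ⟨⟨_, hc A⟩, fun g w => inclInf_injective (by
      simp only [ContinuousMap.coe_mk]
      rw [inclInf_actOrth, inclInf_smul, inclInf_smul, inclInf_actOrth, Prod.smul_fst,
        Prod.smul_snd, act_smul, act_smul]
      rfl)⟩
  have h := CIsom.rel_one (ρ := ρ) GHomotopicRel.equivalence (c := c) (fun A B hAB => by
    obtain ⟨γ, h, h', rfl, rfl⟩ := hAB
    exact gHomotopicRel_empty.2 (gHomotopic_actOrth h h' h h' (fun s => presOrth_self (γ s))
      (fun w => inclInf_actOrth (presOrth_self _) w)
      fun w => inclInf_actOrth (presOrth_self _) w)) expands_evenEmb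
  have e : (c (CIsom.one ρ)).1 = .id _ := ContinuousMap.ext fun w => inclInf_injective
    ((inclInf_actOrth (presOrth_self _) w).trans (Prod.ext (act_one _) (act_one _)))
  rw [e, gHomotopicRel_empty] at h
  refine GHomotopic.trans ?_ h
  -- The first member stays in the even places while the second rotates from even to odd places;
  -- `orth_conj_rotate` keeps them orthogonal throughout.
  refine GHomotopic.symm (gHomotopic_actOrth (γ := fun _ => evenIsom ρ)
    (δ := rotateIsom (evenIsom ρ) (oddIsom ρ) even_mul_odd odd_mul_even) (evenIsom ρ).finCont
    (evenIsom ρ).finCont' (finCont_rotateIsom _ _ _ _) (finCont_rotateIsom' _ _ _ _) ?_ ?_ ?_)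
  · exact fun s P Q hPQ => orth_conj_rotate (evenIsom ρ).isIsom even_mul_odd hPQ _ _
  · intro w
    rw [rotateIsom_zero]
    exact inclInf_actOrth (presOrth_self _) w
  · intro w
    rw [rotateIsom_one]
    exact inclInf_interleave _

/-- The interleaved sum of subspaces. -/
def sumMap (ρ : G →* (V ≃ₗᵢ[ℂ] V)) : C(GrInf ρ × GrInf ρ, GrInf ρ) :=
  (sumInf ρ).comp (interleave ρ)

theorem isGammaProduct_sumMap : IsGammaProduct ρ (sumMap ρ) :=
  ⟨interleave ρ, interleave_smul, gHomotopic_inclInf_interleave, gHomotopic_interleave_inclInf, rfl⟩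

theorem opInf_sumMap (x : GrInf ρ × GrInf ρ) :
    opInf (sumMap ρ x) = isum (opInf x.1) (opInf x.2) := by
  rw [sumMap, ContinuousMap.comp_apply, opInf_sumInf, inclInf_interleave, opInf_act, opInf_act]
  rfl

theorem sumMap_smul : IsEquivariant G (sumMap ρ) :=
  IsEquivariant.comp sumInf_smul interleave_smul

/-- Homotopy inverses are unique: `r` is homotopic to `interleave ∘ inclInf ∘ r`, which is homotopic
to `interleave`. -/
theorem IsGammaProduct.gHomotopic {μ : C(GrInf ρ × GrInf ρ, GrInf ρ)} (h : IsGammaProduct ρ μ) :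
    GHomotopic G μ (sumMap ρ) := by
  obtain ⟨r, hr, h₁, -, rfl⟩ := h
  refine GHomotopic.comp_left ?_ sumInf_smul
  exact ((gHomotopic_interleave_inclInf (ρ := ρ)).comp_right hr).symm.trans
    (h₁.comp_left interleave_smul)

/-- The zero subspace is an isolated point. -/
theorem isClopen_zeroInf : IsClopen {zeroInf ρ} := by
  refine ⟨isClosed_singleton, (isCompactFamily_toInf ρ).open_of _ fun n => ?_⟩
  -- An idempotent satisfies `‖p‖ ≤ ‖p‖ ^ 2`, so a nonzero one has norm at least one.
  have e : (toInf ρ n : Gr ρ n → GrInf ρ) ⁻¹' {zeroInf ρ} = {p | ‖p.1‖ < 1} := by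
    ext p
    constructor
    · intro hp
      have : p = Gr.bot ρ n := Gr.op_injective (by
        rw [Gr.op_bot, ← opInf_toInf, Set.mem_singleton_iff.1 hp, opInf_zeroInf])
      rw [this]
      exact lt_of_eq_of_lt norm_zero zero_lt_one
    · intro hp
      have h0 : p.1 = 0 := by
        by_contra hcon
        have h1 := norm_pos_iff.2 hcon
        have h2 : ‖p.1‖ ≤ ‖p.1‖ * ‖p.1‖ := by
          have : p.1 ∘L p.1 = p.1 := ContinuousLinearMap.ext p.idem
          calc ‖p.1‖ = ‖p.1 ∘L p.1‖ := by rw [this]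
            _ ≤ ‖p.1‖ * ‖p.1‖ := ContinuousLinearMap.opNorm_comp_le _ _
        have h3 : ‖p.1‖ < 1 := hp
        nlinarith
      have : p = Gr.bot ρ n := Subtype.ext h0
      refine opInf_injective ?_
      rw [this, opInf_toInf, Gr.op_bot, opInf_zeroInf]
  rw [e]
  exact isOpen_lt Gr.continuous_val.norm continuous_const

theorem sumMap_zero_left : (sumMap ρ).comp ((ContinuousMap.const _ (zeroInf ρ)).prodMk (.id _)) =
    (oddIsom ρ).actMap.1 := ContinuousMap.ext fun x => opInf_injective (by
  rw [ContinuousMap.comp_apply, opInf_sumMap]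
  refine (congrArg₂ isum opInf_zeroInf rfl).trans ((isum_negProj_left _).trans ?_)
  exact (opInf_act_ofEmb _ _).symm)

theorem sumMap_zero_right : (sumMap ρ).comp ((ContinuousMap.id _).prodMk (.const _ (zeroInf ρ))) =
    (evenIsom ρ).actMap.1 := ContinuousMap.ext fun x => opInf_injective (by
  rw [ContinuousMap.comp_apply, opInf_sumMap]
  refine (congrArg₂ isum rfl opInf_zeroInf).trans ((isum_negProj_right _).trans ?_)
  exact (opInf_act_ofEmb _ _).symm)

/-- The two orders of interleaving differ strictly by the permutation `swapEmb`, whose action is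
homotopic to the identity. -/
theorem sumMap_comm : GHomotopic G (sumMap ρ) ((sumMap ρ).comp ContinuousMap.prodSwap) := by
  have e : (sumMap ρ).comp ContinuousMap.prodSwap = (CIsom.ofEmb ρ swapEmb
      (expands_swapEmb.mono (by norm_num))).actMap.1.comp (sumMap ρ) :=
    ContinuousMap.ext fun x => opInf_injective (by
      rw [ContinuousMap.comp_apply, opInf_sumMap]
      refine Eq.trans ?_ (opInf_act_ofEmb _ _).symm
      rw [opInf_sumMap]
      exact (emb_swapEmb_isum _ _).symm)
  rw [e]
  exact ((gHomotopicRel_actMap expands_swapEmb).toGHomotopic.comp_right sumMap_smul).symm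

theorem sumMap_assoc : GHomotopic G ((sumMap ρ).comp ((sumMap ρ).prodMap (.id _)))
    (((sumMap ρ).comp ((ContinuousMap.id _).prodMap (sumMap ρ))).comp (assocMap _)) := by
  have e : ((sumMap ρ).comp ((ContinuousMap.id _).prodMap (sumMap ρ))).comp (assocMap _) =
      (CIsom.ofEmb ρ assocEmb (expands_assocEmb.mono (by norm_num))).actMap.1.comp
        ((sumMap ρ).comp ((sumMap ρ).prodMap (.id _))) :=
    ContinuousMap.ext fun x => opInf_injective (by
      refine Eq.trans ?_ (opInf_act_ofEmb _ _).symm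
      simp only [ContinuousMap.comp_apply, opInf_sumMap]
      refine (congrArg₂ isum rfl (opInf_sumMap _)).trans ?_
      refine (emb_assocEmb_isum _ _ _).symm.trans ?_
      exact congrArg (emb assocEmb) (congrArg₂ isum (opInf_sumMap _).symm rfl))
  rw [e]
  exact ((gHomotopicRel_actMap expands_assocEmb).toGHomotopic.comp_right
    (sumMap_smul.comp (sumMap_smul.prodMap IsEquivariant.id))).symm

/-- The H-space structure on the infinite Grassmannian. -/
theorem IsGammaProduct.exists_gHCommSpace {μ : C(GrInf ρ × GrInf ρ, GrInf ρ)}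
    (h : IsGammaProduct ρ μ) : ∃ A : GHCommSpace G (GrInf ρ), A.hmul = μ ∧ A.e = zeroInf ρ := by
  have hμ := h.gHomotopic
  have hμs := h.equivariant
  have h00 : sumMap ρ (zeroInf ρ, zeroInf ρ) = zeroInf ρ := opInf_injective (by
    rw [opInf_sumMap, opInf_zeroInf, isum_negProj_left, emb_negProj])
  -- The product `μ` is only known up to free homotopy. Since zero is isolated, the homotopy from
  -- `sumMap` is constant at the base point, so the strict equation follows; the other homotopies
  -- become based in the same way.
  have h0 : μ (zeroInf ρ, zeroInf ρ) = zeroInf ρ := by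
    obtain ⟨H, -⟩ := hμ.symm.rel h00 isClopen_zeroInf
    exact (H.apply_one _).symm.trans ((H.eq_fst 1 (Set.mem_singleton _)).trans h00)
  have he : IsEquivariant G (ContinuousMap.const (GrInf ρ) (zeroInf ρ)) := fun g _ =>
    (smul_zeroInf g).symm
  have h₁ : GHomotopicRel G (μ.comp ((ContinuousMap.const _ (zeroInf ρ)).prodMk (.id _))) (.id _)
      {zeroInf ρ} := by
    refine GHomotopic.rel ?_ h0 isClopen_zeroInf
    refine (hμ.comp_right fun g x => Prod.ext (he g x) rfl).trans ?_
    rw [sumMap_zero_left]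
    exact (gHomotopicRel_actMap expands_oddEmb).toGHomotopic
  have h₂ : GHomotopicRel G (μ.comp ((ContinuousMap.id _).prodMk (.const _ (zeroInf ρ)))) (.id _)
      {zeroInf ρ} := by
    refine GHomotopic.rel ?_ h0 isClopen_zeroInf
    refine (hμ.comp_right fun g x => Prod.ext rfl (he g x)).trans ?_
    rw [sumMap_zero_right]
    exact (gHomotopicRel_actMap expands_evenEmb).toGHomotopic
  have h₃ : GHomotopicRel G (μ.comp (μ.prodMap (.id _)))
      ((μ.comp ((ContinuousMap.id _).prodMap μ)).comp (assocMap _))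
      {((zeroInf ρ, zeroInf ρ), zeroInf ρ)} := by
    refine GHomotopic.rel ?_ ((congrArg (fun y => μ (y, zeroInf ρ)) h0).trans h0) isClopen_zeroInf
    have hid := GHomotopic.refl (G := G) (IsEquivariant.id (G := G) (X := GrInf ρ))
    refine ((hμ.prodMap hid).comp_left hμs).trans ?_
    refine (hμ.comp_right (sumMap_smul.prodMap IsEquivariant.id)).trans ?_
    refine sumMap_assoc.trans (GHomotopic.symm ?_)
    refine GHomotopic.comp_right ?_ (fun g x => rfl)
    exact ((hid.prodMap hμ).comp_left hμs).trans
      (hμ.comp_right (IsEquivariant.id.prodMap sumMap_smul))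
  have h₄ : GHomotopicRel G μ (μ.comp ContinuousMap.prodSwap) {(zeroInf ρ, zeroInf ρ)} := by
    refine GHomotopic.rel ?_ h0 isClopen_zeroInf
    exact (hμ.trans sumMap_comm).trans (hμ.symm.comp_right fun g x => rfl)
  exact ⟨{
    hmul := μ
    e := zeroInf ρ
    hmul_e_e := h0
    eHmul := h₁.choose
    hmulE := h₂.choose
    smul_e := smul_zeroInf
    hmul_smul := hμs
    eHmul_smul := h₁.choose_spec
    hmulE_smul := h₂.choose_spec
    assoc := h₃
    comm := h₄ }, rfl, rfl⟩

end GrassmannianHSpace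

end TelGC

end

noncomputable section

open unitInterval

namespace TelGC

/-! ## The H-space structure on the telescope -/

section TelescopeHSpace

variable {G : Type w} [Group G] {V : Type u} [NormedAddCommGroup V] [InnerProductSpace ℂ V]
  {ρ : G →* (V ≃ₗᵢ[ℂ] V)}

/-- The base point of the telescope. -/
def zeroTel (ρ : G →* (V ≃ₗᵢ[ℂ] V)) : GrTel ρ := toTel ρ 0 (zeroInf ρ)

theorem opTel_zeroTel : opTel (zeroTel ρ) = negProj V := by
  rw [zeroTel, opTel_toTel, opInf_zeroInf, Nat.cast_zero, neg_zero, shift_zero]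

theorem timeTel_zeroTel : timeTel (zeroTel ρ) = 0 := by
  rw [zeroTel, timeTel_toTel, Nat.cast_zero]

theorem smul_zeroTel (g : G) : g • zeroTel ρ = zeroTel ρ := congrArg (toTel ρ 0) (smul_zeroInf g)

theorem toTel_smul (n : ℕ) : IsEquivariant G (toTel ρ n) := fun _ _ => rfl

theorem exists_isPt_opTel₂ (y z : GrTel ρ) : ∃ a b : ℕ, (a : ℝ) ≤ max (timeTel y) (timeTel z) ∧
    IsPt a b (opTel y) ∧ IsPt a b (opTel z) := by
  obtain ⟨a, b, ha, h⟩ := exists_isPt_opTel y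
  obtain ⟨a', b', ha', h'⟩ := exists_isPt_opTel z
  refine ⟨max a a', max b b', ?_, h.mono (le_max_left _ _) (le_max_left _ _),
    h'.mono (le_max_right _ _) (le_max_right _ _)⟩
  push_cast
  exact max_le_max ha ha'

variable [FiniteDimensional ℂ V]

/-- The action of an isometry on the telescope. -/
def CIsom.telAct (A : CIsom ρ) (z : GrTel ρ) : GrTel ρ :=
  ofTel ρ (conj A.J A.J' (opTel z)) (4 * timeTel z) (by
    obtain ⟨a, b, ha, h⟩ := exists_isPt_opTel z
    -- Multiplying the time by the common expansion bound `4` compensates the growth of the window.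
    refine ⟨4 * a, 4 * b, ?_, h.conj (c := 4) A.isIsom⟩
    push_cast
    linarith)

theorem opTel_telAct (A : CIsom ρ) (z : GrTel ρ) :
    opTel (A.telAct z) = conj A.J A.J' (opTel z) := opTel_ofTel _

theorem timeTel_telAct (A : CIsom ρ) (z : GrTel ρ) : timeTel (A.telAct z) = 4 * timeTel z :=
  timeTel_ofTel _

theorem telAct_smul (A : CIsom ρ) (g : G) (z : GrTel ρ) : A.telAct (g • z) = g • A.telAct z :=
  opTel_timeTel_injective
    (by rw [opTel_telAct, opTel_smul, opTel_smul, opTel_telAct, actOp_conj A.inv A.inv'])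
    (by rw [timeTel_telAct, timeTel_smul, timeTel_smul, timeTel_telAct])

theorem telAct_eq_self (A : CIsom ρ) {z : GrTel ρ} (h : conj A.J A.J' (opTel z) = opTel z)
    (hz : timeTel z = 0) : A.telAct z = z :=
  opTel_timeTel_injective (by rw [opTel_telAct, h]) (by rw [timeTel_telAct, hz, mul_zero])

theorem telAct_zeroTel (A : CIsom ρ) : A.telAct (zeroTel ρ) = zeroTel ρ :=
  telAct_eq_self A (by rw [opTel_zeroTel, conj_negProj]) timeTel_zeroTel

/-- The interleaved sum of two points of the telescope. -/
def telMul (y z : GrTel ρ) : GrTel ρ :=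
  ofTel ρ (isum (opTel y) (opTel z)) (2 * max (timeTel y) (timeTel z)) (by
    -- The maximum of the times bounds a common window, and interleaving doubles it; hence the time
    -- `2 * max`.
    obtain ⟨a, b, ha, h, h'⟩ := exists_isPt_opTel₂ y z
    refine ⟨2 * a, 2 * b, ?_, h.isum h'⟩
    push_cast
    linarith)

theorem opTel_telMul (y z : GrTel ρ) : opTel (telMul y z) = isum (opTel y) (opTel z) :=
  opTel_ofTel _

theorem timeTel_telMul (y z : GrTel ρ) :
    timeTel (telMul y z) = 2 * max (timeTel y) (timeTel z) := timeTel_ofTel _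

theorem telMul_smul (g : G) (y z : GrTel ρ) : telMul (g • y) (g • z) = g • telMul y z :=
  opTel_timeTel_injective
    (by rw [opTel_telMul, opTel_smul, opTel_smul, opTel_smul, opTel_telMul, actOp_isum])
    (by rw [timeTel_telMul, timeTel_smul, timeTel_smul, timeTel_smul, timeTel_telMul])

theorem telMul_zeroTel_zeroTel : telMul (zeroTel ρ) (zeroTel ρ) = zeroTel ρ :=
  opTel_timeTel_injective
    (by rw [opTel_telMul, opTel_zeroTel, isum_negProj_left, emb_negProj])
    (by rw [timeTel_telMul, timeTel_zeroTel, max_self, mul_zero])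

theorem telMul_toTel (n : ℕ) (x y : GrInf ρ) :
    telMul (toTel ρ n x) (toTel ρ n y) = toTel ρ (2 * n) (sumMap ρ (x, y)) :=
  opTel_timeTel_injective
    (by
      rw [opTel_telMul, opTel_toTel, opTel_toTel, opTel_toTel, opInf_sumMap, isum_shift]
      push_cast
      ring_nf)
    (by
      rw [timeTel_telMul, timeTel_toTel, timeTel_toTel, timeTel_toTel, max_self]
      push_cast
      ring)

theorem continuous_telAct_path {Z : Type*} [TopologicalSpace Z] [CompactSpace Z] [T2Space Z]
    {γ : Z → CIsom ρ} (h : FinCont fun s => (γ s).J) (h' : FinCont fun s => (γ s).J') :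
    Continuous fun q : Z × GrTel ρ => (γ q.1).telAct q.2 := by
  refine (IsCompactFamily.id.prod (isCompactFamily_tel ρ)).continuous_iff.2 fun i => ?_
  refine continuous_of_opTel (a := 4 * i.2.1) (b := 4 * i.2.2) ?_ ?_ (fun q => ?_) fun q => ?_
  · simp only [Function.comp_apply, opTel_telAct]
    exact FinCont.conj (h.comp continuous_fst) (h'.comp continuous_fst)
      ((finCont_opTel_cyl i.2).comp continuous_snd)
  · simp only [Function.comp_apply, timeTel_telAct]
    exact continuous_const.mul
      ((continuous_timeTel.comp ((isCompactFamily_tel ρ).cont i.2)).comp continuous_snd)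
  · simp only [Function.comp_apply, opTel_telAct]
    exact (isPt_opTel_cyl i.2 q.2).conj (c := 4) (γ q.1).isIsom
  · simp only [Function.comp_apply, timeTel_telAct]
    have := le_timeTel_cyl i.2 q.2
    push_cast
    linarith

theorem continuous_telAct (A : CIsom ρ) : Continuous A.telAct := by
  refine (isCompactFamily_tel ρ).continuous_iff.2 fun i => ?_
  refine continuous_of_opTel (a := 4 * i.1) (b := 4 * i.2) ?_ ?_ (fun q => ?_) fun q => ?_
  · simp only [Function.comp_apply, opTel_telAct]
    exact FinCont.conj A.finCont A.finCont' (finCont_opTel_cyl i)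
  · simp only [Function.comp_apply, timeTel_telAct]
    exact continuous_const.mul (continuous_timeTel.comp ((isCompactFamily_tel ρ).cont i))
  · simp only [Function.comp_apply, opTel_telAct]
    exact (isPt_opTel_cyl i q).conj (c := 4) A.isIsom
  · simp only [Function.comp_apply, timeTel_telAct]
    have := le_timeTel_cyl i q
    push_cast
    linarith

theorem opTel_telAct_ofEmb {φ : ℤ ↪ ℤ} (h : Expands 4 φ) (z : GrTel ρ) :
    opTel ((CIsom.ofEmb ρ φ h).telAct z) = emb φ (opTel z) := opTel_telAct _ z

/-- The action of an isometry on the telescope as an equivariant map. -/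
def CIsom.telMap (A : CIsom ρ) : {f : C(GrTel ρ, GrTel ρ) // IsEquivariant G f} :=
  ⟨⟨A.telAct, continuous_telAct A⟩, telAct_smul A⟩

theorem continuous_telMul : Continuous fun q : GrTel ρ × GrTel ρ => telMul q.1 q.2 := by
  refine ((isCompactFamily_tel ρ).prod (isCompactFamily_tel ρ)).continuous_iff.2 fun i => ?_
  refine continuous_of_opTel (a := 2 * max i.1.1 i.2.1) (b := 2 * max i.1.2 i.2.2) ?_ ?_
    (fun q => ?_) fun q => ?_
  · simp only [Function.comp_apply, opTel_telMul]
    exact ((finCont_opTel_cyl i.1).comp continuous_fst).isum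
      ((finCont_opTel_cyl i.2).comp continuous_snd)
  · simp only [Function.comp_apply, timeTel_telMul]
    have h₁ := continuous_timeTel.comp ((isCompactFamily_tel ρ).cont i.1)
    have h₂ := continuous_timeTel.comp ((isCompactFamily_tel ρ).cont i.2)
    exact continuous_const.mul ((h₁.comp continuous_fst).max (h₂.comp continuous_snd))
  · simp only [Function.comp_apply, opTel_telMul]
    exact ((isPt_opTel_cyl i.1 q.1).mono (le_max_left _ _) (le_max_left _ _)).isum
      ((isPt_opTel_cyl i.2 q.2).mono (le_max_right _ _) (le_max_right _ _))
  · simp only [Function.comp_apply, timeTel_telMul]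
    have := max_le_max (le_timeTel_cyl i.1 q.1) (le_timeTel_cyl i.2 q.2)
    push_cast
    linarith

/-- Equivariant maps to the telescope that differ in the position only are homotopic. -/
theorem gHomotopicRel_of_opTel {Z : Type*} [TopologicalSpace Z] [MulAction G Z] {S : Set Z}
    {f f' : C(Z, GrTel ρ)} (hf : IsEquivariant G f) (hf' : IsEquivariant G f')
    (h : ∀ z, opTel (f z) = opTel (f' z)) (hS : ∀ z ∈ S, timeTel (f z) = 0)
    (hS' : ∀ z ∈ S, timeTel (f' z) = 0) : GHomotopicRel G f f' S := by
  have key : ∀ {k k' : C(Z, GrTel ρ)}, IsEquivariant G k → IsEquivariant G k' →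
      (∀ z ∈ S, timeTel (k' z) = 0) → ∀ k'' : C(Z, GrTel ρ),
      (∀ z, k'' z = flow (k z) (timeTel (k' z))) → GHomotopicRel G k k'' S := by
    intro k k' hk hk' hS k'' hk''
    refine GHomotopicRel.of_map (fun (t : I) z => flow (k z) (t * timeTel (k' z))) ?_ ?_ ?_ ?_ ?_
    · refine continuous_flow.comp (Continuous.prodMk (by fun_prop) ?_)
      have := continuous_timeTel.comp k'.continuous
      exact (continuous_subtype_val.comp continuous_fst).mul (this.comp continuous_snd)
    · intro z
      simp only [Set.Icc.coe_zero, zero_mul, flow_zero]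
    · intro z
      simp only [Set.Icc.coe_one, one_mul, hk'']
    · intro t z hz
      simp only [hS z hz, mul_zero, flow_zero]
    · intro g t z
      simp only [hk g z, hk' g z, timeTel_smul, flow_smul]
  -- Each map is pushed forward by the time of the other. Both end at the same operator and the sum
  -- of the times, and nothing moves on `S`, where both times vanish.
  let k : C(Z, GrTel ρ) := ⟨fun z => flow (f z) (timeTel (f' z)),
    continuous_flow.comp (f.continuous.prodMk (continuous_timeTel.comp f'.continuous))⟩
  refine (key hf hf' hS' k fun _ => rfl).trans (key hf' hf hS k fun z => ?_).symm
  refine opTel_timeTel_injective ?_ ?_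
  · simp only [k, ContinuousMap.coe_mk, opTel_flow, h]
  · simp only [k, ContinuousMap.coe_mk, timeTel_flow, max_eq_left (timeTel_nonneg _), add_comm]

theorem gHomotopic_of_opTel {Z : Type*} [TopologicalSpace Z] [MulAction G Z]
    {f f' : C(Z, GrTel ρ)} (hf : IsEquivariant G f) (hf' : IsEquivariant G f')
    (h : ∀ z, opTel (f z) = opTel (f' z)) : GHomotopic G f f' :=
  gHomotopicRel_empty.1 (gHomotopicRel_of_opTel hf hf' h (fun _ h => absurd h (Set.notMem_empty _))
    fun _ h => absurd h (Set.notMem_empty _))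

/-- The action of an injection on the telescope is homotopic to the identity. -/
theorem gHomotopicRel_telMap {φ : ℤ ↪ ℤ} (hφ : Expands 2 φ) :
    GHomotopicRel G (CIsom.ofEmb ρ φ (hφ.mono (by norm_num))).telMap.1 (.id _) {zeroTel ρ} := by
  have h := CIsom.rel_one (ρ := ρ) GHomotopicRel.equivalence (c := CIsom.telMap) (fun A B hAB => by
    obtain ⟨γ, h, h', rfl, rfl⟩ := hAB
    exact GHomotopicRel.of_map (S := {zeroTel ρ}) (fun s => (γ s).telAct)
      (continuous_telAct_path h h') (fun _ => rfl) (fun _ => rfl)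
      (fun t x hx => by
        rw [Set.mem_singleton_iff.1 hx, telAct_zeroTel]
        exact (telAct_zeroTel (γ 0)).symm)
      fun g t x => telAct_smul _ g x) hφ
  -- The identity isometry does not act on the telescope as the identity, since it multiplies the
  -- time by `4`; the difference in time is removed by the flow.
  refine h.trans (gHomotopicRel_of_opTel (telAct_smul _) IsEquivariant.id (fun z => ?_) ?_ ?_)
  · exact (opTel_telAct _ z).trans (conj_one _)
  · intro z hz
    rw [Set.mem_singleton_iff.1 hz]
    exact (congrArg timeTel (telAct_zeroTel _)).trans timeTel_zeroTel
  · intro z hz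
    rw [Set.mem_singleton_iff.1 hz]
    exact timeTel_zeroTel

/-- Equivariant maps to the telescope that differ by an injection of coordinates are homotopic. -/
theorem gHomotopicRel_of_opTel_emb {Z : Type*} [TopologicalSpace Z] [MulAction G Z] {z₀ : Z}
    {f f' : C(Z, GrTel ρ)} (hf : IsEquivariant G f) (hf' : IsEquivariant G f')
    {φ : ℤ ↪ ℤ} (hφ : Expands 2 φ) (h : ∀ z, opTel (f z) = emb φ (opTel (f' z)))
    (hS : f z₀ = zeroTel ρ) (hS' : f' z₀ = zeroTel ρ) : GHomotopicRel G f f' {z₀} := by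
  have h₁ := (gHomotopicRel_telMap (ρ := ρ) hφ).comp_right hf' (S := {z₀}) (by
    rw [Set.mapsTo_singleton, hS']
    rfl)
  refine (gHomotopicRel_of_opTel hf (IsEquivariant.comp (Subtype.prop _) hf') (fun z => ?_) ?_
    ?_).trans h₁
  · exact (h z).trans (opTel_telAct_ofEmb _ _).symm
  · intro z hz
    rw [Set.mem_singleton_iff.1 hz, hS, timeTel_zeroTel]
  · intro z hz
    rw [Set.mem_singleton_iff.1 hz, ContinuousMap.comp_apply, hS']
    exact (congrArg timeTel (telAct_zeroTel _)).trans timeTel_zeroTel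

/-- The product of the telescope. -/
def telMulMap (ρ : G →* (V ≃ₗᵢ[ℂ] V)) : C(GrTel ρ × GrTel ρ, GrTel ρ) :=
  ⟨fun q => telMul q.1 q.2, continuous_telMul⟩

theorem telMulMap_smul : IsEquivariant G (telMulMap ρ) := fun g q => telMul_smul g q.1 q.2

theorem telMul_unit_left : GHomotopicRel G
    ((telMulMap ρ).comp ((ContinuousMap.const _ (zeroTel ρ)).prodMk (.id _))) (.id _)
    {zeroTel ρ} := by
  have he : IsEquivariant G ((ContinuousMap.const (GrTel ρ) (zeroTel ρ)).prodMk (.id _)) :=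
    fun g _ => Prod.ext (smul_zeroTel g).symm rfl
  refine gHomotopicRel_of_opTel_emb (telMulMap_smul.comp he) IsEquivariant.id expands_oddEmb
    (fun z => ?_) telMul_zeroTel_zeroTel rfl
  refine (opTel_telMul _ _).trans ?_
  change isum (opTel (zeroTel ρ)) (opTel z) = emb oddEmb (opTel z)
  rw [opTel_zeroTel, isum_negProj_left]

theorem telMul_unit_right : GHomotopicRel G
    ((telMulMap ρ).comp ((ContinuousMap.id _).prodMk (.const _ (zeroTel ρ)))) (.id _)
    {zeroTel ρ} := by
  have he : IsEquivariant G ((ContinuousMap.id _).prodMk (.const (GrTel ρ) (zeroTel ρ))) :=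
    fun g _ => Prod.ext rfl (smul_zeroTel g).symm
  refine gHomotopicRel_of_opTel_emb (telMulMap_smul.comp he) IsEquivariant.id expands_evenEmb
    (fun z => ?_) telMul_zeroTel_zeroTel rfl
  refine (opTel_telMul _ _).trans ?_
  change isum (opTel z) (opTel (zeroTel ρ)) = emb evenEmb (opTel z)
  rw [opTel_zeroTel, isum_negProj_right]

theorem telMul_assoc : GHomotopicRel G ((telMulMap ρ).comp ((telMulMap ρ).prodMap (.id _)))
    (((telMulMap ρ).comp ((ContinuousMap.id _).prodMap (telMulMap ρ))).comp (assocMap _))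
    {((zeroTel ρ, zeroTel ρ), zeroTel ρ)} := by
  refine (gHomotopicRel_of_opTel_emb ?_ ?_ expands_assocEmb (fun z => ?_) ?_ ?_).symm
  · exact (telMulMap_smul.comp (IsEquivariant.id.prodMap telMulMap_smul)).comp fun g z => rfl
  · exact telMulMap_smul.comp (telMulMap_smul.prodMap IsEquivariant.id)
  · change opTel (telMul z.1.1 (telMul z.1.2 z.2)) =
      emb assocEmb (opTel (telMul (telMul z.1.1 z.1.2) z.2))
    simp only [opTel_telMul, emb_assocEmb_isum]
  · exact (congrArg (telMul (zeroTel ρ)) telMul_zeroTel_zeroTel).trans telMul_zeroTel_zeroTel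
  · exact (congrArg (fun y => telMul y (zeroTel ρ)) telMul_zeroTel_zeroTel).trans
      telMul_zeroTel_zeroTel

theorem telMul_comm : GHomotopicRel G (telMulMap ρ) ((telMulMap ρ).comp ContinuousMap.prodSwap)
    {(zeroTel ρ, zeroTel ρ)} := by
  refine gHomotopicRel_of_opTel_emb telMulMap_smul ?_ expands_swapEmb (fun z => ?_)
    telMul_zeroTel_zeroTel telMul_zeroTel_zeroTel
  · exact telMulMap_smul.comp fun g z => rfl
  · change opTel (telMul z.1 z.2) = emb swapEmb (opTel (telMul z.2 z.1))
    rw [opTel_telMul, opTel_telMul, emb_swapEmb_isum]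

/-- The equivariant H-space structure of the telescope. -/
def telHSpace (ρ : G →* (V ≃ₗᵢ[ℂ] V)) : GHCommSpace G (GrTel ρ) where
  hmul := telMulMap ρ
  e := zeroTel ρ
  hmul_e_e := telMul_zeroTel_zeroTel
  eHmul := telMul_unit_left.choose
  hmulE := telMul_unit_right.choose
  smul_e := smul_zeroTel
  hmul_smul := telMulMap_smul
  eHmul_smul := telMul_unit_left.choose_spec
  hmulE_smul := telMul_unit_right.choose_spec
  assoc := telMul_assoc
  comm := telMul_comm

theorem telMulMap_comp_toTel (n : ℕ) : (telMulMap ρ).comp ((toTel ρ n).prodMap (toTel ρ n)) =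
    (toTel ρ (2 * n)).comp (sumMap ρ) := ContinuousMap.ext fun x => telMul_toTel n x.1 x.2

theorem IsGammaProduct.gHomotopic_toTel {μ : C(GrInf ρ × GrInf ρ, GrInf ρ)}
    (h : IsGammaProduct ρ μ) (n : ℕ) :
    GHomotopic G ((telMulMap ρ).comp ((toTel ρ n).prodMap (toTel ρ n)))
      ((toTel ρ (2 * n)).comp μ) := by
  rw [telMulMap_comp_toTel]
  exact h.gHomotopic.symm.comp_left (toTel_smul _)

end TelescopeHSpace

end TelGC

end

noncomputable section

open unitInterval

namespace TelGC

/-! ## Homology of increasing unions -/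

section ChainComplexes

open CategoryTheory

variable {R : Type v} [CommRing R]

theorem exists_iCycles (K : ChainComplex (ModuleCat.{w} R) ℕ) (n : ℕ) (x : K.X n)
    (hx : (K.sc n).g x = 0) : ∃ z : K.cycles n, K.iCycles n z = x :=
  ⟨(K.sc n).moduleCatCyclesIso.inv ⟨x, hx⟩,
    congr($((K.sc n).moduleCatCyclesIso_inv_iCycles) ⟨x, hx⟩)⟩

theorem homologyπ_surjective (K : ChainComplex (ModuleCat.{w} R) ℕ) (n : ℕ) :
    Function.Surjective (K.homologyπ n) := (ModuleCat.epi_iff_surjective _).1 inferInstance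

theorem iCycles_injective (K : ChainComplex (ModuleCat.{w} R) ℕ) (n : ℕ) :
    Function.Injective (K.iCycles n) := (ModuleCat.mono_iff_injective _).1 inferInstance

theorem exists_toCycles (K : ChainComplex (ModuleCat.{w} R) ℕ) (n : ℕ) (z : K.cycles n)
    (hz : K.homologyπ n z = 0) : ∃ y : K.X (n + 1), K.toCycles (n + 1) n y = z :=
  (ShortComplex.moduleCat_exact_iff _).1 (ShortComplex.exact_of_g_is_cokernel
    (.mk (K.toCycles (n + 1) n) (K.homologyπ n) (by simp))
    (K.homologyIsCokernel (n + 1) n (by simp))) z hz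

variable {K : ℕ → ChainComplex (ModuleCat.{w} R) ℕ} {L : ChainComplex (ModuleCat.{w} R) ℕ}
  {φ : ∀ m, K m ⟶ L} (hφ : ∀ m i, Function.Injective ((φ m).f i))
  (hL : ∀ i (x : L.X i), ∃ m y, (φ m).f i y = x)

include hφ hL

/-- A cycle comes from a chain of some `K m`, and that chain is a cycle because its boundary
vanishes after the injective map to `L`. -/
theorem exists_homologyMap_eq (n : ℕ) (c : L.homology n) :
    ∃ m b, HomologicalComplex.homologyMap (φ m) n b = c := by
  obtain ⟨z, rfl⟩ := homologyπ_surjective L n c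
  obtain ⟨m, y, hy⟩ := hL n (L.iCycles n z)
  have hd : ((K m).sc n).g y = 0 := by
    refine hφ m _ ?_
    have h1 : (φ m).f _ (((K m).sc n).g y) = (L.sc n).g ((φ m).f n y) :=
      congr($((φ m).comm n ((ComplexShape.down ℕ).next n)) y).symm
    have h2 : (L.sc n).g (L.iCycles n z) = 0 := congr($((L.sc n).iCycles_g) z)
    exact (h1.trans (congrArg (L.sc n).g hy)).trans (h2.trans (map_zero ((φ m).f _).hom).symm)
  obtain ⟨b, hb⟩ := exists_iCycles (K m) n y hd
  refine ⟨m, (K m).homologyπ n b, ?_⟩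
  have h2 : HomologicalComplex.cyclesMap (φ m) n b = z := by
    refine iCycles_injective L n ?_
    have := congr($(HomologicalComplex.cyclesMap_i (φ m) n) b)
    simp only [ConcreteCategory.comp_apply] at this
    rw [this, hb, hy]
  have := congr($(HomologicalComplex.homologyπ_naturality (φ m) n) b)
  simp only [ConcreteCategory.comp_apply] at this
  rw [this, h2]

/-- A chain that bounds the cycle comes from some stage `k`; by injectivity the boundary relation
already holds in stage `max m k`. -/
theorem exists_homologyMap_eq_zero {ψ : ∀ {m m'}, m ≤ m' → (K m ⟶ K m')}
    (hψ : ∀ {m m'} (h : m ≤ m'), ψ h ≫ φ m' = φ m) (n m : ℕ) (b : (K m).homology n)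
    (hb : HomologicalComplex.homologyMap (φ m) n b = 0) :
    ∃ m', ∃ h : m ≤ m', HomologicalComplex.homologyMap (ψ h) n b = 0 := by
  obtain ⟨z, rfl⟩ := homologyπ_surjective (K m) n b
  have h1 := congr($(HomologicalComplex.homologyπ_naturality (φ m) n) z)
  simp only [ConcreteCategory.comp_apply] at h1
  rw [h1] at hb
  obtain ⟨y, hy⟩ := exists_toCycles L n _ hb
  obtain ⟨k, x, hx⟩ := hL (n + 1) y
  refine ⟨max m k, le_max_left m k, ?_⟩
  have h2 := congr($(HomologicalComplex.homologyπ_naturality (ψ (le_max_left m k)) n) z)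
  simp only [ConcreteCategory.comp_apply] at h2
  have h3 : HomologicalComplex.cyclesMap (ψ (le_max_left m k)) n z =
      (K (max m k)).toCycles (n + 1) n ((ψ (le_max_right m k)).f (n + 1) x) := by
    refine iCycles_injective _ n (hφ _ n ?_)
    have e1 := congr($(HomologicalComplex.cyclesMap_i (ψ (le_max_left m k)) n) z)
    have e2 := congr($((K (max m k)).toCycles_i (n + 1) n) ((ψ (le_max_right m k)).f (n + 1) x))
    simp only [ConcreteCategory.comp_apply] at e1 e2
    have e3 := congr($((φ (max m k)).comm (n + 1) n) ((ψ (le_max_right m k)).f (n + 1) x))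
    simp only [ConcreteCategory.comp_apply] at e3
    have e4 : (φ (max m k)).f (n + 1) ((ψ (le_max_right m k)).f (n + 1) x) = y :=
      (congr(($(hψ (le_max_right m k))).f (n + 1) x)).trans hx
    have e5 : (φ (max m k)).f n ((ψ (le_max_left m k)).f n ((K m).iCycles n z)) =
        (φ m).f n ((K m).iCycles n z) :=
      congr(($(hψ (le_max_left m k))).f n ((K m).iCycles n z))
    have e6 := congr($(HomologicalComplex.cyclesMap_i (φ m) n) z)
    simp only [ConcreteCategory.comp_apply] at e6
    have e7 := congr($(L.toCycles_i (n + 1) n) y)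
    simp only [ConcreteCategory.comp_apply] at e7
    rw [e1, e2, ← e3, e4, e5, ← e6, ← hy, e7]
  rw [h2, h3]
  have := congr($((K (max m k)).toCycles_comp_homologyπ (n + 1) n)
    ((ψ (le_max_right m k)).f (n + 1) x))
  exact this

end ChainComplexes

/-! ### Singular homology of an increasing union of open subspaces -/

section IncreasingUnions

open CategoryTheory

variable {T : Type u} [TopologicalSpace T] {U : ℕ → Set T}

/-- The inclusion of a subspace. -/
def inclOf (S : Set T) : C(S, T) := ⟨Subtype.val, continuous_subtype_val⟩

/-- The inclusion of subspaces. -/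
def inclOfLE {S S' : Set T} (h : S ⊆ S') : C(S, S') := ⟨Set.inclusion h, continuous_inclusion h⟩

variable (R : Type v) [CommRing R] (hU : ∀ m, IsOpen (U m)) (hm : Monotone U)
  (hT : ∀ x, ∃ m, x ∈ U m)

/-- The singular chain complex. -/
abbrev singC (X : Type u) [TopologicalSpace X] : ChainComplex (ModuleCat.{max u v} R) ℕ :=
  SSet.chainComplex (TopCat.toSSet.obj (TopCat.of X)) (ModuleCat.of R (ULift.{u} R))

/-- The map of singular chain complexes. -/
abbrev singCMap {X Y : Type u} [TopologicalSpace X] [TopologicalSpace Y] (f : C(X, Y)) :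
    singC.{u, v} R X ⟶ singC.{u, v} R Y :=
  SSet.chainComplexMap (TopCat.toSSet.map (TopCat.ofHom f)) (ModuleCat.of R (ULift.{u} R))

theorem singCMap_injective {X Y : Type u} [TopologicalSpace X] [TopologicalSpace Y] (f : C(X, Y))
    (hf : Function.Injective f) (i : ℕ) : Function.Injective ((singCMap.{u, v} R f).f i) := by
  have : Mono (TopCat.ofHom f) := (TopCat.mono_iff_injective _).2 hf
  have h : Mono (((AlgebraicTopology.singularChainComplexFunctor (ModuleCat.{max u v} R)).obj
    (ModuleCat.of R (ULift.{u} R))).map (TopCat.ofHom f)) := inferInstance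
  have h' : Mono (singCMap.{u, v} R f) := h
  exact (ModuleCat.mono_iff_injective _).1 inferInstance

include hU hm hT

/-- A singular simplex has compact image, so it lies in a single `U m`; a chain lies in the directed
supremum of the images and hence in one of them. -/
theorem exists_singCMap_eq (i : ℕ) (x : (singC.{u, v} R T).X i) :
    ∃ m y, (singCMap.{u, v} R (inclOf (U m))).f i y = x := by
  let N : ℕ → Submodule R ((singC.{u, v} R T).X i) := fun m =>
    LinearMap.range ((singCMap.{u, v} R (inclOf (U m))).f i).hom
  have hN : Monotone N := by
    intro m m' h
    rintro _ ⟨y, rfl⟩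
    refine ⟨(singCMap.{u, v} R (inclOfLE (hm h))).f i y, ?_⟩
    have e : singCMap.{u, v} R (inclOfLE (hm h)) ≫ singCMap.{u, v} R (inclOf (U m')) =
      singCMap.{u, v} R (inclOf (U m)) := by
      rw [← Functor.map_comp, ← Functor.map_comp]
      rfl
    exact congr(($e).f i y)
  have htop : (⨆ m, N m) = ⊤ := by
    -- Maps out of the chain module are determined on simplices, so the quotient by all the images
    -- is shown to vanish simplex by simplex.
    have h0 : ModuleCat.ofHom (⨆ m, N m).mkQ = 0 := by
      refine SSet.chainComplex_hom_ext fun s => ?_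
      let s₀ : C(ULift.{u} (stdSimplex ℝ (Fin (i + 1))), T) := TopCat.Hom.hom s.down
      obtain ⟨m, hs⟩ : ∃ m, ∀ t, s₀ t ∈ U m := by
        obtain ⟨m, hs⟩ := isCompact_univ.elim_directed_cover (fun m => s₀ ⁻¹' U m)
          (fun m => (hU m).preimage s₀.continuous)
          (fun t _ => Set.mem_iUnion.2 (hT (s₀ t))) (Monotone.directed_le fun _ _ h =>
            Set.preimage_mono (hm h))
        exact ⟨m, fun t => hs (Set.mem_univ t)⟩
      let s' : (TopCat.toSSet.obj (TopCat.of (U m))).obj (Opposite.op (SimplexCategory.mk i)) :=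
        ⟨TopCat.ofHom ⟨fun t => ⟨s₀ t, hs t⟩, by fun_prop⟩⟩
      have e := SSet.ι_chainComplexMap_f _ _ (f := TopCat.toSSet.map (TopCat.ofHom (inclOf (U m))))
        (R := ModuleCat.of R (ULift.{u} R)) s'
      have e' : (TopCat.toSSet.map (TopCat.ofHom (inclOf (U m)))).app _ s' = s := rfl
      rw [e'] at e
      rw [← e, Limits.comp_zero]
      ext r
      exact (Submodule.Quotient.mk_eq_zero _).2 (Submodule.mem_iSup_of_mem m ⟨_, rfl⟩)
    rw [← Submodule.ker_mkQ (⨆ m, N m)]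
    exact LinearMap.ker_eq_top.2 (congrArg ModuleCat.Hom.hom h0)
  have hx : x ∈ ⨆ m, N m := htop ▸ Submodule.mem_top
  obtain ⟨m, y, hy⟩ := (Submodule.mem_iSup_of_directed N hN.directed_le).1 hx
  exact ⟨m, y, hy⟩

theorem exists_singHMap_eq (n : ℕ) (c : singH.{u, v} R n T) :
    ∃ m b, singHMap R n (inclOf (U m)) b = c :=
  exists_homologyMap_eq (fun m => singCMap_injective R (inclOf (U m)) Subtype.val_injective)
    (exists_singCMap_eq R hU hm hT) n c

theorem exists_singHMap_eq_zero (n m : ℕ) (b : singH.{u, v} R n (U m))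
    (hb : singHMap R n (inclOf (U m)) b = 0) :
    ∃ m', ∃ h : m ≤ m', singHMap R n (inclOfLE (hm h)) b = 0 :=
  exists_homologyMap_eq_zero
    (fun m => singCMap_injective R (inclOf (U m)) Subtype.val_injective)
    (exists_singCMap_eq R hU hm hT) (ψ := fun h => singCMap R (inclOfLE (hm h)))
    (fun h => by rw [← Functor.map_comp, ← Functor.map_comp]; rfl) n m b hb

end IncreasingUnions

end TelGC

end

noncomputable section

open unitInterval

namespace TelGC

/-! ## Localization at a single path component -/

section MonoidRings

variable {M N : Type*} [CommMonoid M] [CommMonoid N] {g : M →* N} {a : M}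

/-- The support is finite, so one power of `a` identifies all pairs of support elements with equal
images. On the support, multiplication by this power then factors through `g`. -/
theorem exists_mapDomain_mul_eq_zero (hg : ∀ x y, g x = g y → ∃ k, a ^ k * x = a ^ k * y)
    (c : M →₀ ℤ) (h : Finsupp.mapDomain g c = 0) :
    ∃ k, Finsupp.mapDomain (a ^ k * ·) c = 0 := by
  classical
  have hg' : ∀ p : M × M, ∃ k, g p.1 = g p.2 → a ^ k * p.1 = a ^ k * p.2 := fun p => by
    by_cases hp : g p.1 = g p.2
    · obtain ⟨k, hk⟩ := hg _ _ hp
      exact ⟨k, fun _ => hk⟩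
    · exact ⟨0, fun h => absurd h hp⟩
  choose k hk using hg'
  let m := (c.support ×ˢ c.support).sup k
  have hm : ∀ x ∈ c.support, ∀ y ∈ c.support, g x = g y → a ^ m * x = a ^ m * y := by
    intro x hx y hy hxy
    have h1 : k (x, y) ≤ m := Finset.le_sup (f := k) (Finset.mk_mem_product hx hy)
    rw [← Nat.sub_add_cancel h1, pow_add, mul_assoc, mul_assoc, hk (x, y) hxy]
  -- The factorization of multiplication by `a ^ m` through `g`; the value `1` away from the image
  -- of the support plays no role.
  let q : N → M := fun n => if hn : ∃ x ∈ c.support, g x = n then a ^ m * hn.choose else 1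
  have hq : ∀ x ∈ c.support, a ^ m * x = (q ∘ g) x := by
    intro x hx
    have hn : ∃ y ∈ c.support, g y = g x := ⟨x, hx, rfl⟩
    have e : (q ∘ g) x = a ^ m * hn.choose := dif_pos hn
    rw [e]
    exact hm _ hx _ hn.choose_spec.1 hn.choose_spec.2.symm
  refine ⟨m, ?_⟩
  rw [Finsupp.mapDomain_congr hq, Finsupp.mapDomain_comp, h, Finsupp.mapDomain_zero]

theorem single_mul_eq_mapDomain (b : M) (r : MonoidAlgebra ℤ M) :
    MonoidAlgebra.single b 1 * r = MonoidAlgebra.mapDomain (b * ·) r := by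
  induction r using MonoidAlgebra.induction_linear with
  | zero => rw [mul_zero, MonoidAlgebra.mapDomain_zero]
  | add r s hr hs => rw [mul_add, hr, hs, MonoidAlgebra.mapDomain_add]
  | single m k => rw [MonoidAlgebra.single_mul_single, one_mul, MonoidAlgebra.mapDomain_single]

/-- The hypotheses express that `N` is `M` with `a` inverted; elements of the monoid ring are finite
sums, so common denominators exist. -/
theorem isLocalization_monoidAlgebra (ha : IsUnit (g a))
    (hs : ∀ n, ∃ k x, g a ^ k * n = g x) (hg : ∀ x y, g x = g y → ∃ k, a ^ k * x = a ^ k * y) :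
    letI := (MonoidAlgebra.mapDomainRingHom ℤ g).toAlgebra
    IsLocalization (Submonoid.powers (MonoidAlgebra.single a 1 : MonoidAlgebra ℤ M))
      (MonoidAlgebra ℤ N) := by
  let _ := (MonoidAlgebra.mapDomainRingHom ℤ g).toAlgebra
  have hmap : ∀ r : MonoidAlgebra ℤ M, algebraMap (MonoidAlgebra ℤ M) (MonoidAlgebra ℤ N) r =
    MonoidAlgebra.mapDomain g r := fun r => rfl
  have hpow : ∀ k, (MonoidAlgebra.single a 1 : MonoidAlgebra ℤ M) ^ k =
      MonoidAlgebra.single (a ^ k) 1 := fun k => by rw [MonoidAlgebra.single_pow, one_pow]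
  refine (isLocalization_iff _ _).2 ⟨?_, ?_, ?_⟩
  · rintro ⟨_, k, rfl⟩
    simp only [map_pow]
    refine IsUnit.pow k ?_
    rw [hmap, MonoidAlgebra.mapDomain_single]
    exact ha.map (MonoidAlgebra.of ℤ N)
  · intro z
    suffices h : ∃ k r, MonoidAlgebra.single (g a ^ k) 1 * z = MonoidAlgebra.mapDomain g r by
      obtain ⟨k, r, h⟩ := h
      refine ⟨(r, ⟨_, k, rfl⟩), ?_⟩
      simp only [hpow, hmap, MonoidAlgebra.mapDomain_single, map_pow]
      rw [mul_comm, h]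
    induction z using MonoidAlgebra.induction_linear with
    | zero => exact ⟨0, 0, by rw [mul_zero, MonoidAlgebra.mapDomain_zero]⟩
    | add y z hy hz =>
      obtain ⟨k, r, h⟩ := hy
      obtain ⟨l, s, h'⟩ := hz
      refine ⟨k + l, MonoidAlgebra.single (a ^ l) 1 * r + MonoidAlgebra.single (a ^ k) 1 * s, ?_⟩
      rw [← hmap, map_add, map_mul, map_mul]
      simp only [hmap]
      rw [← h, ← h', MonoidAlgebra.mapDomain_single, MonoidAlgebra.mapDomain_single, ← mul_assoc,
        ← mul_assoc, MonoidAlgebra.single_mul_single, MonoidAlgebra.single_mul_single, one_mul,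
        map_pow, map_pow, ← pow_add, ← pow_add, add_comm l k, mul_add]
    | single n c =>
      obtain ⟨k, x, h⟩ := hs n
      exact ⟨k, MonoidAlgebra.single x c, by
        rw [MonoidAlgebra.single_mul_single, one_mul, h, MonoidAlgebra.mapDomain_single]⟩
  · intro x y hxy
    have h0 : MonoidAlgebra.mapDomain g (x - y) = 0 := by
      rw [← hmap, map_sub, hxy, sub_self]
    obtain ⟨k, hk⟩ := exists_mapDomain_mul_eq_zero hg (x - y).coeff
      (congrArg MonoidAlgebra.coeff h0)
    refine ⟨⟨_, k, rfl⟩, ?_⟩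
    have h1 : MonoidAlgebra.single (a ^ k) 1 * (x - y) = 0 := by
      rw [single_mul_eq_mapDomain, MonoidAlgebra.mapDomain, hk]
      rfl
    simp only [hpow]
    exact sub_eq_zero.1 (by rw [← mul_sub, h1])

end MonoidRings

/-! ### A criterion for group completions by inverting one path component -/

section Criterion

variable {X Y : Type u} [TopologicalSpace X] [TopologicalSpace Y] {A : HCommSpace X}
  {B : HCommSpace Y} {f : C(X, Y)}

/-- The additive map induced on homology, regarded as a module over the path components. -/
def mapH (A : HCommSpace X) (B : HCommSpace Y) (R : Type v) [CommRing R] (n : ℕ) (f : C(X, Y)) :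
    A.Hlgy R n →+ B.Hlgy R n := (singHMap R n f).toAddMonoidHom

theorem mapH_congr {f g : C(X, Y)} (R : Type v) [CommRing R] (n : ℕ) (h : f.Homotopic g) :
    mapH A B R n f = mapH A B R n g := by
  rw [mapH, mapH, singHMap_congr R n h]

theorem mapH_id (R : Type v) [CommRing R] (n : ℕ) (c : A.Hlgy R n) :
    mapH A A R n (.id X) c = c := LinearMap.congr_fun (singHMap_id R n) c

theorem mapH_comp {Z : Type u} [TopologicalSpace Z] {C : HCommSpace Z} (R : Type v) [CommRing R]
    (n : ℕ) (g : C(Y, Z)) (f : C(X, Y)) (c : A.Hlgy R n) :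
    mapH A C R n (g.comp f) c = mapH B C R n g (mapH A B R n f c) :=
  LinearMap.congr_fun (singHMap_comp R n g f) c

theorem single_smul_hlgy (A : HCommSpace X) (R : Type v) [CommRing R] (n : ℕ) (a : X)
    (c : A.Hlgy R n) : (MonoidAlgebra.single (A.toPi0 a) 1 : MonoidAlgebra ℤ A.Pi0) • c =
      mapH A A R n (A.leftMul a) c := by
  rw [HCommSpace.smul_toPi0, one_smul]
  rfl

theorem monoidRingMap_single (hf : IsHMap A B f) (a : X) :
    hf.monoidRingMap (MonoidAlgebra.single (A.toPi0 a) 1) =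
      MonoidAlgebra.single (B.toPi0 (f a)) 1 := by
  simp only [IsHMap.monoidRingMap, MonoidAlgebra.mapDomainRingHom_apply,
    MonoidAlgebra.mapDomain_single]
  rfl

/-- An H-space map which inverts a path component on path components and on homology is a group
completion if the path components of the target form a group. -/
theorem isHomotopyGroupCompletion_of (hf : IsHMap A B f) (hB : ∀ b : B.Pi0, IsUnit b) (a : X)
    (hs : ∀ n, ∃ k x, hf.pi0 (A.toPi0 a) ^ k * n = hf.pi0 x)
    (hg : ∀ x y, hf.pi0 x = hf.pi0 y → ∃ k, A.toPi0 a ^ k * x = A.toPi0 a ^ k * y)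
    (hs' : ∀ (R : Type v) [CommRing R] (n : ℕ) (c : B.Hlgy R n), ∃ (k : ℕ) (b : A.Hlgy R n),
      (MonoidAlgebra.single (B.toPi0 (f a)) 1 : MonoidAlgebra ℤ B.Pi0) ^ k • c = hf.hlgyMap R n b)
    (hg' : ∀ (R : Type v) [CommRing R] (n : ℕ) (b : A.Hlgy R n), hf.hlgyMap R n b = 0 →
      ∃ k : ℕ, (MonoidAlgebra.single (A.toPi0 a) 1 : MonoidAlgebra ℤ A.Pi0) ^ k • b = 0) :
    IsHomotopyGroupCompletion.{u, v} A B f where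
  isHMap := hf
  isUnit_pi0 := hB
  pi0 := by
    refine ⟨fun _ => hB _, fun z => ?_, fun {x y} h => ?_⟩
    · obtain ⟨k, x, h⟩ := hs z
      refine ⟨(x, ⟨A.toPi0 a ^ k, Submonoid.mem_top _⟩), ?_⟩
      rw [mul_comm]
      exact (congrArg (· * z) (map_pow hf.pi0 _ _)).trans h
    · obtain ⟨k, h⟩ := hg x y h
      exact ⟨⟨A.toPi0 a ^ k, Submonoid.mem_top _⟩, h⟩
  homology R _ n := by
    have hloc := isLocalization_monoidAlgebra (hB _) hs hg
    let _ : Algebra (MonoidAlgebra ℤ A.Pi0) (MonoidAlgebra ℤ B.Pi0) := hf.monoidRingMap.toAlgebra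
    let _ : Module (MonoidAlgebra ℤ A.Pi0) (B.Hlgy R n) :=
      Module.compHom (B.Hlgy R n) hf.monoidRingMap
    have : IsScalarTower (MonoidAlgebra ℤ A.Pi0) (MonoidAlgebra ℤ B.Pi0) (B.Hlgy R n) :=
      ⟨fun r s c => mul_smul (hf.monoidRingMap r) s c⟩
    have hloc' : IsLocalization
        (Submonoid.powers (MonoidAlgebra.single (A.toPi0 a) 1 : MonoidAlgebra ℤ A.Pi0))
        (MonoidAlgebra ℤ B.Pi0) := hloc
    -- Base change to a localized ring is the same as localization of the module, which can be
    -- verified on elements.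
    refine (isLocalizedModule_iff_isBaseChange
      (Submonoid.powers (MonoidAlgebra.single (A.toPi0 a) 1 : MonoidAlgebra ℤ A.Pi0)) _ _).1
      ⟨fun r => ?_, fun y => ?_, fun {x y} h => ?_⟩
    · have h1 := IsLocalization.map_units (MonoidAlgebra ℤ B.Pi0) r
      have h2 := h1.map (algebraMap (MonoidAlgebra ℤ B.Pi0)
        (Module.End (MonoidAlgebra ℤ B.Pi0) (B.Hlgy R n)))
      rw [Module.End.isUnit_iff] at h2 ⊢
      exact h2
    · obtain ⟨k, b, h⟩ := hs' R n y
      refine ⟨(b, ⟨_, k, rfl⟩), ?_⟩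
      refine Eq.trans ?_ h
      change hf.monoidRingMap (MonoidAlgebra.single (A.toPi0 a) 1 ^ k) • y = _
      rw [map_pow, monoidRingMap_single]
    · obtain ⟨k, h⟩ := hg' R n (x - y) (by
        rw [map_sub]
        exact sub_eq_zero.2 h)
      refine ⟨⟨_, k, rfl⟩, sub_eq_zero.1 ?_⟩
      rw [← smul_sub]
      exact h

/-- The iterates of a continuous map. -/
def iter (η : C(X, X)) : ℕ → C(X, X)
  | 0 => .id X
  | m + 1 => η.comp (iter η m)

theorem mapH_iter {η : C(X, X)} {a : X} (hη : (A.leftMul a).Homotopic η) (R : Type v)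
    [CommRing R] (n m : ℕ) (b : A.Hlgy R n) :
    mapH A A R n (iter η m) b =
      (MonoidAlgebra.single (A.toPi0 a) 1 : MonoidAlgebra ℤ A.Pi0) ^ m • b := by
  induction m with
  | zero =>
    rw [pow_zero, one_smul, iter, mapH_id]
  | succ m ih =>
    rw [pow_succ', mul_smul, ← ih, single_smul_hlgy, mapH_congr R n hη, iter, mapH_comp (B := A)]

theorem toPi0_iter {η : C(X, X)} {a : X} (hη : (A.leftMul a).Homotopic η) (m : ℕ) (x : X) :
    A.toPi0 (iter η m x) = A.toPi0 a ^ m * A.toPi0 x := by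
  induction m with
  | zero => rw [pow_zero, one_mul, iter, ContinuousMap.id_apply]
  | succ m ih =>
    rw [pow_succ', mul_assoc, ← ih, ← HCommSpace.toPi0_mul, iter]
    exact Quotient.sound (HCommSpace.joined_of_homotopic hη (iter η m x)).symm

/-- A homotopy telescope of the iterates of the translation by a point is a group completion if its
path components form a group. -/
theorem isHomotopyGroupCompletion_of_telescope (hf : IsHMap A B f) (hB : ∀ b : B.Pi0, IsUnit b)
    {a : X} {η : C(X, X)} (hη : (A.leftMul a).Homotopic η) {U : ℕ → Set Y}
    (hU : ∀ m, IsOpen (U m)) (hm : Monotone U) (hT : ∀ y, ∃ m, y ∈ U m) (r : ∀ m, C(U m, X))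
    (j : ℕ → C(X, Y)) (hj₀ : j 0 = f) (hj : ∀ m, (j m).Homotopic ((B.leftMul (f a)).comp (j (m + 1))))
    (hr : ∀ m, ((j m).comp (r m)).Homotopic (inclOf (U m))) (hfU : ∀ m x, f x ∈ U (m + 1))
    (hrf : ∀ m x, r (m + 1) ⟨f x, hfU m x⟩ = iter η (m + 1) x) :
    IsHomotopyGroupCompletion.{u, v} A B f := by
  let f' : ∀ m, C(X, U (m + 1)) := fun m => ⟨fun x => ⟨f x, hfU m x⟩, by fun_prop⟩
  have hrf' : ∀ m, (r (m + 1)).comp (f' m) = iter η (m + 1) := fun m =>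
    ContinuousMap.ext (hrf m)
  refine isHomotopyGroupCompletion_of hf hB a (fun n => ?_) (fun x y h => ?_) (fun R _ n c => ?_)
    fun R _ n b hb => ?_
  · obtain ⟨y⟩ := n
    -- The map `j m` is `f` divided by the `m`-th power of `a`, by iterating `hj`. Since every point
    -- of `Y` is joined to a value of some `j m`, every component is a fraction.
    have key : ∀ m x, B.toPi0 (f a) ^ m * B.toPi0 (j m x) = B.toPi0 (f x) := by
      intro m x
      induction m with
      | zero => rw [pow_zero, one_mul, hj₀]
      | succ m ih =>
        rw [← ih, pow_succ, mul_assoc, ← HCommSpace.toPi0_mul]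
        exact congrArg _ (Quotient.sound (HCommSpace.joined_of_homotopic (hj m) x).symm)
    obtain ⟨m, hy⟩ := hT y
    refine ⟨m, A.toPi0 (r m ⟨y, hy⟩), ?_⟩
    refine Eq.trans ?_ (key m (r m ⟨y, hy⟩))
    exact congrArg (B.toPi0 (f a) ^ m * ·)
      (Quotient.sound (HCommSpace.joined_of_homotopic (hr m) ⟨y, hy⟩).symm)
  · obtain ⟨x⟩ := x
    obtain ⟨y⟩ := y
    obtain ⟨γ⟩ : Joined (f x) (f y) := Quotient.exact h
    -- The path is compact and lies in one `U m`; applying `r` there brings it back to `X`, where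
    -- its ends have become `η`-iterates of `x` and `y`.
    obtain ⟨m, hs⟩ := isCompact_univ.elim_directed_cover (fun m => γ ⁻¹' U m)
      (fun m => (hU m).preimage γ.continuous) (fun t _ => Set.mem_iUnion.2 (hT (γ t)))
      (Monotone.directed_le fun _ _ h => Set.preimage_mono (hm h))
    have hs' : ∀ t, γ t ∈ U (m + 1) := fun t => hm m.le_succ (hs (Set.mem_univ t))
    refine ⟨m + 1, ?_⟩
    change A.toPi0 a ^ (m + 1) * A.toPi0 x = A.toPi0 a ^ (m + 1) * A.toPi0 y
    rw [← toPi0_iter hη, ← toPi0_iter hη, ← hrf, ← hrf]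
    refine Quotient.sound (HCommSpace.joined_map (r (m + 1)) ⟨?_⟩)
    exact { toFun := fun t => ⟨γ t, hs' t⟩
            continuous_toFun := by fun_prop
            source' := Subtype.ext γ.source
            target' := Subtype.ext γ.target }
  · have key : ∀ (m : ℕ) (b : A.Hlgy R n),
        (MonoidAlgebra.single (B.toPi0 (f a)) 1 : MonoidAlgebra ℤ B.Pi0) ^ m •
          mapH A B R n (j m) b = mapH A B R n f b := by
      intro m b
      induction m with
      | zero => rw [pow_zero, one_smul, hj₀]
      | succ m ih =>
        rw [← ih, pow_succ, mul_smul, single_smul_hlgy, mapH_congr R n (hj m),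
          mapH_comp (B := B)]
    obtain ⟨m, b, rfl⟩ := exists_singHMap_eq R hU hm hT n c
    refine ⟨m, singHMap R n (r m) b, ?_⟩
    refine Eq.trans ?_ (key m (singHMap R n (r m) b))
    refine congrArg (fun c : B.Hlgy R n =>
      (MonoidAlgebra.single (B.toPi0 (f a)) 1 : MonoidAlgebra ℤ B.Pi0) ^ m • c) ?_
    rw [← singHMap_congr R n (hr m), singHMap_comp]
    rfl
  -- The image of `f` is only assumed to lie in the sets from `U 1` on. The class dies in some later
  -- `U (m + 1)`, and applying `r (m + 1)` shows that `η ^ (m + 1)`, hence the power of `a`, kills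
  -- `b`.
  · have h1 : singHMap R n (inclOf (U 1)) (singHMap R n (f' 0) b) = 0 := by
      refine Eq.trans ?_ hb
      exact (LinearMap.congr_fun (singHMap_comp R n (inclOf (U 1)) (f' 0)) b).symm
    obtain ⟨m, h, h2⟩ := exists_singHMap_eq_zero R hU hm hT n 1 _ h1
    obtain ⟨m, rfl⟩ := Nat.exists_eq_add_of_le' h
    refine ⟨m + 1, ?_⟩
    rw [← mapH_iter hη, ← hrf']
    have e : f' m = (inclOfLE (hm h)).comp (f' 0) := rfl
    refine (LinearMap.congr_fun (singHMap_comp R n (r (m + 1)) (f' m)) b).trans ?_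
    rw [e, singHMap_comp]
    exact (congrArg (singHMap R n (r (m + 1))) h2).trans (map_zero _)

end Criterion

end TelGC

end

noncomputable section

open unitInterval

namespace TelGC

/-! ## Fixed points -/

section FixedPoints

variable {G : Type w} [Group G] (K : Subgroup G)

theorem GHomotopic.fixMap {X Y : Type*} [TopologicalSpace X] [TopologicalSpace Y] [MulAction G X]
    [MulAction G Y] {f f' : C(X, Y)} (h : GHomotopic G f f') (hf : IsEquivariant G f)
    (hf' : IsEquivariant G f') : (fixMap K f hf).Homotopic (fixMap K f' hf') := by
  obtain ⟨H, hH⟩ := h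
  exact ⟨{ toFun := fun q => ⟨H (q.1, q.2.1), fun k hk => by rw [← hH, q.2.2 k hk]⟩
           continuous_toFun := by fun_prop
           map_zero_left := fun x => Subtype.ext (H.apply_zero x.1)
           map_one_left := fun x => Subtype.ext (H.apply_one x.1) }⟩

theorem IsGHMap.fixed {X Y : Type u} [TopologicalSpace X] [TopologicalSpace Y] [MulAction G X]
    [MulAction G Y] {A : GHCommSpace G X} {B : GHCommSpace G Y} {f : C(X, Y)}
    (hf : IsGHMap A B f) : IsHMap (A.fixed K) (B.fixed K) (fixMap K f hf.equivariant) where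
  map_e := Subtype.ext hf.map_e
  map_hmul := by
    obtain ⟨H, hH⟩ := hf.map_hmul
    exact ⟨{
      toFun := fun q => ⟨H (q.1, (q.2.1.1, q.2.2.1)), fun k hk => by
        rw [← hH, Prod.smul_mk, q.2.1.2 k hk, q.2.2.2 k hk]⟩
      continuous_toFun := by fun_prop
      map_zero_left := fun x => Subtype.ext (H.apply_zero (x.1.1, x.2.1))
      map_one_left := fun x => Subtype.ext (H.apply_one (x.1.1, x.2.1))
      prop' := fun t x hx => Subtype.ext (H.eq_fst t (by
        rw [Set.mem_singleton_iff.1 hx]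
        rfl)) }⟩

end FixedPoints

/-! ## The group completion -/

section GroupCompletion

variable {G : Type w} [Group G] {V : Type u} [NormedAddCommGroup V] [InnerProductSpace ℂ V]
  {ρ : G →* (V ≃ₗᵢ[ℂ] V)}

/-- The orthogonal complement. -/
def Gr.compl {n : ℕ} (p : Gr ρ n) : Gr ρ n :=
  Gr.of ρ (ContinuousLinearMap.id ℂ _ - p.1) (fun v => by simp [p.idem]) fun v w => by
    change inner ℂ (v - p.1 v) w = inner ℂ v (w - p.1 w)
    rw [inner_sub_left, inner_sub_right, p.symm]

theorem Gr.smul_compl {n : ℕ} (g : G) (p : Gr ρ n) : g • p.compl = (g • p).compl :=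
  Gr.ext fun v => by
    change diag ρ n g (diag ρ n g⁻¹ v - p.1 (diag ρ n g⁻¹ v)) =
      v - diag ρ n g (p.1 (diag ρ n g⁻¹ v))
    rw [map_sub, ← diag_mul, mul_inv_cancel, diag_one]

/-- A subspace and its orthogonal complement. -/
def OrthPair.compl {n : ℕ} (p : Gr ρ n) : OrthPair ρ n :=
  ⟨(p, p.compl), fun v => by
    change p.1 (v - p.1 v) = 0
    rw [map_sub, p.idem, sub_self]⟩

theorem OrthPair.sum_compl {n : ℕ} (p : Gr ρ n) : OrthPair.sum ρ n (compl p) = Gr.top ρ n :=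
  Gr.ext fun v => add_sub_cancel (p.1 v) v

theorem opInf_iter_etaInf (m : ℕ) (x : GrInf ρ) :
    opInf (iter (etaInf ρ) m x) = shift m (opInf x) := by
  induction m with
  | zero => rw [iter, ContinuousMap.id_apply, Nat.cast_zero, shift_zero]
  | succ m ih =>
    rw [iter, ContinuousMap.comp_apply, opInf_etaInf, ih, shift_shift]
    push_cast
    rw [add_comm]

theorem iter_fixMap (K : Subgroup G) (m : ℕ) (x : Fix K (GrInf ρ)) :
    (iter (fixMap K (etaInf ρ) (etaInf_smul ρ)) m x).1 = iter (etaInf ρ) m x.1 := by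
  induction m with
  | zero => rfl
  | succ m ih => exact congrArg (etaInf ρ) ih

/-- The point `V` of the infinite Grassmannian. -/
def unitInf (ρ : G →* (V ≃ₗᵢ[ℂ] V)) : GrInf ρ := etaInf ρ (zeroInf ρ)

theorem opInf_unitInf : opInf (unitInf ρ) = shift 1 (negProj V) := by
  rw [unitInf, opInf_etaInf, opInf_zeroInf]

theorem smul_unitInf (g : G) : g • unitInf ρ = unitInf ρ := by
  rw [unitInf, ← etaInf_smul, smul_zeroInf]

variable [FiniteDimensional ℂ V]

/-- The retraction of a part of the telescope onto a stage. -/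
def retract (m : ℕ) (z : GrTel ρ) : GrInf ρ :=
  if h : timeTel z < m then ofOpInf ρ (shift m (opTel z)) (by
    obtain ⟨a, b, ha, hP⟩ := exists_isPt_opTel z
    exact ⟨_, isPt_shift hP (Nat.cast_le.1 (ha.trans h.le))⟩) else zeroInf ρ

theorem opInf_retract {m : ℕ} {z : GrTel ρ} (h : timeTel z < m) :
    opInf (retract m z) = shift m (opTel z) := by
  rw [retract, dif_pos h, opInf_ofOpInf]

theorem retract_smul (m : ℕ) (g : G) {z : GrTel ρ} (h : timeTel z < m) :
    retract m (g • z) = g • retract m z := opInf_injective (by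
  rw [opInf_smul, opInf_retract h, opInf_retract (by rwa [timeTel_smul]), opTel_smul, actOp_shift])

theorem continuousOn_retract (m : ℕ) : ContinuousOn (retract m) {z : GrTel ρ | timeTel z < m} := by
  have hU : IsOpen {z : GrTel ρ | timeTel z < m} := isOpen_lt continuous_timeTel continuous_const
  refine (isCompactFamily_tel ρ).continuousOn hU fun i => ?_
  by_cases hi : i.1 ≤ m
  · have hP : ∀ q : Gr ρ i.2 × I, IsPt 0 (i.2 + m)
        (shift m (opTel (cylTel ρ i.1 (toInf ρ i.2 q.1, q.2)))) := fun q =>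
      isPt_shift (isPt_opTel_cyl i q) hi
    have hc : Continuous fun q : Gr ρ i.2 × I => ofOpInf ρ _ ⟨_, hP q⟩ := by
      refine continuous_of_opInf ?_ (n := i.2 + m) fun q => ?_
      · simp only [opInf_ofOpInf]
        exact (finCont_opTel_cyl i).shift _
      · rw [opInf_ofOpInf]
        exact hP q
    refine hc.continuousOn.congr fun q hq => opInf_injective ?_
    rw [opInf_ofOpInf]
    exact opInf_retract hq
  -- A cylinder that begins after time `m` does not meet the region.
  · refine (continuousOn_empty _).mono fun q hq => hi ?_
    have h : timeTel (cylTel ρ i.1 (toInf ρ i.2 q.1, q.2)) < m := hq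
    exact Nat.cast_le.1 ((le_timeTel_cyl i q).trans h.le)

/-- Retracting to stage `m` and returning keeps the operator and changes only the time, to `m`; so
the flow deforms the identity into it. -/
theorem toTel_retract {m : ℕ} {z : GrTel ρ} (h : timeTel z < m) :
    toTel ρ m (retract m z) = flow z (m - timeTel z) :=
  opTel_timeTel_injective
    (by rw [opTel_toTel, opInf_retract h, shift_shift, neg_add_cancel, shift_zero, opTel_flow])
    (by rw [timeTel_toTel, timeTel_flow, max_eq_left (sub_nonneg.2 h.le), add_sub_cancel])

/-- The translation of operators on the telescope. -/
def telShift (z : GrTel ρ) : GrTel ρ := ofTel ρ (shift 1 (opTel z)) (timeTel z) (by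
  obtain ⟨a, b, ha, h⟩ := exists_isPt_opTel z
  -- Enlarging `a` to `a + 1` first leaves room for the translation also when `a = 0`, and the bound
  -- returns to `a`, so the time need not change.
  exact ⟨a, b + 1, ha, (h.mono a.le_succ le_rfl).shift (by push_cast; ring) (by push_cast; ring)⟩)

theorem opTel_telShift (z : GrTel ρ) : opTel (telShift z) = shift 1 (opTel z) := opTel_ofTel _

theorem timeTel_telShift (z : GrTel ρ) : timeTel (telShift z) = timeTel z := timeTel_ofTel _

theorem continuous_telShift : Continuous (telShift : GrTel ρ → GrTel ρ) := by
  refine (isCompactFamily_tel ρ).continuous_iff.2 fun i => ?_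
  refine continuous_of_opTel (a := i.1) (b := i.2 + 1) ?_ ?_ (fun q => ?_) fun q => ?_
  · simp only [Function.comp_apply, opTel_telShift]
    exact (finCont_opTel_cyl i).shift 1
  · simp only [Function.comp_apply, timeTel_telShift]
    exact continuous_timeTel.comp ((isCompactFamily_tel ρ).cont i)
  · simp only [Function.comp_apply, opTel_telShift]
    exact ((isPt_opTel_cyl i q).mono (Nat.le_succ _) le_rfl).shift (by push_cast; ring)
      (by push_cast; ring)
  · simp only [Function.comp_apply, timeTel_telShift]
    exact le_timeTel_cyl i q

/-- The translation of operators on the telescope as a map. -/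
def telShiftMap (ρ : G →* (V ≃ₗᵢ[ℂ] V)) : C(GrTel ρ, GrTel ρ) := ⟨telShift, continuous_telShift⟩

theorem telShiftMap_smul : IsEquivariant G (telShiftMap ρ) := fun g z =>
  opTel_timeTel_injective
    (by
      refine (opTel_telShift _).trans ?_
      rw [opTel_smul, opTel_smul, ← actOp_shift]
      exact congrArg _ (opTel_telShift z).symm)
    (by
      refine (timeTel_telShift _).trans ?_
      rw [timeTel_smul, timeTel_smul]
      exact (timeTel_telShift z).symm)

/-- Adding `V` is homotopic to `η`. -/
theorem gHomotopic_add_unit {μ : C(GrInf ρ × GrInf ρ, GrInf ρ)} (h : IsGammaProduct ρ μ) :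
    GHomotopic G (μ.comp ((ContinuousMap.const _ (unitInf ρ)).prodMk (.id _))) (etaInf ρ) := by
  have he : IsEquivariant G ((ContinuousMap.const (GrInf ρ) (unitInf ρ)).prodMk (.id _)) :=
    fun g _ => Prod.ext (smul_unitInf g).symm rfl
  have e : (sumMap ρ).comp ((ContinuousMap.const _ (unitInf ρ)).prodMk (.id _)) =
      (etaInf ρ).comp (evenIsom ρ).actMap.1 := ContinuousMap.ext fun x => opInf_injective (by
    rw [ContinuousMap.comp_apply, opInf_sumMap, ContinuousMap.comp_apply, opInf_etaInf]
    change isum (opInf (unitInf ρ)) (opInf x) = shift 1 (opInf ((evenIsom ρ).act x))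
    rw [opInf_unitInf, isum_shift_negProj]
    exact congrArg _ (opInf_act_ofEmb _ x).symm)
  refine (h.gHomotopic.comp_right he).trans ?_
  rw [e]
  exact (gHomotopicRel_actMap expands_evenEmb).toGHomotopic.comp_left (etaInf_smul ρ)

theorem telMul_unit_smul : IsEquivariant G ((telMulMap ρ).comp
    ((ContinuousMap.const _ (toTel ρ 0 (unitInf ρ))).prodMk (.id _))) :=
  telMulMap_smul.comp fun g _ => Prod.ext (congrArg (toTel ρ 0) (smul_unitInf g)).symm rfl

/-- Adding `V` in the telescope is homotopic to the translation. -/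
theorem gHomotopic_telMul_unit : GHomotopic G ((telMulMap ρ).comp
    ((ContinuousMap.const _ (toTel ρ 0 (unitInf ρ))).prodMk (.id _))) (telShiftMap ρ) := by
  have h := (gHomotopicRel_telMap (ρ := ρ) expands_evenEmb).toGHomotopic.comp_left
    (telShiftMap_smul (ρ := ρ))
  refine (gHomotopic_of_opTel telMul_unit_smul
    (telShiftMap_smul.comp (Subtype.prop _)) fun z => ?_).trans h
  change opTel (telMul (toTel ρ 0 (unitInf ρ)) z) = opTel (telShift ((evenIsom ρ).telAct z))
  rw [opTel_telMul, opTel_telShift, opTel_toTel, opInf_unitInf, Nat.cast_zero, neg_zero, shift_zero,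
    isum_shift_negProj]
  exact congrArg _ (opTel_telAct_ofEmb _ z).symm

/-- The inclusions of consecutive stages differ by the addition of `V`. -/
theorem gHomotopic_toTel_succ (m : ℕ) : GHomotopic G (toTel ρ m) (((telMulMap ρ).comp
    ((ContinuousMap.const _ (toTel ρ 0 (unitInf ρ))).prodMk (.id _))).comp (toTel ρ (m + 1))) := by
  refine GHomotopic.trans ?_ (gHomotopic_telMul_unit.comp_right (toTel_smul (m + 1))).symm
  refine gHomotopic_of_opTel (toTel_smul m) (telShiftMap_smul.comp (toTel_smul _)) fun x => ?_
  change opTel (toTel ρ m x) = opTel (telShift (toTel ρ (m + 1) x))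
  rw [opTel_telShift, opTel_toTel, opTel_toTel, shift_shift]
  push_cast
  ring_nf

/-- The sum of a subspace and a complement is the whole space. -/
theorem exists_compl {K : Subgroup G} (x : Fix K (GrInf ρ)) : ∃ (n : ℕ) (y : Fix K (GrInf ρ)),
    Joined (fixMap K (sumMap ρ) sumMap_smul ⟨(x.1, y.1), fun k hk => Prod.ext (x.2 k hk) (y.2 k hk)⟩)
      (iter (fixMap K (etaInf ρ) (etaInf_smul ρ)) n
        ⟨zeroInf ρ, fun k _ => smul_zeroInf k⟩) := by
  obtain ⟨⟨n, (p : Gr ρ n)⟩, hx⟩ := x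
  have hp : ∀ k ∈ K, k • p = p := fun k hk => Gr.op_injective (by
    have := congrArg opInf (hx k hk)
    exact this)
  let w : OrthInf ρ := (orthSeq ρ).ι n (OrthPair.compl p)
  have hw : inclInf ρ w = (toInf ρ n p, toInf ρ n p.compl) := rfl
  have hy : ∀ k ∈ K, k • toInf ρ n p.compl = toInf ρ n p.compl := fun k hk =>
    congrArg (toInf ρ n)
      ((Gr.smul_compl (ρ := ρ) k p).trans (congrArg (Gr.compl (ρ := ρ)) (hp k hk)))
  have hwK : ∀ k ∈ K, k • w = w := fun k hk => inclInf_injective (by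
    rw [inclInf_smul, hw]
    exact Prod.ext (hx k hk) (hy k hk))
  -- On the orthogonal pair `w` this homotopy is a path of fixed points from the interleaved sum to
  -- the honest direct sum, which is all of `V^n`, that is, the `n`-th iterate of `η` at zero.
  have h := gHomotopic_interleave_inclInf (ρ := ρ) |>.comp_left (sumInf_smul (ρ := ρ))
  have h' := HCommSpace.joined_of_homotopic (h.fixMap K
    (IsEquivariant.comp sumInf_smul (interleave_smul.comp inclInf_smul))
    (IsEquivariant.comp sumInf_smul IsEquivariant.id)) ⟨w, hwK⟩
  refine ⟨n, ⟨toInf ρ n p.compl, hy⟩, ?_⟩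
  have e : fixMap K ((sumInf ρ).comp (.id _)) (IsEquivariant.comp sumInf_smul IsEquivariant.id)
      ⟨w, hwK⟩ = iter (fixMap K (etaInf ρ) (etaInf_smul ρ)) n
        ⟨zeroInf ρ, fun k _ => smul_zeroInf k⟩ := by
    refine Subtype.ext (opInf_injective ?_)
    rw [iter_fixMap, opInf_iter_etaInf, opInf_zeroInf, negProj, shift_dg]
    refine (congrArg (fun p => opInf (toInf ρ n p)) (OrthPair.sum_compl p)).trans ?_
    rw [opInf_toInf, Gr.op_top]
    simp only [sub_neg]
  rw [e] at h'
  exact h'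

end GroupCompletion

end TelGC

end

noncomputable section

open unitInterval

namespace TelGC

/-! ## The canonical map to the telescope is a group completion -/

section Main

variable {G : Type w} [Group G] {V : Type u} [NormedAddCommGroup V] [InnerProductSpace ℂ V]
  {ρ : G →* (V ≃ₗᵢ[ℂ] V)} [FiniteDimensional ℂ V] {A : GHCommSpace G (GrInf ρ)}

/-- At stage zero the product of the telescope restricts strictly to `sumMap`, so only the homotopy
from `μ` to `sumMap` matters; it is based because zero is isolated. -/
theorem isGHMap_toTel (hμ : IsGammaProduct ρ A.hmul) (he : A.e = zeroInf ρ) :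
    IsGHMap A (telHSpace ρ) (toTel ρ 0) where
  equivariant := toTel_smul 0
  map_e := congrArg (toTel ρ 0) he
  map_hmul := by
    have h := (hμ.gHomotopic.rel (x := (A.e, A.e)) (A.hmul_e_e.trans he) isClopen_zeroInf).comp_left
      (toTel_smul (ρ := ρ) 0)
    have e : (toTel ρ 0).comp (sumMap ρ) = (telMulMap ρ).comp ((toTel ρ 0).prodMap (toTel ρ 0)) :=
      (telMulMap_comp_toTel 0).symm
    rw [e] at h
    exact h

/-- The part of the fixed points of the telescope in front of `m`. -/
def front (ρ : G →* (V ≃ₗᵢ[ℂ] V)) (K : Subgroup G) (m : ℕ) : Set (Fix K (GrTel ρ)) :=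
  {z | timeTel z.1 < m}

/-- The retraction onto a stage. -/
def retractFix (K : Subgroup G) (m : ℕ) : C(front ρ K m, Fix K (GrInf ρ)) where
  toFun z := ⟨retract m z.1.1, fun k hk => by rw [← retract_smul m k z.2, z.1.2 k hk]⟩
  continuous_toFun := Continuous.subtype_mk ((continuousOn_retract m).comp_continuous
    (continuous_subtype_val.comp continuous_subtype_val) fun z => z.2) _

/-- The homotopy flows each point forward to time `m`. -/
theorem retractFix_homotopic (K : Subgroup G) (m : ℕ) :
    ((fixMap K (toTel ρ m) (toTel_smul m)).comp (retractFix K m)).Homotopic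
      (inclOf (front ρ K m)) := by
  refine ContinuousMap.Homotopic.symm ⟨{
    toFun := fun q => ⟨flow q.2.1.1 (q.1 * (m - timeTel q.2.1.1)), fun k hk => by
      rw [← flow_smul, q.2.1.2 k hk]⟩
    continuous_toFun := ?_
    map_zero_left := fun z => Subtype.ext ?_
    map_one_left := fun z => Subtype.ext ?_ }⟩
  · have hz : Continuous fun q : I × front ρ K m => q.2.1.1 :=
      continuous_subtype_val.comp (continuous_subtype_val.comp continuous_snd)
    exact Continuous.subtype_mk (continuous_flow.comp (hz.prodMk
      ((continuous_subtype_val.comp continuous_fst).mul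
        (continuous_const.sub (continuous_timeTel.comp hz))))) _
  · change flow z.1.1 (((0 : I) : ℝ) * _) = _
    rw [Set.Icc.coe_zero, zero_mul, flow_zero]
    rfl
  · change flow z.1.1 (((1 : I) : ℝ) * _) = toTel ρ m (retract m z.1.1)
    rw [Set.Icc.coe_one, one_mul, toTel_retract z.2]

theorem isEquivariantHomotopyGroupCompletion_toTel (hμ : IsGammaProduct ρ A.hmul)
    (he : A.e = zeroInf ρ) :
    IsEquivariantHomotopyGroupCompletion.{u, v, w} A (telHSpace ρ) (toTel ρ 0) where
  isGHMap := isGHMap_toTel hμ he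
  fixed K := by
    have hf := (isGHMap_toTel hμ he).fixed K
    let B := (telHSpace ρ).fixed K
    let f := fixMap K (toTel ρ 0) (toTel_smul 0)
    let a : Fix K (GrInf ρ) := ⟨unitInf ρ, fun k _ => smul_unitInf k⟩
    let o : Fix K (GrInf ρ) := ⟨zeroInf ρ, fun k _ => smul_zeroInf k⟩
    let j : ℕ → C(Fix K (GrInf ρ), Fix K (GrTel ρ)) := fun m => fixMap K (toTel ρ m) (toTel_smul m)
    have hη : ((A.fixed K).leftMul a).Homotopic (fixMap K (etaInf ρ) (etaInf_smul ρ)) :=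
      (gHomotopic_add_unit hμ).fixMap K (hμ.equivariant.comp
        fun g _ => Prod.ext (smul_unitInf g).symm rfl) (etaInf_smul ρ)
    have hj : ∀ m, (j m).Homotopic ((B.leftMul (f a)).comp (j (m + 1))) := fun m =>
      (gHomotopic_toTel_succ m).fixMap K (toTel_smul m) (telMul_unit_smul.comp (toTel_smul (m + 1)))
    have hr := retractFix_homotopic (ρ := ρ) K
    have hT : ∀ z : Fix K (GrTel ρ), ∃ m, z ∈ front ρ K m := fun z =>
      exists_nat_gt (timeTel z.1)
    have ho : (A.fixed K).e = o := Subtype.ext he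
    have hfo : B.toPi0 (f o) = 1 := rfl
    -- The inverse of the class of `V` is the zero subspace placed in stage `1`.
    have hfa : IsUnit (B.toPi0 (f a)) := by
      refine IsUnit.of_mul_eq_one (B.toPi0 (j 1 o)) ?_
      rw [← HCommSpace.toPi0_mul, ← hfo]
      exact (Quotient.sound (HCommSpace.joined_of_homotopic (hj 0) o)).symm
    -- A fixed subspace and its complement add up to a power of the class of `V`, and a factor of a
    -- unit is a unit.
    have hfx : ∀ x, IsUnit (B.toPi0 (f x)) := by
      intro x
      obtain ⟨n, y, hy⟩ := exists_compl x
      have h1 : Joined ((A.fixed K).hmul (x, y))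
          (iter (fixMap K (etaInf ρ) (etaInf_smul ρ)) n o) :=
        (HCommSpace.joined_of_homotopic (hμ.gHomotopic.fixMap K hμ.equivariant sumMap_smul)
          ⟨(x.1, y.1), fun k hk => Prod.ext (x.2 k hk) (y.2 k hk)⟩).trans hy
      have h2 : (A.fixed K).toPi0 x * (A.fixed K).toPi0 y = (A.fixed K).toPi0 a ^ n := by
        rw [← HCommSpace.toPi0_mul]
        refine (Quotient.sound h1).trans ((toPi0_iter hη n o).trans ?_)
        rw [← ho, HCommSpace.toPi0_e, mul_one]
      have h3 : B.toPi0 (f x) * B.toPi0 (f y) = B.toPi0 (f a) ^ n := by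
        have := congrArg hf.pi0 h2
        rw [map_mul, map_pow] at this
        exact this
      exact isUnit_of_mul_isUnit_left (h3 ▸ hfa.pow n)
    have hB : ∀ b : B.Pi0, IsUnit b := by
      rintro ⟨z⟩
      obtain ⟨m, hz⟩ := hT z
      -- Classes from later stages differ from classes from stage zero by powers of the class of
      -- `V`; every point flows into such a stage.
      have hjm : ∀ m x, IsUnit (B.toPi0 (j m x)) := by
        intro m x
        induction m with
        | zero => exact hfx x
        | succ m ih =>
          have h1 : B.toPi0 (j m x) = B.toPi0 (f a) * B.toPi0 (j (m + 1) x) :=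
            Quotient.sound (HCommSpace.joined_of_homotopic (hj m) x)
          exact isUnit_of_mul_isUnit_right (h1 ▸ ih)
      have h2 : B.toPi0 (j m (retractFix K m ⟨z, hz⟩)) = B.toPi0 z :=
        Quotient.sound (HCommSpace.joined_of_homotopic (hr m) ⟨z, hz⟩)
      have h3 := hjm m (retractFix K m ⟨z, hz⟩)
      rw [h2] at h3
      exact h3
    refine isHomotopyGroupCompletion_of_telescope hf hB hη (U := front ρ K)
      (fun m => isOpen_lt (continuous_timeTel.comp continuous_subtype_val) continuous_const)
      (fun m n h z (hz : timeTel z.1 < m) => hz.trans_le (Nat.cast_le.2 h)) hT (retractFix K) j rfl hj hr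
      (fun m x => ?_) fun m x => Subtype.ext (opInf_injective ?_)
    · change timeTel (toTel ρ 0 x.1) < _
      rw [timeTel_toTel]
      exact_mod_cast m.succ_pos
    · rw [iter_fixMap, opInf_iter_etaInf]
      refine (opInf_retract ?_).trans ?_
      · change timeTel (toTel ρ 0 x.1) < _
        rw [timeTel_toTel]
        exact_mod_cast m.succ_pos
      · change shift _ (opTel (toTel ρ 0 x.1)) = _
        rw [opTel_toTel, Nat.cast_zero, neg_zero, shift_zero]

end Main

end TelGC

end

theorem mainTheorem10 {G : Type w} [Group G] [Finite G] {V : Type u} [NormedAddCommGroup V]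
    [InnerProductSpace ℂ V] [FiniteDimensional ℂ V] (ρ : G →* (V ≃ₗᵢ[ℂ] V)) :
    (∃ μ, IsGammaProduct ρ μ) ∧
    ∀ μ, IsGammaProduct ρ μ →
      ∃ (A : GHCommSpace G (GrInf ρ)) (B : GHCommSpace G (GrTel ρ)),
        A.hmul = μ ∧ A.e = zeroInf ρ ∧ B.e = toTel ρ 0 (zeroInf ρ) ∧
        (∀ n, GHomotopic G (B.hmul.comp ((toTel ρ n).prodMap (toTel ρ n)))
          ((toTel ρ (2 * n)).comp μ)) ∧
        IsEquivariantHomotopyGroupCompletion.{u, v, w} A B (toTel ρ 0) := by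
  refine ⟨⟨sumMap ρ, isGammaProduct_sumMap⟩, fun μ hμ => ?_⟩
  obtain ⟨A, rfl, he⟩ := hμ.exists_gHCommSpace
  exact ⟨A, telHSpace ρ, rfl, he, rfl, hμ.gHomotopic_toTel,
    isEquivariantHomotopyGroupCompletion_toTel hμ he⟩
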